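/- A mechanical billiard consists of a surface with a Riemannian metric $g$, a force function $U$ (smooth outside a singular set), and a reflection wall $B$. A particle moves according to $\nabla_{\dot q}\dot q=\nabla U(q)$ and is reflected elastically at $B$: the component of the velocity tangent to $B$ is kept, and the normal component changes sign. Let $E(q,v)=\frac12 g_q(v,v)-U(q)$ be the energy. The billiard is called integrable if there is a smooth function $F$ on the phase space (the tangent bundle of the surface without the singular set) that is constant along all motions, is invariant under the reflections at $B$, and is functionally independent of $E$ (the differentials of $E$ and $F$ are linearly independent on a dense set). Let $m_1,m_2,f\in\mathbb R$ be arbitrary. The Lagrange problem with Kepler centres $Z_1,Z_2$ is given by the following force functions, where a term with zero coefficient causes no singularity. * In the plane $\mathbb R^2$, with $Z_1,Z_2\in\mathbb R^2$: $U=\frac{m_1}{\|q-Z_1\|}+\frac{m_2}{\|q-Z_2\|}+f\,\|q-\frac{Z_1+Z_2}2\|^2$. * On the unit sphere $\mathcal S\subset\mathbb R^3$, with $Z_2\notin\{Z_1,-Z_1\}$: $U=m_1\cot\theta_{Z_1}+m_2\cot\theta_{Z_2}+f\tan^2\theta_{Z_{mid}}$, where $\theta_P$ is the central angle to $P$. *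 In the hyperbolic plane $\mathcal H_S=\{\langle q,q\rangle=-1,\ z<0\}$, where $\langle\cdot,\cdot\rangle$ is the form $dx^2+dy^2-dz^2$: $U=m_1\coth\theta_{Z_1}+m_2\coth\theta_{Z_2}+f\tanh^2\theta_{Z_{mid}}$, where $\theta_P$ is the hyperbolic distance to $P$. In the last two cases $Z_{mid}$ is the midpoint of $Z_1,Z_2$. Theorem. In each of these three geometries there is one function $F$ that makes the billiard integrable for every wall $B$ that is a combination of confocal conic sections with foci $Z_1,Z_2$. That is, $B$ is contained in the union of finitely many sets of the form $\{d(q,Z_1)+d(q,Z_2)=s\}$ with $s>d(Z_1,Z_2)$ (on the sphere also $s<2\pi-d(Z_1,Z_2)$) or $\{|d(q,Z_1)-d(q,Z_2)|=s\}$ with $0\le s<d(Z_1,Z_2)$, where $d$ is the distance. Moreover, $F$ is the energy of the Lagrange problem that corresponds under central projection, as follows. Put $\varepsilon=1$ and let $\langle\cdot,\cdot\rangle$ be the Euclidean product for the sphere; put $\varepsilon=-1$ for the hyperbolic plane. Write $M=Z_{mid}$ and let $P=\{x:\langle x,M\rangle=\varepsilon\}$ be the tangent plane at $M$. Let $\tilde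 q=q/(\varepsilon\langle q,M\rangle)$ be the central projection of $q$ to $P$, and let $a=\langle\tilde Z_1-M,\tilde Z_1-M\rangle^{1/2}$. Give $P$ the norm $\|u\|_a^2=x^2+\frac{y^2}{1+\varepsilon a^2}$ in orthonormal coordinates with the $y$-axis in the direction of $\tilde Z_1-M$. A velocity $v$ at $q$ corresponds to $\tilde v=\varepsilon(\langle q,M\rangle v-\langle v,M\rangle q)$. * Hyperbolic plane: $F(q,v)$ is the value at $(\tilde q,\tilde v)$ of the energy of the Lagrange problem in $(P,\|\cdot\|_a)$ with Kepler centres $\tilde Z_1,\tilde Z_2$, mass factors $m_i/\sqrt{1-a^2}$ and Hooke factor $f$. * Sphere: the same with mass factors $m_i/\sqrt{1+a^2}$ on the hemisphere $\langle q,M\rangle>0$, and with $-m_i/\sqrt{1+a^2}$ on the opposite open hemisphere (the analytic continuation). * Plane: there are non-antipodal points $W_1,W_2\in\mathcal S$, a number $r>0$ and an affine map $\iota$ from $\mathbb R^2$ to the tangent plane $P$ of $\mathcal S$ at the midpoint of $W_1,W_2$, with linear part $T$, such that $\iota(Z_i)=\tilde W_i$ and $\|Tu\|_a=r\|u\|$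 (with $a$ formed from $W_1,W_2$). For these, $F(q,v)$ is the energy of the spherical Lagrange problem with centres $W_1,W_2$, mass factors $\sqrt{1+a^2}\,r^3m_i$ and Hooke factor $f$, at the point $x/\|x\|$ with velocity $\|x\|Tv-\frac{\langle x,Tv\rangle}{\|x\|}x$, where $x=\iota(q)$. -/

import Mathlib

open scoped ContDiff

noncomputable section

/-- The Euclidean plane. -/
abbrev Plane : Type := EuclideanSpace ℝ (Fin 2)

/-- The three-dimensional coordinate space that contains the sphere and the hyperboloid. -/
abbrev Space : Type := EuclideanSpace ℝ (Fin 3)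

/-- A natural mechanical system on an embedded surface `carrier` of a finite-dimensional vector
space `E`. The Riemannian metric of the surface is the restriction of the bilinear form `metric`
to its tangent spaces, and `force` is the force function (minus the potential). Singular points
of the force function are not part of `carrier`. -/
structure MechanicalSystem (E : Type) [NormedAddCommGroup E] [NormedSpace ℝ E] where
  /-- the configuration surface -/
  carrier : Set E
  /-- the ambient bilinear form that induces the metric -/
  metric : LinearMap.BilinForm ℝ E
  /-- the force function -/
  force : E → ℝ

namespace MechanicalSystem

section

variable {E : Type} [NormedAddCommGroup E] [NormedSpace ℝ E]

/-- The tangent bundle of the configuration surface: pairs (position, velocity). -/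
def phaseSpace (S : MechanicalSystem E) : Set (E × E) :=
  {p | p.1 ∈ S.carrier ∧ p.2 ∈ tangentConeAt ℝ S.carrier p.1}

/-- The total energy: kinetic energy minus force function. -/
def energy (S : MechanicalSystem E) (p : E × E) : ℝ :=
  S.metric p.2 p.2 / 2 - S.force p.1

/-- `γ` solves the equation of motion `∇_γ' γ' = grad U` on the open interval `I`.
The Levi-Civita derivative `∇_γ' γ'` is the tangential part of `γ''`, so the equation says that
the differential of `U` along the surface at `γ t` is `u ↦ metric (γ'' t) u`; the values of this
form on normal vectors do not matter for the derivative within the surface. -/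
def IsMotion [FiniteDimensional ℝ E] (S : MechanicalSystem E) (I : Set ℝ) (γ : ℝ → E) : Prop :=
  IsOpen I ∧ I.OrdConnected ∧ ∀ t ∈ I,
    γ t ∈ S.carrier ∧ DifferentiableAt ℝ γ t ∧ DifferentiableAt ℝ (deriv γ) t ∧
    HasFDerivWithinAt S.force
      (LinearMap.toContinuousLinearMap (S.metric (deriv (deriv γ) t))) S.carrier (γ t)

/-- `F` is constant along all motions. -/
def IsFirstIntegral [FiniteDimensional ℝ E] (S : MechanicalSystem E) (F : E × E → ℝ) : Prop :=
  ∀ (I : Set ℝ) (γ : ℝ → E), S.IsMotion I γ →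
    ∀ s ∈ I, ∀ t ∈ I, F (γ s, deriv γ s) = F (γ t, deriv γ t)

/-- Elastic reflection of the velocity `v` into the velocity `w` at the point `q` of the wall `B`:
the component tangent to the wall is kept, the normal component changes its sign. At a corner
of the wall either of the tangent directions may be used. -/
def IsReflection (S : MechanicalSystem E) (B : Set E) (q v w : E) : Prop :=
  q ∈ B ∧ (q, v) ∈ S.phaseSpace ∧ (q, w) ∈ S.phaseSpace ∧
  ∃ τ ∈ tangentConeAt ℝ B q, τ ≠ 0 ∧
    ∃ (k : ℝ) (n : E), S.metric n τ = 0 ∧ v = k • τ + n ∧ w = k • τ - n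

/-- `F` is the restriction to the phase space of a smooth function on a neighbourhood. -/
def IsSmooth (S : MechanicalSystem E) (F : E × E → ℝ) : Prop :=
  ∃ (O : Set (E × E)) (G : E × E → ℝ), IsOpen O ∧ S.phaseSpace ⊆ O ∧
    ContDiffOn ℝ ∞ G O ∧ Set.EqOn F G S.phaseSpace

/-- At the point `p` of the phase space the functions `F` and `G` have differentials along the
phase space, and these are linearly independent. -/
def IndependentAt (S : MechanicalSystem E) (F G : E × E → ℝ) (p : E × E) : Prop :=
  ∃ L₁ L₂ : E × E →L[ℝ] ℝ,
    HasFDerivWithinAt F L₁ S.phaseSpace p ∧ HasFDerivWithinAt G L₂ S.phaseSpace p ∧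
    ∀ a b : ℝ, (∀ u ∈ tangentConeAt ℝ S.phaseSpace p, a * L₁ u + b * L₂ u = 0) → a = 0 ∧ b = 0

/-- `F` is an additional first integral of the mechanical billiard with system `S` and reflection
wall `B`: a smooth first integral of `S`, invariant under the reflections at `B`, and functionally
independent of the energy, that is, with independent differentials on a dense set. The billiard
is integrable if such an `F` exists. -/
structure IsAdditionalIntegral [FiniteDimensional ℝ E] (S : MechanicalSystem E) (B : Set E)
    (F : E × E → ℝ) : Prop where
  smooth : S.IsSmooth F
  firstIntegral : S.IsFirstIntegral F
  reflection : ∀ q v w : E, S.IsReflection B q v w → F (q, v) = F (q, w)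
  independent : S.phaseSpace ⊆ closure {p ∈ S.phaseSpace | S.IndependentAt S.energy F p}

end

end MechanicalSystem

section Conics

variable {E : Type}

/-- The ellipse in `M` with foci `Z₁`, `Z₂` and sum of the focal distances `s`. -/
def focalEllipse (M : Set E) (d : E → E → ℝ) (Z₁ Z₂ : E) (s : ℝ) : Set E :=
  {q ∈ M | d q Z₁ + d q Z₂ = s}

/-- The hyperbola (both branches) in `M` with foci `Z₁`, `Z₂` and difference of the focal
distances `s`. -/
def focalHyperbola (M : Set E) (d : E → E → ℝ) (Z₁ Z₂ : E) (s : ℝ) : Set E :=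
  {q ∈ M | |d q Z₁ - d q Z₂| = s}

/-- Conic sections with foci `Z₁`, `Z₂` for a distance `d` on `M` without upper bound. The
hyperbola with `s = 0` is the perpendicular bisector of the foci. -/
def IsFocalConic (M : Set E) (d : E → E → ℝ) (Z₁ Z₂ : E) (C : Set E) : Prop :=
  (∃ s : ℝ, d Z₁ Z₂ < s ∧ C = focalEllipse M d Z₁ Z₂ s) ∨
  (∃ s : ℝ, 0 ≤ s ∧ s < d Z₁ Z₂ ∧ C = focalHyperbola M d Z₁ Z₂ s)

/-- A combination of conic sections of the given family: a wall all of whose pieces lie on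
finitely many members of the family. -/
def IsCombination (family : Set E → Prop) (B : Set E) : Prop :=
  ∃ 𝒞 : Set (Set E), 𝒞.Finite ∧ (∀ C ∈ 𝒞, family C) ∧ B ⊆ ⋃₀ 𝒞

end Conics

/-- The Lagrange problem on an affine plane `A` with the Euclidean metric given by `g`: Kepler
centres `Z₁`, `Z₂` with mass factors `m₁`, `m₂` and a Hooke centre with factor `f` at their
midpoint. A Kepler centre is a singularity only if its mass factor is not zero. -/
def flatLagrange {E : Type} [NormedAddCommGroup E] [NormedSpace ℝ E] (A : Set E)
    (g : LinearMap.BilinForm ℝ E) (Z₁ Z₂ : E) (m₁ m₂ f : ℝ) : MechanicalSystem E where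
  carrier := {q ∈ A | (m₁ ≠ 0 → q ≠ Z₁) ∧ (m₂ ≠ 0 → q ≠ Z₂)}
  metric := g
  force q :=
    m₁ / √(g (q - Z₁) (q - Z₁)) + m₂ / √(g (q - Z₂) (q - Z₂))
      + f * g (q - midpoint ℝ Z₁ Z₂) (q - midpoint ℝ Z₁ Z₂)

/-- The Lagrange problem in the Euclidean plane. -/
def planarLagrange (Z₁ Z₂ : Plane) (m₁ m₂ f : ℝ) : MechanicalSystem Plane :=
  flatLagrange Set.univ (innerₗ Plane) Z₁ Z₂ m₁ m₂ f

/-- The Minkowski form `dx² + dy² - dz²`. -/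
def minkowski : LinearMap.BilinForm ℝ Space :=
  LinearMap.mk₂ ℝ (fun x y => x 0 * y 0 + x 1 * y 1 - x 2 * y 2)
    (fun x x' y => by simp only [PiLp.add_apply]; ring)
    (fun c x y => by simp only [PiLp.smul_apply, smul_eq_mul]; ring)
    (fun x y y' => by simp only [PiLp.add_apply]; ring)
    (fun c x y => by simp only [PiLp.smul_apply, smul_eq_mul]; ring)

/-- The unit sphere. -/
def unitSphere : Set Space := Metric.sphere 0 1

/-- The lower sheet of the two-sheeted hyperboloid: the hyperbolic plane. -/
def hyperbolicPlane : Set Space := {q | minkowski q q = -1 ∧ q 2 < 0}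

/-- The distance on the unit sphere: the central angle. -/
def sphereDist (p q : Space) : ℝ := InnerProductGeometry.angle p q

/-- The distance in the hyperbolic plane: the hyperbolic central angle. -/
def hyperbolicDist (p q : Space) : ℝ := Real.arcosh (-minkowski p q)

/-- Spherical conic sections with foci `Z₁`, `Z₂`. The ellipse with `s = π` and the hyperbola with
`s = 0` are great circles. -/
def IsSphericalConic (Z₁ Z₂ : Space) (C : Set Space) : Prop :=
  (∃ s : ℝ, sphereDist Z₁ Z₂ < s ∧ s < 2 * Real.pi - sphereDist Z₁ Z₂ ∧
    C = focalEllipse unitSphere sphereDist Z₁ Z₂ s) ∨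
  (∃ s : ℝ, 0 ≤ s ∧ s < sphereDist Z₁ Z₂ ∧
    C = focalHyperbola unitSphere sphereDist Z₁ Z₂ s)

/-- The midpoint of two points of the quadric `g q q = ε`, where `ε = 1` for the sphere and
`ε = -1` for the hyperboloid. -/
def quadricMidpoint (ε : ℝ) (g : LinearMap.BilinForm ℝ Space) (Z₁ Z₂ : Space) : Space :=
  (√(ε * g (Z₁ + Z₂) (Z₁ + Z₂)))⁻¹ • (Z₁ + Z₂)

/-- The midpoint of two points of the sphere that are not antipodal. -/
def sphereMid (Z₁ Z₂ : Space) : Space := quadricMidpoint 1 (innerₗ Space) Z₁ Z₂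

/-- The midpoint of two points of the hyperbolic plane. -/
def hyperbolicMid (Z₁ Z₂ : Space) : Space := quadricMidpoint (-1) minkowski Z₁ Z₂

/-- The Lagrange problem on the sphere. The Kepler centres and their antipodal points are singular
if the mass factor is not zero, the equator with respect to the midpoint is singular if the Hooke
factor is not zero. -/
def sphericalLagrange (Z₁ Z₂ : Space) (m₁ m₂ f : ℝ) : MechanicalSystem Space where
  carrier := {q ∈ unitSphere | (m₁ ≠ 0 → q ≠ Z₁ ∧ q ≠ -Z₁) ∧ (m₂ ≠ 0 → q ≠ Z₂ ∧ q ≠ -Z₂) ∧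
    (f ≠ 0 → inner ℝ q (sphereMid Z₁ Z₂) ≠ 0)}
  metric := innerₗ Space
  force q :=
    m₁ * Real.cot (sphereDist q Z₁) + m₂ * Real.cot (sphereDist q Z₂)
      + f * Real.tan (sphereDist q (sphereMid Z₁ Z₂)) ^ 2

/-- The hyperbolic cotangent. -/
def hyperbolicCot (x : ℝ) : ℝ := Real.cosh x / Real.sinh x

/-- The Lagrange problem in the hyperbolic plane. -/
def hyperbolicLagrange (Z₁ Z₂ : Space) (m₁ m₂ f : ℝ) : MechanicalSystem Space where
  carrier := {q ∈ hyperbolicPlane | (m₁ ≠ 0 → q ≠ Z₁) ∧ (m₂ ≠ 0 → q ≠ Z₂)}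
  metric := minkowski
  force q :=
    m₁ * hyperbolicCot (hyperbolicDist q Z₁) + m₂ * hyperbolicCot (hyperbolicDist q Z₂)
      + f * Real.tanh (hyperbolicDist q (hyperbolicMid Z₁ Z₂)) ^ 2

section Projection

variable (ε : ℝ) (g : LinearMap.BilinForm ℝ Space)

/-- The plane tangent at `M` to the quadric `g q q = ε`. -/
def tangentPlane (M : Space) : Set Space := {x | g x M = ε}

/-- The central projection from the origin to `tangentPlane ε g M`. -/
def centralPoint (M q : Space) : Space := (ε * g q M)⁻¹ • q

/-- The action of the central projection on velocities, taking the change of time into account: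
if `x = centralPoint ε g M q` and `v = dq/dτ`, this is `dx/dt` with `d/dτ = |g x x| d/dt`. -/
def centralVelocity (M q v : Space) : Space := ε • (g q M • v - g v M • q)

/-- The vector from the projection of the midpoint of `Z₁`, `Z₂` to the projection of `Z₁`. -/
def halfFocal (Z₁ Z₂ : Space) : Space :=
  centralPoint ε g (quadricMidpoint ε g Z₁ Z₂) Z₁ - quadricMidpoint ε g Z₁ Z₂

/-- The number `1 + ε a²`, where `a` is the length of `halfFocal ε g Z₁ Z₂`. -/
def focalFactor (Z₁ Z₂ : Space) : ℝ :=
  1 + ε * g (halfFocal ε g Z₁ Z₂) (halfFocal ε g Z₁ Z₂)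

/-- The affine change of the metric in the tangent plane at the midpoint: in orthonormal
coordinates `(x, y)` with `y` in the direction of the foci it is `x² + y² / (1 + ε a²)`. -/
def affineForm (Z₁ Z₂ : Space) : LinearMap.BilinForm ℝ Space :=
  g - (ε / focalFactor ε g Z₁ Z₂) •
    (g (halfFocal ε g Z₁ Z₂)).smulRight (g (halfFocal ε g Z₁ Z₂))

/-- The planar Lagrange problem to which the Lagrange problem with centres `Z₁`, `Z₂` and factors
`m₁`, `m₂`, `f` on the quadric `g q q = ε` corresponds under the central projection. -/
def projectedLagrange (Z₁ Z₂ : Space) (m₁ m₂ f : ℝ) : MechanicalSystem Space :=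
  flatLagrange (tangentPlane ε g (quadricMidpoint ε g Z₁ Z₂)) (affineForm ε g Z₁ Z₂)
    (centralPoint ε g (quadricMidpoint ε g Z₁ Z₂) Z₁)
    (centralPoint ε g (quadricMidpoint ε g Z₁ Z₂) Z₂)
    (m₁ / √(focalFactor ε g Z₁ Z₂)) (m₂ / √(focalFactor ε g Z₁ Z₂)) f

/-- The phase point of the plane that corresponds to the phase point `p` of the quadric. -/
def projectedPhase (Z₁ Z₂ : Space) (p : Space × Space) : Space × Space :=
  (centralPoint ε g (quadricMidpoint ε g Z₁ Z₂) p.1,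
    centralVelocity ε g (quadricMidpoint ε g Z₁ Z₂) p.1 p.2)

end Projection

/-- The inverse of the central projection of the sphere on phase points: the point `x` of a
tangent plane goes to `q = x / ‖x‖` and `u = dx/dt` goes to `dq/dτ`, `d/dτ = ‖x‖² d/dt`. -/
def toSpherePhase (x u : Space) : Space × Space :=
  (‖x‖⁻¹ • x, ‖x‖ • u - (inner ℝ x u / ‖x‖) • x)

/-- The affine map `ι` identifies the Euclidean plane with centres `Z₁`, `Z₂`, up to the factor
`r` of lengths, with the tangent plane of the sphere at the midpoint of `W₁`, `W₂`, endowed with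
its affinely changed metric, and it maps the centres to the central projections of `W₁`, `W₂`. -/
structure IsCentralChart (Z₁ Z₂ : Plane) (W₁ W₂ : Space) (r : ℝ) (ι : Plane →ᵃ[ℝ] Space) :
    Prop where
  mem_left : W₁ ∈ unitSphere
  mem_right : W₂ ∈ unitSphere
  not_antipodal : W₁ ≠ -W₂
  scale_pos : 0 < r
  mem_plane : ∀ q, ι q ∈ tangentPlane 1 (innerₗ Space) (sphereMid W₁ W₂)
  map_left : ι Z₁ = centralPoint 1 (innerₗ Space) (sphereMid W₁ W₂) W₁
  map_right : ι Z₂ = centralPoint 1 (innerₗ Space) (sphereMid W₁ W₂) W₂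
  isometry : ∀ u : Plane,
    affineForm 1 (innerₗ Space) W₁ W₂ (ι.linear u) (ι.linear u) = r ^ 2 * ‖u‖ ^ 2

end

/-!
On all three surfaces the additional integral has the same form
`F = (α g(v, v) + η g(c₁, v) g(c₂, v)) / 2 - V`, where `c₁`, `c₂` are the tangent fields that point
to the two foci. The structure `FocalSurface` collects what is needed of the surface, and
`FocalSurface.isAdditionalIntegral` deduces integrability as follows.

* The covariant derivatives of the focal fields are multiples of the identity, and `α` is adjusted
  to them, so that the quadratic part is a Killing tensor. Hence `F` is constant along motions when
  `dV` is the image of `dU` under the quadratic part (`FocalSurface.IsCompatible`). This is a linear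
  condition on the pair `(U, V)`, so it is enough to verify it for one Kepler centre and for the
  Hooke term.
* A tangent vector of a confocal conic is orthogonal to the sum or the difference of the unit
  vectors that point to the foci. Reflection in it exchanges the two focal directions up to sign,
  therefore the mixed term `g(c₁, τ) g(c₂, n) + g(c₂, τ) g(c₁, n)` vanishes for a normal vector `n`
  (`FocalSurface.IsConicDirection.principal`), and elastic reflection keeps `F`. The restrictions on
  the parameter of the conics exclude the degenerate conics on the line through the foci, where the
  sum or difference is zero.
* Away from the foci the quadratic part is not a multiple of the metric, so for almost all
  velocities the differentials of `F` and the energy are independent already in the direction of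
  the velocities.

The sphere and the hyperbolic plane are treated at the same time as quadrics `g(q, q) = ε`, with the
linear functions `focalCos` in place of `cos d(q, Z)` and `cosh d(q, Z)`. That `F` is the energy of
the centrally projected Lagrange problem is `projected_energy`: the kinetic parts agree by the
vanishing of the Gram determinant of `v`, `c₁`, `c₂` in the two-dimensional tangent plane, and the
potential parts by the formulas for the changed metric in `affineForm_self`. For the Euclidean plane
the corresponding integral is the spherical energy in the affine map `centralChart`, which sends the
plane to a tangent plane of the sphere and the foci to the projections of two points `W₁`, `W₂`.
-/

open Filter Topology

/-! ### Tangent cones of walls -/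

section TangentCones

variable {E : Type} [NormedAddCommGroup E] [NormedSpace ℝ E]

theorem HasDerivAt.mem_tangentConeAt {s : Set E} {γ : ℝ → E} {v : E} {t : ℝ}
    (h : HasDerivAt γ v t) (hs : ∀ᶠ u in 𝓝[≠] t, γ u ∈ s) : v ∈ tangentConeAt ℝ s (γ t) := by
  refine mem_tangentConeAt_of_seq (𝓝[≠] t) (fun u => (u - t)⁻¹) (fun u => γ u - γ t) ?_ ?_ ?_
  · have h1 : Tendsto γ (𝓝[≠] t) (𝓝 (γ t)) := h.continuousAt.tendsto.mono_left nhdsWithin_le_nhds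
    simpa using h1.sub_const (γ t)
  · simpa using hs
  · simpa [slope_fun_def] using hasDerivAt_iff_tendsto_slope.1 h

/-- The tangent cone of a finite union is the union of the tangent cones. -/
theorem exists_mem_tangentConeAt_of_finite {𝒞 : Set (Set E)} (h𝒞 : 𝒞.Finite) {B : Set E}
    (hB : B ⊆ ⋃₀ 𝒞) {q τ : E} (hτ : τ ∈ tangentConeAt ℝ B q) :
    ∃ C ∈ 𝒞, τ ∈ tangentConeAt ℝ C q := by
  obtain ⟨ι, l, hl, c, d, hd, hdB, hcd⟩ := exists_fun_of_mem_tangentConeAt hτ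
  by_contra! hcon
  have h1 : ∀ C ∈ 𝒞, ∀ᶠ n in l, q + d n ∉ C := by
    intro C hC
    by_contra hf
    refine hcon C hC (mem_tangentConeAt_of_frequently l c d hd (fun h => hf ?_) hcd)
    exact h
  have h2 := (eventually_all_finite h𝒞).2 h1
  obtain ⟨n, hn1, hn2⟩ := (h2.and hdB).exists
  obtain ⟨C, hC, hnC⟩ := hB hn2
  exact hn1 C hC hnC

/-- A function that is constant on a set has zero derivative in tangent directions, also at limit
points of the set. -/
theorem HasFDerivAt.eq_zero_of_mem_tangentConeAt {C : Set E} {h : E → ℝ} {L : E →L[ℝ] ℝ} {q τ : E}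
    {s : ℝ} (hL : HasFDerivAt h L q) (hC : ∀ x ∈ C, h x = s) (hτ : τ ∈ tangentConeAt ℝ C q) :
    L τ = 0 := by
  have hq : q ∈ closure C := mem_closure_of_nonempty_tangentConeAt ⟨τ, hτ⟩
  have h1 : h q ∈ closure (h '' C) := hL.continuousAt.continuousWithinAt.mem_closure_image hq
  have h2 : h '' C ⊆ {s} := by rintro _ ⟨x, hx, rfl⟩; exact hC x hx
  have h3 : h q = s := by simpa using closure_mono h2 h1
  have h4 : HasFDerivWithinAt h (0 : E →L[ℝ] ℝ) C q :=
    (hasFDerivWithinAt_const s q C).congr (fun x hx => hC x hx) h3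
  simpa using hL.hasFDerivWithinAt.unique_on h4 hτ

end TangentCones

/-! ### Derivatives of quadratic expressions -/

section Bilinear

variable {E : Type} [NormedAddCommGroup E] [NormedSpace ℝ E] [FiniteDimensional ℝ E]
  (g : LinearMap.BilinForm ℝ E)

theorem LinearMap.BilinForm.isBoundedBilinearMap :
    IsBoundedBilinearMap ℝ (fun p : E × E => g p.1 p.2) := by
  have h := (LinearMap.toContinuousLinearMap
    ((LinearMap.toContinuousLinearMap : (E →ₗ[ℝ] ℝ) ≃ₗ[ℝ] _).toLinearMap ∘ₗ g)).isBoundedBilinearMap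
  exact h

theorem LinearMap.BilinForm.contDiffAt {F : Type} [NormedAddCommGroup F] [NormedSpace ℝ F]
    {a b : F → E} {x : F} {n : WithTop ℕ∞} (ha : ContDiffAt ℝ n a x) (hb : ContDiffAt ℝ n b x) :
    ContDiffAt ℝ n (fun y => g (a y) (b y)) x :=
  g.isBoundedBilinearMap.contDiff.contDiffAt.comp x (ha.prodMk hb)

theorem LinearMap.BilinForm.hasDerivAt {a b : ℝ → E} {a' b' : E} {t : ℝ}
    (ha : HasDerivAt a a' t) (hb : HasDerivAt b b' t) :
    HasDerivAt (fun s => g (a s) (b s)) (g (a t) b' + g a' (b t)) t := by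
  have h := (g.isBoundedBilinearMap.hasFDerivAt (a t, b t)).comp_hasDerivAt t (ha.prodMk hb)
  exact h

end Bilinear

/-- The zeros of a polynomial of degree exactly two are isolated; this applies also when `0` is
itself a zero. -/
theorem eventually_quadratic_ne_zero (a b : ℝ) {c : ℝ} (hc : c ≠ 0) :
    ∀ᶠ t in 𝓝[≠] (0 : ℝ), a + b * t + c * t ^ 2 ≠ 0 := by
  by_cases ha : a = 0
  · by_cases hb : b = 0
    · filter_upwards [self_mem_nhdsWithin] with t ht
      have : t ≠ 0 := ht
      simp [ha, hb, hc, this]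
    · have h : ContinuousAt (fun t : ℝ => b + c * t) 0 := by fun_prop
      filter_upwards [self_mem_nhdsWithin,
        (h.eventually_ne (by simpa using hb)).filter_mono nhdsWithin_le_nhds] with t ht ht'
      have h0 : t ≠ 0 := ht
      have : a + b * t + c * t ^ 2 = t * (b + c * t) := by rw [ha]; ring
      rw [this]
      exact mul_ne_zero h0 ht'
  · have h : ContinuousAt (fun t : ℝ => a + b * t + c * t ^ 2) 0 := by fun_prop
    exact (h.eventually_ne (by simpa using ha)).filter_mono nhdsWithin_le_nhds

section FocalIntegral

variable {E : Type} [NormedAddCommGroup E] [NormedSpace ℝ E]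

/-- The function `(α g(v, v) + η g(c₁, v) g(c₂, v)) / 2 - V` of a phase point `(q, v)`, where `α`,
the vector fields `c₁`, `c₂` and `V` depend on `q`. The constants `α = 1`, `η = 0` give an
energy. -/
noncomputable def focalIntegral (g : LinearMap.BilinForm ℝ E) (α : E → ℝ) (η : ℝ) (c₁ c₂ : E → E)
    (V : E → ℝ) (p : E × E) : ℝ :=
  (α p.1 * g p.2 p.2 + η * (g (c₁ p.1) p.2 * g (c₂ p.1) p.2)) / 2 - V p.1

variable [FiniteDimensional ℝ E] {g : LinearMap.BilinForm ℝ E} {α : E → ℝ} {η : ℝ} {c₁ c₂ : E → E}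
  {V : E → ℝ}

theorem focalIntegral_contDiffAt (p : E × E) (hα : ContDiffAt ℝ ∞ α p.1)
    (h₁ : ContDiffAt ℝ ∞ c₁ p.1) (h₂ : ContDiffAt ℝ ∞ c₂ p.1) (hV : ContDiffAt ℝ ∞ V p.1) :
    ContDiffAt ℝ ∞ (focalIntegral g α η c₁ c₂ V) p := by
  have hα' : ContDiffAt ℝ ∞ (fun x : E × E => α x.1) p := hα.comp p contDiffAt_fst
  have hV' : ContDiffAt ℝ ∞ (fun x : E × E => V x.1) p := hV.comp p contDiffAt_fst
  have h₁' : ContDiffAt ℝ ∞ (fun x : E × E => c₁ x.1) p := h₁.comp p contDiffAt_fst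
  have h₂' : ContDiffAt ℝ ∞ (fun x : E × E => c₂ x.1) p := h₂.comp p contDiffAt_fst
  have hs : ContDiffAt ℝ ∞ (fun x : E × E => x.2) p := contDiffAt_snd
  exact (((hα'.mul (g.contDiffAt hs hs)).add (contDiffAt_const.mul
    ((g.contDiffAt h₁' hs).mul (g.contDiffAt h₂' hs)))).div_const 2).sub hV'

/-- The derivative in the direction of a velocity `u` at fixed position is the polar form of the
quadratic part. -/
theorem focalIntegral_fderiv_vertical (hg : ∀ x y, g x y = g y x) (q v u : E)
    (h : DifferentiableAt ℝ (focalIntegral g α η c₁ c₂ V) (q, v)) :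
    fderiv ℝ (focalIntegral g α η c₁ c₂ V) (q, v) (0, u) =
      α q * g v u + η / 2 * (g (c₁ q) v * g (c₂ q) u + g (c₂ q) v * g (c₁ q) u) := by
  have hcurve : HasDerivAt (fun t : ℝ => v + t • u) u 0 := by
    simpa using ((hasDerivAt_id (0 : ℝ)).smul_const u).const_add v
  have hpair : HasDerivAt (fun t : ℝ => (q, v + t • u)) (0, u) 0 :=
    (hasDerivAt_const 0 q).prodMk hcurve
  have h1 : HasDerivAt (fun t : ℝ => focalIntegral g α η c₁ c₂ V (q, v + t • u))
      (fderiv ℝ (focalIntegral g α η c₁ c₂ V) (q, v) (0, u)) 0 := by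
    have h0 : HasFDerivAt (focalIntegral g α η c₁ c₂ V)
        (fderiv ℝ (focalIntegral g α η c₁ c₂ V) (q, v)) ((fun t : ℝ => (q, v + t • u)) 0) := by
      simpa using h.hasFDerivAt
    exact h0.comp_hasDerivAt 0 hpair
  have hK := ((((g.hasDerivAt hcurve hcurve).const_mul (α q)).add
    (((g.hasDerivAt (hasDerivAt_const 0 (c₁ q)) hcurve).mul
      (g.hasDerivAt (hasDerivAt_const 0 (c₂ q)) hcurve)).const_mul η)).div_const 2).sub_const (V q)
  have h2 := h1.unique hK
  rw [h2]
  simp only [zero_smul, add_zero, map_zero, LinearMap.zero_apply]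
  rw [hg u v]
  ring

end FocalIntegral

/-! ### Focal surfaces and their quadratic integrals -/

/-- A surface `X` in `E` with the metric induced by `g` and two foci, as it is seen by the
quadratic integrals of the problem of two centres. The fields `c₁`, `c₂` are tangent vectors that
point to the foci, and the quadratic part of the integral is `α g + η c₁ c₂`. The field equations
`fderiv_α` and `fderiv_c₁`, `fderiv_c₂` say that this is a Killing tensor. The map `J q` is a
rotation by a right angle in the tangent plane; `parseval` expresses that this plane has
dimension two. -/
structure FocalSurface {E : Type} [NormedAddCommGroup E] [NormedSpace ℝ E] (X : Set E)
    (g : LinearMap.BilinForm ℝ E) where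
  /-- the tangent plane -/
  T : E → Submodule ℝ E
  /-- the rotation by a right angle in the tangent plane -/
  J : E → E →ₗ[ℝ] E
  /-- the tangent field towards the first focus -/
  c₁ : E → E
  /-- the tangent field towards the second focus -/
  c₂ : E → E
  /-- the factor in the covariant derivative of `c₁` -/
  lam₁ : E → ℝ
  /-- the factor in the covariant derivative of `c₂` -/
  lam₂ : E → ℝ
  /-- the coefficient of the metric -/
  α : E → ℝ
  /-- the coefficient of the product of the focal fields -/
  η : ℝ
  η_ne_zero : η ≠ 0
  symm : ∀ x y, g x y = g y x
  tangentCone : ∀ q ∈ X, tangentConeAt ℝ X q = T q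
  pos : ∀ q ∈ X, ∀ v ∈ T q, v ≠ 0 → 0 < g v v
  J_mem : ∀ q ∈ X, ∀ v ∈ T q, J q v ∈ T q
  J_orthogonal : ∀ q ∈ X, ∀ v ∈ T q, g v (J q v) = 0
  J_norm : ∀ q ∈ X, ∀ v ∈ T q, g (J q v) (J q v) = g v v
  parseval : ∀ q ∈ X, ∀ v ∈ T q, ∀ a ∈ T q, ∀ b ∈ T q,
    g v v * g a b = g a v * g b v + g a (J q v) * g b (J q v)
  c₁_mem : ∀ q ∈ X, c₁ q ∈ T q
  c₂_mem : ∀ q ∈ X, c₂ q ∈ T q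
  α_contDiff : ContDiff ℝ ∞ α
  c₁_contDiff : ContDiff ℝ ∞ c₁
  c₂_contDiff : ContDiff ℝ ∞ c₂
  fderiv_α : ∀ q ∈ X, ∀ v ∈ T q,
    fderiv ℝ α q v = η * (lam₁ q * g (c₂ q) v + lam₂ q * g (c₁ q) v)
  fderiv_c₁ : ∀ q ∈ X, ∀ v ∈ T q, ∀ u ∈ T q, g (fderiv ℝ c₁ q v) u = -lam₁ q * g v u
  fderiv_c₂ : ∀ q ∈ X, ∀ v ∈ T q, ∀ u ∈ T q, g (fderiv ℝ c₂ q v) u = -lam₂ q * g v u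
  exists_curve : ∀ q ∈ X, ∀ v ∈ T q, ∃ Γ : ℝ → E × E, ContinuousAt Γ 0 ∧ Γ 0 = (q, v) ∧
    ∀ᶠ t in 𝓝[≠] (0 : ℝ), (Γ t).1 ∈ X ∧ (Γ t).2 ∈ T (Γ t).1 ∧ c₁ (Γ t).1 ≠ 0 ∧ c₂ (Γ t).1 ≠ 0

namespace FocalSurface

variable {E : Type} [NormedAddCommGroup E] [NormedSpace ℝ E] {X : Set E}
  {g : LinearMap.BilinForm ℝ E} (D : FocalSurface X g)

/-- The quadratic integral with potential part `V`. -/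
noncomputable def integral (V : E → ℝ) : E × E → ℝ := focalIntegral g D.α D.η D.c₁ D.c₂ V

/-- The direction `τ` at `q` is orthogonal to the sum (`σ = 1`) or to the difference (`σ = -1`) of
the unit vectors that point to the foci, and this sum or difference does not vanish. These are the
directions of the confocal conics. Square roots are lengths of the focal vectors. -/
def IsConicDirection (q τ : E) : Prop :=
  ∃ σ : ℝ, σ ^ 2 = 1 ∧
    g (D.c₁ q) τ * √(g (D.c₂ q) (D.c₂ q)) + σ * (g (D.c₂ q) τ * √(g (D.c₁ q) (D.c₁ q))) = 0 ∧
    g (D.c₁ q) (D.c₂ q) ≠ -σ * (√(g (D.c₁ q) (D.c₁ q)) * √(g (D.c₂ q) (D.c₂ q)))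

/-- The differentials of the force function `U` and of the potential part `V` of the integral are
related by the quadratic part of the integral. -/
def IsCompatible (U V : E → ℝ) (q : E) : Prop :=
  ∃ L L' : E →L[ℝ] ℝ, HasFDerivAt U L q ∧ HasFDerivAt V L' q ∧ ∀ v ∈ D.T q,
    L' v = D.α q * L v + D.η / 2 * (L (D.c₁ q) * g (D.c₂ q) v + L (D.c₂ q) * g (D.c₁ q) v)

theorem IsCompatible.add {D : FocalSurface X g} {U V U' V' : E → ℝ} {q : E}
    (h : D.IsCompatible U V q) (h' : D.IsCompatible U' V' q) :
    D.IsCompatible (fun x => U x + U' x) (fun x => V x + V' x) q := by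
  obtain ⟨L, M, hL, hM, h⟩ := h
  obtain ⟨L', M', hL', hM', h'⟩ := h'
  refine ⟨L + L', M + M', hL.add hL', hM.add hM', fun v hv => ?_⟩
  simp only [_root_.add_apply, h v hv, h' v hv]
  ring

theorem IsCompatible.const_mul {D : FocalSurface X g} {U V : E → ℝ} {q : E} (m : ℝ)
    (h : m ≠ 0 → D.IsCompatible U V q) :
    D.IsCompatible (fun x => m * U x) (fun x => m * V x) q := by
  by_cases hm : m = 0
  · refine ⟨0, 0, ?_, ?_, fun v _ => by simp⟩ <;> simpa [hm] using hasFDerivAt_const (0 : ℝ) q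
  · obtain ⟨L, M, hL, hM, h⟩ := h hm
    refine ⟨m • L, m • M, hL.const_mul m, hM.const_mul m, fun v hv => ?_⟩
    simp only [_root_.smul_apply, smul_eq_mul, h v hv]
    ring

theorem pos_iff {q v : E} (hq : q ∈ X) (hv : v ∈ D.T q) : g v v ≠ 0 ↔ v ≠ 0 := by
  refine ⟨fun h h0 => h (by simp [h0]), fun h => (D.pos q hq v hv h).ne'⟩

theorem metric_nonneg {q v : E} (hq : q ∈ X) (hv : v ∈ D.T q) : 0 ≤ g v v := by
  by_cases h : v = 0
  · simp [h]
  · exact (D.pos q hq v hv h).le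

/-- The conic directions are principal directions of the quadratic part of the integral: two
unit vectors are mirror images of each other in their bisectors. -/
theorem IsConicDirection.principal {D : FocalSurface X g} {q τ n : E} (hq : q ∈ X)
    (h : D.IsConicDirection q τ) (hτ : τ ∈ D.T q) (hn : n ∈ D.T q) (hτ0 : τ ≠ 0)
    (hnτ : g n τ = 0) :
    g (D.c₁ q) τ * g (D.c₂ q) n + g (D.c₂ q) τ * g (D.c₁ q) n = 0 := by
  obtain ⟨σ, hσ, h1, h2⟩ := h
  have hc1 := D.c₁_mem q hq
  have hc2 := D.c₂_mem q hq
  have ht := D.pos q hq τ hτ hτ0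
  set r1 := √(g (D.c₁ q) (D.c₁ q)) with hr1
  set r2 := √(g (D.c₂ q) (D.c₂ q)) with hr2
  have hr1s : r1 ^ 2 = g (D.c₁ q) (D.c₁ q) := Real.sq_sqrt (D.metric_nonneg hq hc1)
  have hr2s : r2 ^ 2 = g (D.c₂ q) (D.c₂ q) := Real.sq_sqrt (D.metric_nonneg hq hc2)
  have hr2p : r2 ≠ 0 := by
    intro h0
    have : D.c₂ q = 0 := by
      by_contra hc
      exact (D.pos_iff hq hc2).2 hc (by rw [← hr2s, h0]; ring)
    apply h2
    rw [h0, this]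
    simp
  have p11 := D.parseval q hq τ hτ _ hc1 _ hc1
  have p22 := D.parseval q hq τ hτ _ hc2 _ hc2
  have p12 := D.parseval q hq τ hτ _ hc1 _ hc2
  have p1n := D.parseval q hq τ hτ _ hc1 _ hn
  have p2n := D.parseval q hq τ hτ _ hc2 _ hn
  rw [hnτ] at p1n p2n
  rw [← hr1s] at p11
  rw [← hr2s] at p22
  set a1 := g (D.c₁ q) τ
  set a2 := g (D.c₂ q) τ
  set b1 := g (D.c₁ q) (D.J q τ)
  set b2 := g (D.c₂ q) (D.J q τ)
  set t := g τ τ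
  -- `a1`, `b1` and `a2`, `b2` are the components of the focal vectors along `τ` and across it. The
  -- components along `τ` agree up to sign after division by the lengths `r1`, `r2`; by Parseval so
  -- do the components across.
  have key : (b1 * r2 - σ * (b2 * r1)) * (b1 * r2 + σ * (b2 * r1)) = 0 := by
    linear_combination (-r2 ^ 2) * p11 + r1 ^ 2 * p22 + (-a1 * r2 + σ * a2 * r1) * h1
      + (r1 ^ 2 * b2 ^ 2 * (-1) - a2 ^ 2 * r1 ^ 2) * hσ
  have hab : a1 * b2 + a2 * b1 = 0 := by
    rcases mul_eq_zero.1 key with hk | hk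
    · have : r2 * (a1 * b2 + a2 * b1) = 0 := by linear_combination b2 * h1 + a2 * hk
      exact (mul_eq_zero.1 this).resolve_left hr2p
    -- With this sign the unit focal vectors are parallel, and their `σ`-sum vanishes.
    · exfalso
      apply h2
      have : r2 * t * (g (D.c₁ q) (D.c₂ q) + σ * (r1 * r2)) = 0 := by
        linear_combination r2 * p12 + a2 * h1 + b2 * hk + σ * r1 * p22
      have := (mul_eq_zero.1 this).resolve_left (mul_ne_zero hr2p ht.ne')
      linarith
  have : t * (a1 * g (D.c₂ q) n + a2 * g (D.c₁ q) n) = 0 := by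
    linear_combination a1 * p2n + a2 * p1n + g n (D.J q τ) * hab
  exact (mul_eq_zero.1 this).resolve_left ht.ne'

/-- Away from the foci the quadratic part of the integral is not a multiple of the metric. -/
theorem exists_not_principal {q : E} (hq : q ∈ X) (h₁ : D.c₁ q ≠ 0) (h₂ : D.c₂ q ≠ 0) :
    ∃ w ∈ D.T q, g (D.c₁ q) w * g (D.c₂ q) (D.J q w) + g (D.c₂ q) w * g (D.c₁ q) (D.J q w) ≠ 0 := by
  have hc1 := D.c₁_mem q hq
  have hc2 := D.c₂_mem q hq
  have g1 := D.pos q hq _ hc1 h₁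
  have g2 := D.pos q hq _ hc2 h₂
  set e := D.c₁ q
  have hJe := D.J_mem q hq e hc1
  have hoe := D.J_orthogonal q hq e hc1
  by_cases hd : g (D.c₂ q) (D.J q e) = 0
  -- If `c₂` is parallel to `c₁ = e`, then `e` is principal, and the diagonal `e + J e` is not.
  · have hJJ : g e (D.J q (D.J q e)) = -g e e := by
      have h := D.J_orthogonal q hq (e + D.J q e) (Submodule.add_mem _ hc1 hJe)
      simp only [map_add, LinearMap.add_apply] at h
      have h3 := D.J_orthogonal q hq _ hJe
      have h4 := D.J_norm q hq e hc1
      linarith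
    have hJJm := D.J_mem q hq _ hJe
    have p := D.parseval q hq e hc1 _ hc2 _ hJJm
    have p22 := D.parseval q hq e hc1 _ hc2 _ hc2
    rw [hd, D.symm (D.J q (D.J q e)) e, hJJ] at p
    rw [hd] at p22
    have h12 : g (D.c₂ q) e ≠ 0 := by
      intro h0
      rw [h0] at p22
      simp only [mul_zero, add_zero, mul_eq_zero] at p22
      rcases p22 with h | h <;> linarith
    have hcJ : g (D.c₂ q) (D.J q (D.J q e)) = -g (D.c₂ q) e := by
      apply mul_left_cancel₀ g1.ne'
      rw [p]; ring
    refine ⟨e + D.J q e, Submodule.add_mem _ hc1 hJe, ?_⟩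
    simp only [map_add, hoe, hd, hJJ, hcJ]
    have : g e e * g (D.c₂ q) e ≠ 0 := mul_ne_zero g1.ne' h12
    intro h
    apply this
    linarith
  · refine ⟨e, hc1, ?_⟩
    rw [hoe, mul_zero, add_zero]
    exact mul_ne_zero g1.ne' hd

variable {S : MechanicalSystem E} {O : Set E} {U V : E → ℝ}

theorem mem_phaseSpace_iff (hO : IsOpen O) (hS : S.carrier = X ∩ O) {q v : E} :
    (q, v) ∈ S.phaseSpace ↔ q ∈ X ∧ q ∈ O ∧ v ∈ D.T q := by
  simp only [MechanicalSystem.phaseSpace, Set.mem_ofPred_eq, hS, Set.mem_inter_iff, and_assoc]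
  refine and_congr_right fun hX => and_congr_right fun hq => ?_
  rw [tangentConeAt_inter_nhds (hO.mem_nhds hq), D.tangentCone q hX]
  rfl

/-- The values at `k τ + n` and `k τ - n` differ by the mixed term of the quadratic part, which
vanishes when `τ` is a principal direction. -/
theorem reflection (hO : IsOpen O) (hS : S.carrier = X ∩ O) (hg : S.metric = g) {B : Set E}
    (hB : ∀ q ∈ X, ∀ τ ∈ tangentConeAt ℝ B q, D.IsConicDirection q τ) {q v w : E}
    (h : S.IsReflection B q v w) : D.integral V (q, v) = D.integral V (q, w) := by
  obtain ⟨-, hv, hw, τ, hτB, hτ0, k, n, hn, rfl, rfl⟩ := h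
  rw [hg] at hn
  obtain ⟨hq, -, hvT⟩ := (D.mem_phaseSpace_iff hO hS).1 hv
  obtain ⟨-, -, hwT⟩ := (D.mem_phaseSpace_iff hO hS).1 hw
  simp only [integral, focalIntegral, map_add, map_sub, map_smul, LinearMap.add_apply,
    LinearMap.sub_apply, LinearMap.smul_apply, smul_eq_mul]
  rw [D.symm τ n, hn]
  by_cases hk : k = 0
  -- The integral is even in the velocity, so `n` and `-n` give the same value.
  · rw [hk]; ring
  · have h2 : (2 : ℝ)⁻¹ • ((k • τ + n) - (k • τ - n)) ∈ D.T q :=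
      Submodule.smul_mem _ _ (Submodule.sub_mem _ hvT hwT)
    have hnT : n ∈ D.T q := by
      have : (2 : ℝ)⁻¹ • ((k • τ + n) - (k • τ - n)) = n := by module
      rwa [this] at h2
    have hτT : τ ∈ D.T q := by
      have h3 : k⁻¹ • ((k • τ + n) - n) ∈ D.T q :=
        Submodule.smul_mem _ _ (Submodule.sub_mem _ hvT hnT)
      rwa [add_sub_cancel_right, smul_smul, inv_mul_cancel₀ hk, one_smul] at h3
    have key := (hB q hq τ hτB).principal hq hτT hnT hτ0 hn
    linear_combination D.η * k * key

variable [FiniteDimensional ℝ E]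

theorem isSmooth (hO : IsOpen O) (hS : S.carrier = X ∩ O) (hV : ContDiffOn ℝ ∞ V O) :
    S.IsSmooth (D.integral V) := by
  refine ⟨O ×ˢ Set.univ, D.integral V, hO.prod isOpen_univ, fun p hp => ?_, fun p hp => ?_,
    fun _ _ => rfl⟩
  · exact ⟨((D.mem_phaseSpace_iff hO hS).1 hp).2.1, trivial⟩
  · exact (focalIntegral_contDiffAt p D.α_contDiff.contDiffAt D.c₁_contDiff.contDiffAt
      D.c₂_contDiff.contDiffAt (hV.contDiffAt (hO.mem_nhds hp.1))).contDiffWithinAt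

/-- The derivative of the integral along a motion vanishes by the Killing equations and the
compatibility of `U` and `V`. -/
theorem isFirstIntegral (hO : IsOpen O) (hS : S.carrier = X ∩ O) (hg : S.metric = g)
    (hU : Set.EqOn S.force U S.carrier) (hUV : ∀ q ∈ S.carrier, D.IsCompatible U V q) :
    S.IsFirstIntegral (D.integral V) := by
  intro I γ hγ s hs t ht
  obtain ⟨hIo, hIc, hmot⟩ := hγ
  have hder : ∀ t ∈ I, HasDerivAt (fun t => D.integral V (γ t, deriv γ t)) 0 t := by
    intro t ht
    obtain ⟨hC, hd1, hd2, hF⟩ := hmot t ht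
    rw [hg] at hF
    have hqX : γ t ∈ X := (hS ▸ hC : γ t ∈ X ∩ O).1
    have h1 := hd1.hasDerivAt
    have h2 := hd2.hasDerivAt
    set v := deriv γ t with hv
    set w := deriv (deriv γ) t with hw
    have hTC : tangentConeAt ℝ S.carrier (γ t) = D.T (γ t) := by
      rw [hS, tangentConeAt_inter_nhds (hO.mem_nhds (hS ▸ hC : γ t ∈ X ∩ O).2),
        D.tangentCone _ hqX]
    have hvT : v ∈ D.T (γ t) := by
      have : v ∈ tangentConeAt ℝ S.carrier (γ t) := by
        refine h1.mem_tangentConeAt ?_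
        filter_upwards [(hIo.mem_nhds ht : I ∈ 𝓝 t) |> mem_nhdsWithin_of_mem_nhds] with u hu
        exact (hmot u hu).1
      rwa [hTC] at this
    obtain ⟨L, M, hL, hM, hLM⟩ := hUV _ hC
    have hwL : ∀ u ∈ D.T (γ t), g w u = L u := by
      intro u hu
      have h3 : HasFDerivWithinAt S.force L S.carrier (γ t) :=
        hL.hasFDerivWithinAt.congr (fun x hx => hU hx) (hU hC)
      have hu' : u ∈ tangentConeAt ℝ S.carrier (γ t) := by rw [hTC]; exact hu
      simpa using hF.unique_on h3 hu'
    have hα : HasDerivAt (fun t => D.α (γ t)) (fderiv ℝ D.α (γ t) v) t :=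
      ((D.α_contDiff.differentiable (by simp)) (γ t)).hasFDerivAt.comp_hasDerivAt t h1
    have hc₁ : HasDerivAt (fun t => D.c₁ (γ t)) (fderiv ℝ D.c₁ (γ t) v) t :=
      ((D.c₁_contDiff.differentiable (by simp)) (γ t)).hasFDerivAt.comp_hasDerivAt t h1
    have hc₂ : HasDerivAt (fun t => D.c₂ (γ t)) (fderiv ℝ D.c₂ (γ t) v) t :=
      ((D.c₂_contDiff.differentiable (by simp)) (γ t)).hasFDerivAt.comp_hasDerivAt t h1
    have hV' : HasDerivAt (fun t => V (γ t)) (M v) t := hM.comp_hasDerivAt t h1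
    have htot := (((hα.mul (g.hasDerivAt h2 h2)).add (((g.hasDerivAt hc₁ h2).mul
      (g.hasDerivAt hc₂ h2)).const_mul D.η)).div_const 2).sub hV'
    refine htot.congr_deriv ?_
    rw [← hv, D.fderiv_α _ hqX v hvT, D.fderiv_c₁ _ hqX v hvT v hvT,
      D.fderiv_c₂ _ hqX v hvT v hvT, hLM v hvT, D.symm v w, D.symm (D.c₁ (γ t)) w,
      D.symm (D.c₂ (γ t)) w, hwL v hvT, hwL _ (D.c₁_mem _ hqX), hwL _ (D.c₂_mem _ hqX)]
    ring
  have hconv : Convex ℝ I := hIc.convex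
  refine hconv.is_const_of_fderivWithin_eq_zero (𝕜 := ℝ)
    (f := fun t => D.integral V (γ t, deriv γ t))
    (fun u hu => (hder u hu).differentiableAt.differentiableWithinAt) (fun u hu => ?_) hs ht
  rw [fderivWithin_of_isOpen hIo hu]
  ext
  simp [(hder u hu).deriv]

/-- If `v` is not a principal direction, the differentials are independent already on the vertical
vectors `v` and `J v`. -/
theorem independentAt (hO : IsOpen O) (hS : S.carrier = X ∩ O) (hg : S.metric = g)
    (hU : Set.EqOn S.force U S.carrier) (hUs : ContDiffOn ℝ ∞ U O) (hV : ContDiffOn ℝ ∞ V O)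
    {q v : E} (hp : (q, v) ∈ S.phaseSpace)
    (h : g (D.c₁ q) v * g (D.c₂ q) (D.J q v) + g (D.c₂ q) v * g (D.c₁ q) (D.J q v) ≠ 0) :
    S.IndependentAt S.energy (D.integral V) (q, v) := by
  obtain ⟨hqX, hqO, hvT⟩ := (D.mem_phaseSpace_iff hO hS).1 hp
  have hE := (focalIntegral_contDiffAt (g := g) (α := fun _ => 1) (η := 0) (q, v)
    contDiffAt_const D.c₁_contDiff.contDiffAt D.c₂_contDiff.contDiffAt
    (hUs.contDiffAt (hO.mem_nhds hqO))).differentiableAt (by simp)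
  have hF := (focalIntegral_contDiffAt (g := g) (α := D.α) (η := D.η) (q, v)
    D.α_contDiff.contDiffAt D.c₁_contDiff.contDiffAt D.c₂_contDiff.contDiffAt
    (hV.contDiffAt (hO.mem_nhds hqO))).differentiableAt (by simp)
  have hEq : ∀ p ∈ S.phaseSpace,
      S.energy p = focalIntegral g (fun _ => 1) 0 D.c₁ D.c₂ U p := by
    intro p hp
    simp only [MechanicalSystem.energy, focalIntegral, hg, hU hp.1]
    ring
  refine ⟨_, _, hE.hasFDerivAt.hasFDerivWithinAt.congr hEq (hEq _ hp),
    hF.hasFDerivAt.hasFDerivWithinAt, fun a b hab => ?_⟩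
  have hvert : ∀ u ∈ D.T q, (0, u) ∈ tangentConeAt ℝ S.phaseSpace (q, v) := by
    intro u hu
    have hcurve : HasDerivAt (fun t : ℝ => (q, v + t • u)) (0, u) 0 :=
      (hasDerivAt_const 0 q).prodMk
        (by simpa using ((hasDerivAt_id (0 : ℝ)).smul_const u).const_add v)
    have := hcurve.mem_tangentConeAt (s := S.phaseSpace) (.of_forall fun t =>
      (D.mem_phaseSpace_iff hO hS).2
        ⟨hqX, hqO, Submodule.add_mem _ hvT (Submodule.smul_mem _ _ hu)⟩)
    simpa using this
  have hJ := D.J_mem q hqX v hvT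
  have e1 := hab _ (hvert _ hJ)
  have e2 := hab _ (hvert _ hvT)
  rw [focalIntegral_fderiv_vertical D.symm _ _ _ hE,
    focalIntegral_fderiv_vertical D.symm _ _ _ hF] at e1 e2
  rw [D.J_orthogonal q hqX v hvT] at e1
  have hv0 : v ≠ 0 := by rintro rfl; simp at h
  have hgv := D.pos q hqX v hvT hv0
  have hb : b = 0 := by
    have : (b * D.η) * (g (D.c₁ q) v * g (D.c₂ q) (D.J q v)
        + g (D.c₂ q) v * g (D.c₁ q) (D.J q v)) = 0 := by linear_combination 2 * e1
    exact (mul_eq_zero.1 ((mul_eq_zero.1 this).resolve_right h)).resolve_right D.η_ne_zero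
  refine ⟨?_, hb⟩
  rw [hb] at e2
  have : a * g v v = 0 := by linear_combination e2
  exact (mul_eq_zero.1 this).resolve_right hgv.ne'

/-- First the position is moved away from the foci, then the velocity out of the principal
directions. -/
theorem dense_independentAt (hO : IsOpen O) (hS : S.carrier = X ∩ O) (hg : S.metric = g)
    (hU : Set.EqOn S.force U S.carrier) (hUs : ContDiffOn ℝ ∞ U O) (hV : ContDiffOn ℝ ∞ V O) :
    S.phaseSpace ⊆ closure {p ∈ S.phaseSpace | S.IndependentAt S.energy (D.integral V) p} := by
  have h1 : S.phaseSpace ⊆ closure {p ∈ S.phaseSpace | D.c₁ p.1 ≠ 0 ∧ D.c₂ p.1 ≠ 0} := by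
    rintro ⟨q, v⟩ hp
    obtain ⟨hqX, hqO, hvT⟩ := (D.mem_phaseSpace_iff hO hS).1 hp
    obtain ⟨Γ, hΓ, hΓ0, hev⟩ := D.exists_curve q hqX v hvT
    have hlim : Tendsto Γ (𝓝[≠] 0) (𝓝 (q, v)) := by
      rw [← hΓ0]; exact hΓ.tendsto.mono_left nhdsWithin_le_nhds
    have hOev : ∀ᶠ t in 𝓝[≠] (0 : ℝ), (Γ t).1 ∈ O :=
      (continuous_fst.tendsto _ |>.comp hlim).eventually (hO.mem_nhds hqO)
    refine mem_closure_of_tendsto hlim ?_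
    filter_upwards [hev, hOev] with t ht htO
    exact ⟨(D.mem_phaseSpace_iff hO hS).2 ⟨ht.1, htO, ht.2.1⟩, ht.2.2⟩
  refine h1.trans (closure_minimal ?_ isClosed_closure)
  rintro ⟨q, v⟩ ⟨hp, hq1, hq2⟩
  obtain ⟨hqX, hqO, hvT⟩ := (D.mem_phaseSpace_iff hO hS).1 hp
  obtain ⟨w, hwT, hw⟩ := D.exists_not_principal hqX hq1 hq2
  have hcont : Continuous (fun t : ℝ => (q, v + t • w)) := by fun_prop
  have hlim : Tendsto (fun t : ℝ => (q, v + t • w)) (𝓝[≠] 0) (𝓝 (q, v)) := by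
    have := hcont.tendsto 0
    simp only [zero_smul, add_zero] at this
    exact this.mono_left nhdsWithin_le_nhds
  refine mem_closure_of_tendsto hlim ?_
  filter_upwards [eventually_quadratic_ne_zero
    (g (D.c₁ q) v * g (D.c₂ q) (D.J q v) + g (D.c₂ q) v * g (D.c₁ q) (D.J q v))
    (g (D.c₁ q) v * g (D.c₂ q) (D.J q w) + g (D.c₁ q) w * g (D.c₂ q) (D.J q v)
      + g (D.c₂ q) v * g (D.c₁ q) (D.J q w) + g (D.c₂ q) w * g (D.c₁ q) (D.J q v)) hw] with t ht
  have hp' : (q, v + t • w) ∈ S.phaseSpace := (D.mem_phaseSpace_iff hO hS).2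
    ⟨hqX, hqO, Submodule.add_mem _ hvT (Submodule.smul_mem _ _ hwT)⟩
  refine ⟨hp', D.independentAt hO hS hg hU hUs hV hp' ?_⟩
  convert ht using 1
  simp only [map_add, map_smul, smul_eq_mul]
  ring

/-- A system on an open part of a focal surface whose force function is compatible with `V` is
integrable with every wall that has only conic directions. -/
theorem isAdditionalIntegral (hO : IsOpen O) (hS : S.carrier = X ∩ O) (hg : S.metric = g)
    (hU : Set.EqOn S.force U S.carrier) (hUs : ContDiffOn ℝ ∞ U O) (hV : ContDiffOn ℝ ∞ V O)
    (hUV : ∀ q ∈ S.carrier, D.IsCompatible U V q) {B : Set E}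
    (hB : ∀ q ∈ X, ∀ τ ∈ tangentConeAt ℝ B q, D.IsConicDirection q τ) :
    S.IsAdditionalIntegral B (D.integral V) where
  smooth := D.isSmooth hO hS hV
  firstIntegral := D.isFirstIntegral hO hS hg hU hUV
  reflection _ _ _ h := D.reflection hO hS hg hB h
  independent := D.dense_independentAt hO hS hg hU hUs hV

end FocalSurface

/-! ### The quadrics as focal surfaces -/

/-- The form `dx² + dy² + ε dz²`: Euclidean for `ε = 1`, Minkowski for `ε = -1`. -/
noncomputable def quadricForm (ε : ℝ) : LinearMap.BilinForm ℝ Space :=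
  LinearMap.mk₂ ℝ (fun x y => x 0 * y 0 + x 1 * y 1 + ε * (x 2 * y 2))
    (fun x x' y => by simp only [PiLp.add_apply]; ring)
    (fun c x y => by simp only [PiLp.smul_apply, smul_eq_mul]; ring)
    (fun x y y' => by simp only [PiLp.add_apply]; ring)
    (fun c x y => by simp only [PiLp.smul_apply, smul_eq_mul]; ring)

theorem quadricForm_apply (ε : ℝ) (x y : Space) :
    quadricForm ε x y = x 0 * y 0 + x 1 * y 1 + ε * (x 2 * y 2) := rfl

theorem quadricForm_comm (ε : ℝ) (x y : Space) : quadricForm ε x y = quadricForm ε y x := by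
  simp only [quadricForm_apply]; ring

theorem quadricForm_one : quadricForm 1 = innerₗ Space := by
  ext x y
  simp [quadricForm_apply, PiLp.inner_apply, Fin.sum_univ_three, mul_comm]

theorem quadricForm_neg_one : quadricForm (-1) = minkowski := by
  refine LinearMap.ext fun x => LinearMap.ext fun y => ?_
  simp [quadricForm_apply, minkowski]
  ring

/-- The part in the open set `H` of the quadric `g q q = ε`. -/
def quadric (ε : ℝ) (H : Set Space) : Set Space := {q | quadricForm ε q q = ε} ∩ H

/-- The linear function that takes on the quadric the value `cos d(q, Z)` or `cosh d(q, Z)`. -/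
noncomputable def focalCos (ε : ℝ) (Z : Space) : Space →L[ℝ] ℝ :=
  LinearMap.toContinuousLinearMap (ε • quadricForm ε Z)

theorem focalCos_apply (ε : ℝ) (Z q : Space) : focalCos ε Z q = ε * quadricForm ε Z q := rfl

/-- The tangential part of the vector `Z` at the point `q` of the quadric. -/
noncomputable def focalField (ε : ℝ) (Z q : Space) : Space := Z - focalCos ε Z q • q

/-- Rotation by a right angle in the tangent planes of the quadric: the cross product with `q` with
respect to `quadricForm ε`. -/
noncomputable def quadricRotation (ε : ℝ) (q : Space) : Space →ₗ[ℝ] Space where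
  toFun v := !₂[q 1 * v 2 - q 2 * v 1, q 2 * v 0 - q 0 * v 2, ε * (q 0 * v 1 - q 1 * v 0)]
  map_add' v w := by
    ext i; fin_cases i <;> simp <;> ring
  map_smul' c v := by
    ext i; fin_cases i <;> simp <;> ring

section Quadric

variable {ε : ℝ}

theorem quadricForm_rotation (hε : ε = 1 ∨ ε = -1) (q v a : Space) :
    quadricForm ε a (quadricRotation ε q v) =
      a 0 * (q 1 * v 2 - q 2 * v 1) + a 1 * (q 2 * v 0 - q 0 * v 2)
        + a 2 * (q 0 * v 1 - q 1 * v 0) := by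
  rcases hε with rfl | rfl
  · simp [quadricForm_apply, quadricRotation]
  · simp [quadricForm_apply, quadricRotation]
    ring

/-- The product of two determinants is a Gram determinant. -/
theorem quadricForm_gram (hε : ε = 1 ∨ ε = -1) (q v a b : Space) :
    quadricForm ε a (quadricRotation ε q v) * quadricForm ε b (quadricRotation ε q v) =
      ε * (quadricForm ε q q * (quadricForm ε v v * quadricForm ε a b
          - quadricForm ε v b * quadricForm ε a v)
        - quadricForm ε q v * (quadricForm ε v q * quadricForm ε a b
          - quadricForm ε v b * quadricForm ε a q)
        + quadricForm ε q b * (quadricForm ε v q * quadricForm ε a v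
          - quadricForm ε v v * quadricForm ε a q)) := by
  rw [quadricForm_rotation hε, quadricForm_rotation hε]
  simp only [quadricForm_apply]
  rcases hε with rfl | rfl <;> ring

theorem quadricForm_parseval (hε : ε = 1 ∨ ε = -1) {q v a b : Space}
    (hq : quadricForm ε q q = ε) (hv : quadricForm ε q v = 0) (ha : quadricForm ε q a = 0)
    (hb : quadricForm ε q b = 0) :
    quadricForm ε v v * quadricForm ε a b = quadricForm ε a v * quadricForm ε b v
      + quadricForm ε a (quadricRotation ε q v) * quadricForm ε b (quadricRotation ε q v) := by
  rw [quadricForm_gram hε, hq, hv, hb, quadricForm_comm ε v b]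
  have h2 : ε * ε = 1 := by rcases hε with rfl | rfl <;> norm_num
  linear_combination (-(quadricForm ε v v * quadricForm ε a b
    - quadricForm ε b v * quadricForm ε a v)) * h2

/-- The form is positive definite on the tangent planes, also in the Minkowski case. -/
theorem quadricForm_pos (hε : ε = 1 ∨ ε = -1) {q v : Space} (hq : quadricForm ε q q = ε)
    (hv : quadricForm ε q v = 0) (hv0 : v ≠ 0) : 0 < quadricForm ε v v := by
  have hne : v 0 ≠ 0 ∨ v 1 ≠ 0 ∨ v 2 ≠ 0 := by
    by_contra! h
    exact hv0 (by ext i; fin_cases i <;> simp [h])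
  rw [quadricForm_apply] at hq hv ⊢
  rcases hε with rfl | rfl
  · have h0 := mul_self_nonneg (v 0)
    have h1 := mul_self_nonneg (v 1)
    have h2 := mul_self_nonneg (v 2)
    rcases hne with h | h | h <;> have := mul_self_pos.2 h <;> linarith
  · have hz : q 2 * q 2 = 1 + q 0 * q 0 + q 1 * q 1 := by linarith
    have hz0 : 0 < q 2 * q 2 := by nlinarith [mul_self_nonneg (q 0), mul_self_nonneg (q 1)]
    have hpos : 0 < v 0 * v 0 + v 1 * v 1 := by
      by_contra hcon
      have h0 : v 0 = 0 := by nlinarith [mul_self_nonneg (v 0), mul_self_nonneg (v 1)]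
      have h1 : v 1 = 0 := by nlinarith [mul_self_nonneg (v 0), mul_self_nonneg (v 1)]
      have h2 : q 2 * v 2 = 0 := by rw [h0, h1] at hv; linarith
      have h3 : v 2 = 0 := (mul_eq_zero.1 h2).resolve_left (by rintro h; simp [h] at hz0)
      simp [h0, h1, h3] at hne
    have key : q 2 * q 2 * (v 0 * v 0 + v 1 * v 1 + -1 * (v 2 * v 2)) =
        v 0 * v 0 + v 1 * v 1 + (q 0 * v 1 - q 1 * v 0) ^ 2 := by
      linear_combination (v 0 * v 0 + v 1 * v 1) * hz
        + (q 0 * v 0 + q 1 * v 1 + q 2 * v 2) * hv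
    by_contra hcon
    nlinarith [sq_nonneg (q 0 * v 1 - q 1 * v 0)]

theorem exists_quadric_tangent (q : Space) : ∃ w : Space, quadricForm ε q w = 0 ∧ w ≠ 0 := by
  by_cases h : q 0 = 0 ∧ q 1 = 0
  · refine ⟨!₂[1, 0, 0], by simp [quadricForm_apply, h.1], fun h0 => ?_⟩
    simpa using congrArg (fun x : Space => x 0) h0
  · refine ⟨!₂[q 1, -q 0, 0], by simp [quadricForm_apply]; ring, fun h0 => h ⟨?_, ?_⟩⟩
    · simpa using congrArg (fun x : Space => x 1) h0
    · simpa using congrArg (fun x : Space => x 0) h0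

/-- The radial projection to the quadric of the line through `q` in the tangent direction `w`. -/
noncomputable def quadricCurve (ε : ℝ) (q w : Space) (t : ℝ) : Space :=
  (√(1 + ε * quadricForm ε w w * t ^ 2))⁻¹ • (q + t • w)

theorem quadricCurve_zero (q w : Space) : quadricCurve ε q w 0 = q := by
  simp [quadricCurve]

theorem quadricCurve_hasDerivAt (q w : Space) : HasDerivAt (quadricCurve ε q w) w 0 := by
  set c := ε * quadricForm ε w w with hc
  have h1 : HasDerivAt (fun t : ℝ => 1 + c * t ^ 2) 0 0 := by
    simpa using ((hasDerivAt_pow 2 (0 : ℝ)).const_mul c).const_add 1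
  have h2 : HasDerivAt (fun t : ℝ => (√(1 + c * t ^ 2))⁻¹) 0 0 :=
    ((h1.sqrt (by simp)).inv (by simp)).congr_deriv (by simp)
  have h3 : HasDerivAt (fun t : ℝ => q + t • w) w 0 := by
    simpa using ((hasDerivAt_id (0 : ℝ)).smul_const w).const_add q
  exact (h2.smul h3).congr_deriv (by simp)

theorem quadricCurve_eventually (hε : ε = 1 ∨ ε = -1) {H : Set Space} (hH : IsOpen H) {q w : Space}
    (hq : q ∈ quadric ε H) (hw : quadricForm ε q w = 0) :
    ∀ᶠ t in 𝓝 (0 : ℝ), quadricCurve ε q w t ∈ quadric ε H ∧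
      0 < 1 + ε * quadricForm ε w w * t ^ 2 := by
  have h1 : ∀ᶠ t in 𝓝 (0 : ℝ), quadricCurve ε q w t ∈ H := by
    have := (quadricCurve_hasDerivAt (ε := ε) q w).continuousAt
    refine this.eventually (hH.mem_nhds ?_)
    rw [quadricCurve_zero]; exact hq.2
  have h2 : ∀ᶠ t in 𝓝 (0 : ℝ), 0 < 1 + ε * quadricForm ε w w * t ^ 2 := by
    have : ContinuousAt (fun t : ℝ => 1 + ε * quadricForm ε w w * t ^ 2) 0 := by fun_prop
    exact this.eventually (lt_mem_nhds (by simp))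
  filter_upwards [h1, h2] with t ht1 ht2
  refine ⟨⟨?_, ht1⟩, ht2⟩
  have hqq : quadricForm ε q q = ε := hq.1
  have h22 : ε * ε = 1 := by rcases hε with rfl | rfl <;> norm_num
  have hs := Real.sq_sqrt ht2.le
  set r := √(1 + ε * quadricForm ε w w * t ^ 2) with hr
  have hr0 : r ≠ 0 := (Real.sqrt_pos.2 ht2).ne'
  change quadricForm ε (r⁻¹ • (q + t • w)) (r⁻¹ • (q + t • w)) = ε
  simp only [map_add, map_smul, LinearMap.add_apply, LinearMap.smul_apply, smul_eq_mul, hqq, hw,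
    quadricForm_comm ε w q]
  field_simp
  rw [hs]
  linear_combination (-quadricForm ε w w * t ^ 2) * h22

theorem quadric_tangentCone (hε : ε = 1 ∨ ε = -1) {H : Set Space} (hH : IsOpen H) {q : Space}
    (hq : q ∈ quadric ε H) :
    tangentConeAt ℝ (quadric ε H) q = LinearMap.ker (quadricForm ε q) := by
  ext v
  simp only [SetLike.mem_coe, LinearMap.mem_ker]
  constructor
  · intro hv
    have hL := (quadricForm ε).isBoundedBilinearMap.hasFDerivAt (q, q)
    have hd : HasFDerivAt (fun x : Space => (x, x))
        ((ContinuousLinearMap.id ℝ Space).prod (ContinuousLinearMap.id ℝ Space)) q :=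
      (hasFDerivAt_id q).prodMk (hasFDerivAt_id q)
    have h := (HasFDerivAt.comp (f := fun x : Space => (x, x)) q hL hd).eq_zero_of_mem_tangentConeAt
      (s := ε) (fun x hx => hx.1) hv
    have h' : quadricForm ε q v + quadricForm ε v q = 0 := h
    rw [quadricForm_comm ε v q] at h'
    linarith
  · intro hv
    have := (quadricCurve_hasDerivAt (ε := ε) q v).mem_tangentConeAt (s := quadric ε H)
      (((quadricCurve_eventually hε hH hq hv).filter_mono nhdsWithin_le_nhds).mono fun t ht => ht.1)
    rwa [quadricCurve_zero] at this

theorem quadricForm_focalField (hε : ε = 1 ∨ ε = -1) {Z q : Space} (v : Space)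
    (hv : quadricForm ε q v = 0) :
    quadricForm ε (focalField ε Z q) v = ε * focalCos ε Z v := by
  have h22 : ε * ε = 1 := by rcases hε with rfl | rfl <;> norm_num
  simp only [focalField, focalCos_apply, map_sub, map_smul, LinearMap.sub_apply,
    LinearMap.smul_apply, smul_eq_mul, hv]
  linear_combination (-quadricForm ε Z v) * h22

theorem focalField_mem (hε : ε = 1 ∨ ε = -1) {Z q : Space} (hq : quadricForm ε q q = ε) :
    quadricForm ε q (focalField ε Z q) = 0 := by
  have h22 : ε * ε = 1 := by rcases hε with rfl | rfl <;> norm_num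
  simp only [focalField, focalCos_apply, map_sub, map_smul, smul_eq_mul, hq,
    quadricForm_comm ε q Z]
  linear_combination (-quadricForm ε Z q) * h22

theorem focalCos_focalField (Z Z' q : Space) :
    focalCos ε Z (focalField ε Z' q) = focalCos ε Z Z' - focalCos ε Z' q * focalCos ε Z q := by
  simp [focalField]

theorem focalCos_self (hε : ε = 1 ∨ ε = -1) {Z : Space} (hZ : quadricForm ε Z Z = ε) :
    focalCos ε Z Z = 1 := by
  rw [focalCos_apply, hZ]
  rcases hε with rfl | rfl <;> norm_num

theorem focalCos_comm (Z Z' : Space) : focalCos ε Z Z' = focalCos ε Z' Z := by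
  rw [focalCos_apply, focalCos_apply, quadricForm_comm]

theorem focalField_contDiff (Z : Space) : ContDiff ℝ ∞ (focalField ε Z) := by
  unfold focalField; fun_prop

theorem focalField_fderiv (Z q v : Space) :
    fderiv ℝ (focalField ε Z) q v = -(focalCos ε Z q • v + focalCos ε Z v • q) := by
  have h : HasFDerivAt (focalField ε Z) _ q :=
    (((focalCos ε Z).hasFDerivAt (x := q)).smul (hasFDerivAt_id q)).const_sub Z
  rw [h.fderiv]
  simp

/-- A curve with nonzero velocity leaves the points `Z` and `-Z`, where the focal field vanishes, at
once. -/
theorem focalField_eventually_ne (hε : ε = 1 ∨ ε = -1) {H : Set Space} (hH : IsOpen H)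
    {Z q w : Space} (hZ : quadricForm ε Z Z = ε) (hq : q ∈ quadric ε H)
    (hw : quadricForm ε q w = 0) (hw0 : w ≠ 0) :
    ∀ᶠ t in 𝓝[≠] (0 : ℝ), focalField ε Z (quadricCurve ε q w t) ≠ 0 := by
  by_cases h : focalField ε Z q = 0
  · filter_upwards [self_mem_nhdsWithin,
      (quadricCurve_eventually hε hH hq hw).filter_mono nhdsWithin_le_nhds] with t ht ht2 h0
    have ht0 : t ≠ 0 := ht
    set r := √(1 + ε * quadricForm ε w w * t ^ 2) with hr
    have hr0 : r ≠ 0 := (Real.sqrt_pos.2 ht2.2).ne'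
    have hww := quadricForm_pos hε hq.1 hw hw0
    set μ := focalCos ε Z (quadricCurve ε q w t)
    have hZ1 : Z = focalCos ε Z q • q := sub_eq_zero.1 h
    have hZ2 : Z = μ • r⁻¹ • (q + t • w) := sub_eq_zero.1 h0
    have e1 : quadricForm ε w Z = 0 := by
      rw [hZ1, map_smul, quadricForm_comm, hw, smul_zero]
    have e2 : quadricForm ε w Z = μ * (r⁻¹ * (t * quadricForm ε w w)) := by
      nth_rewrite 1 [hZ2]
      simp only [map_smul, map_add, smul_eq_mul, quadricForm_comm ε w q, hw, zero_add]
    have hμ : μ = 0 := by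
      rw [e1] at e2
      exact (mul_eq_zero.1 e2.symm).resolve_right
        (mul_ne_zero (inv_ne_zero hr0) (mul_ne_zero ht0 hww.ne'))
    have hZ0 : Z = 0 := by rw [hZ2, hμ, zero_smul]
    rw [hZ0] at hZ
    rcases hε with rfl | rfl <;> simp at hZ
  · have hc : ContinuousAt (fun t => focalField ε Z (quadricCurve ε q w t)) 0 :=
      ((focalField_contDiff (ε := ε) Z).continuous.continuousAt).comp
        (quadricCurve_hasDerivAt (ε := ε) q w).continuousAt
    refine (hc.eventually_ne ?_).filter_mono nhdsWithin_le_nhds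
    rwa [quadricCurve_zero]

/-- The quadric with the foci `Z₁`, `Z₂` as a focal surface. The field equations determine `α` up to
a constant; this one makes the quadratic part the kinetic energy of the projected problem, see
`projected_kinetic`. -/
noncomputable def quadricSurface (hε : ε = 1 ∨ ε = -1) {H : Set Space} (hH : IsOpen H)
    {Z₁ Z₂ : Space} (h₁ : quadricForm ε Z₁ Z₁ = ε) (h₂ : quadricForm ε Z₂ Z₂ = ε) :
    FocalSurface (quadric ε H) (quadricForm ε) where
  T q := LinearMap.ker (quadricForm ε q)
  J := quadricRotation ε
  c₁ := focalField ε Z₁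
  c₂ := focalField ε Z₂
  lam₁ := focalCos ε Z₁
  lam₂ := focalCos ε Z₂
  α q := (1 - focalCos ε Z₁ Z₂) / 2 + focalCos ε Z₁ q * focalCos ε Z₂ q
  η := ε
  η_ne_zero := by rcases hε with rfl | rfl <;> norm_num
  symm := quadricForm_comm ε
  tangentCone q hq := quadric_tangentCone hε hH hq
  pos q hq v hv hv0 := quadricForm_pos hε hq.1 hv hv0
  J_mem q _ v _ := by
    rw [LinearMap.mem_ker, quadricForm_rotation hε]; ring
  J_orthogonal q _ v _ := by rw [quadricForm_rotation hε]; ring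
  J_norm q hq v hv := by
    by_cases hv0 : v = 0
    · simp [hv0]
    have hq1 : quadricForm ε q q = ε := hq.1
    have hJ : quadricForm ε q (quadricRotation ε q v) = 0 := by
      rw [quadricForm_rotation hε]; ring
    have h22 : ε * ε = 1 := by rcases hε with rfl | rfl <;> norm_num
    have hv' : quadricForm ε q v = 0 := hv
    simp only [quadricForm_apply, quadricRotation, LinearMap.coe_mk, AddHom.coe_mk] at hq1 hv' ⊢
    simp only [Fin.isValue, Matrix.cons_val_zero, Matrix.cons_val_one,
      Matrix.cons_val]
    rcases hε with rfl | rfl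
    · linear_combination (v 0 * v 0 + v 1 * v 1 + v 2 * v 2) * hq1
        - (q 0 * v 0 + q 1 * v 1 + q 2 * v 2) * hv'
    · linear_combination (-(v 0 * v 0 + v 1 * v 1 - v 2 * v 2)) * hq1
        + (q 0 * v 0 + q 1 * v 1 - q 2 * v 2) * hv'
  parseval q hq v hv a ha b hb := quadricForm_parseval hε hq.1 hv ha hb
  c₁_mem q hq := focalField_mem hε hq.1
  c₂_mem q hq := focalField_mem hε hq.1
  α_contDiff := by fun_prop
  c₁_contDiff := focalField_contDiff Z₁
  c₂_contDiff := focalField_contDiff Z₂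
  fderiv_α q hq v hv := by
    have h22 : ε * ε = 1 := by rcases hε with rfl | rfl <;> norm_num
    have h : HasFDerivAt (fun q => (1 - focalCos ε Z₁ Z₂) / 2 + focalCos ε Z₁ q * focalCos ε Z₂ q)
        _ q := (((focalCos ε Z₁).hasFDerivAt (x := q)).mul
          ((focalCos ε Z₂).hasFDerivAt (x := q))).const_add ((1 - focalCos ε Z₁ Z₂) / 2)
    rw [h.fderiv, quadricForm_focalField hε v hv, quadricForm_focalField hε v hv]
    simp only [add_apply, smul_apply, smul_eq_mul]
    linear_combination (-(focalCos ε Z₁ q * focalCos ε Z₂ v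
      + focalCos ε Z₂ q * focalCos ε Z₁ v)) * h22
  fderiv_c₁ q hq v hv u hu := by
    have hu' : quadricForm ε q u = 0 := hu
    rw [focalField_fderiv]
    simp [hu']
  fderiv_c₂ q hq v hv u hu := by
    have hu' : quadricForm ε q u = 0 := hu
    rw [focalField_fderiv]
    simp [hu']
  exists_curve q hq v hv := by
    have h22 : ε * ε = 1 := by rcases hε with rfl | rfl <;> norm_num
    have hv' : quadricForm ε q v = 0 := hv
    obtain ⟨w, hw, hw0⟩ := exists_quadric_tangent (ε := ε) q
    have hY := (quadricCurve_hasDerivAt (ε := ε) q w).continuousAt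
    refine ⟨fun t => (quadricCurve ε q w t,
      v - focalCos ε v (quadricCurve ε q w t) • quadricCurve ε q w t), ?_, ?_, ?_⟩
    · have : ContinuousAt (fun t => focalCos ε v (quadricCurve ε q w t)) 0 :=
        ((focalCos ε v).continuous.continuousAt).comp hY
      exact hY.prodMk (continuousAt_const.sub (this.smul hY))
    · simp [quadricCurve_zero, focalCos_apply, quadricForm_comm ε v q, hv']
    · filter_upwards [(quadricCurve_eventually hε hH hq hw).filter_mono nhdsWithin_le_nhds,
        focalField_eventually_ne hε hH h₁ hq hw hw0,
        focalField_eventually_ne hε hH h₂ hq hw hw0] with t h3 h4 h5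
      exact ⟨h3.1, focalField_mem (Z := v) hε h3.1.1, h4, h5⟩

end Quadric

/-! ### Force functions on the quadrics -/

section QuadricForce

variable {ε : ℝ}

/-- The force function of the Lagrange problem on the quadric in terms of `focalCos`. -/
noncomputable def quadricForce (ε : ℝ) (Z₁ Z₂ : Space) (m₁ m₂ f : ℝ) (q : Space) : ℝ :=
  m₁ * (focalCos ε Z₁ q / √(ε * (1 - focalCos ε Z₁ q ^ 2)))
    + m₂ * (focalCos ε Z₂ q / √(ε * (1 - focalCos ε Z₂ q ^ 2)))
    + f * (ε * (2 * (1 + focalCos ε Z₁ Z₂) / (focalCos ε Z₁ q + focalCos ε Z₂ q) ^ 2 - 1))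

/-- The force function of the centrally projected problem in terms of `focalCos`. The numerators
`focalCos ε Z₁ q + focalCos ε Z₂ q` continue it analytically across the equator of the sphere. -/
noncomputable def quadricPotential (ε : ℝ) (Z₁ Z₂ : Space) (m₁ m₂ f : ℝ) (q : Space) : ℝ :=
  m₁ * ((focalCos ε Z₁ q + focalCos ε Z₂ q) / (2 * √(ε * (1 - focalCos ε Z₁ q ^ 2))))
    + m₂ * ((focalCos ε Z₁ q + focalCos ε Z₂ q) / (2 * √(ε * (1 - focalCos ε Z₂ q ^ 2))))
    + f * (ε * ((1 + focalCos ε Z₁ Z₂) / 2 * (4 - (focalCos ε Z₁ q - focalCos ε Z₂ q) ^ 2)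
      / (focalCos ε Z₁ q + focalCos ε Z₂ q) ^ 2 - 1))

/-- The points that are regular for `quadricForce`. -/
def quadricRegular (ε : ℝ) (Z₁ Z₂ : Space) (m₁ m₂ f : ℝ) : Set Space :=
  {q | (m₁ ≠ 0 → 0 < ε * (1 - focalCos ε Z₁ q ^ 2)) ∧ (m₂ ≠ 0 → 0 < ε * (1 - focalCos ε Z₂ q ^ 2)) ∧
    (f ≠ 0 → focalCos ε Z₁ q + focalCos ε Z₂ q ≠ 0)}

theorem isOpen_setOf_imp {X : Type*} [TopologicalSpace X] (a : Prop) {s : Set X} (hs : IsOpen s) :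
    IsOpen {x | a → x ∈ s} := by
  by_cases ha : a <;> simp [ha, hs]

theorem isOpen_quadricRegular (Z₁ Z₂ : Space) (m₁ m₂ f : ℝ) :
    IsOpen (quadricRegular ε Z₁ Z₂ m₁ m₂ f) := by
  refine (isOpen_setOf_imp _ ?_).inter ((isOpen_setOf_imp _ ?_).inter (isOpen_setOf_imp _ ?_))
  · exact isOpen_lt continuous_const (by fun_prop : Continuous fun q =>
      ε * (1 - focalCos ε Z₁ q ^ 2))
  · exact isOpen_lt continuous_const (by fun_prop : Continuous fun q =>
      ε * (1 - focalCos ε Z₂ q ^ 2))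
  · exact isOpen_ne_fun (by fun_prop : Continuous fun q => focalCos ε Z₁ q + focalCos ε Z₂ q)
      continuous_const

/-- A summand with coefficient zero imposes no smoothness condition. -/
theorem ContDiffAt.const_mul_of_ne_zero {F : Type*} [NormedAddCommGroup F] [NormedSpace ℝ F]
    {h : F → ℝ} {x : F} (m : ℝ) (hh : m ≠ 0 → ContDiffAt ℝ ∞ h x) :
    ContDiffAt ℝ ∞ (fun y => m * h y) x := by
  by_cases hm : m = 0
  · simpa [hm] using contDiffAt_const
  · exact contDiffAt_const.mul (hh hm)

theorem contDiffAt_focalSin {Z q : Space} (h : 0 < ε * (1 - focalCos ε Z q ^ 2)) :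
    ContDiffAt ℝ ∞ (fun q => √(ε * (1 - focalCos ε Z q ^ 2))) q :=
  ContDiffAt.sqrt (by fun_prop) h.ne'

theorem quadricForce_contDiffOn (Z₁ Z₂ : Space) (m₁ m₂ f : ℝ) :
    ContDiffOn ℝ ∞ (quadricForce ε Z₁ Z₂ m₁ m₂ f) (quadricRegular ε Z₁ Z₂ m₁ m₂ f) := by
  rintro q ⟨h1, h2, h3⟩
  refine ContDiffAt.contDiffWithinAt ?_
  refine ((ContDiffAt.const_mul_of_ne_zero m₁ fun hm => ?_).add
    (ContDiffAt.const_mul_of_ne_zero m₂ fun hm => ?_)).add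
    (ContDiffAt.const_mul_of_ne_zero f fun hm => ?_)
  · exact ContDiffAt.div (by fun_prop) (contDiffAt_focalSin (h1 hm)) (Real.sqrt_pos.2 (h1 hm)).ne'
  · exact ContDiffAt.div (by fun_prop) (contDiffAt_focalSin (h2 hm)) (Real.sqrt_pos.2 (h2 hm)).ne'
  · exact contDiffAt_const.mul ((ContDiffAt.div contDiffAt_const
      (g := fun q => (focalCos ε Z₁ q + focalCos ε Z₂ q) ^ 2) (by fun_prop)
      (pow_ne_zero 2 (h3 hm))).sub contDiffAt_const)

theorem quadricPotential_contDiffOn (Z₁ Z₂ : Space) (m₁ m₂ f : ℝ) :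
    ContDiffOn ℝ ∞ (quadricPotential ε Z₁ Z₂ m₁ m₂ f) (quadricRegular ε Z₁ Z₂ m₁ m₂ f) := by
  rintro q ⟨h1, h2, h3⟩
  refine ContDiffAt.contDiffWithinAt ?_
  refine ((ContDiffAt.const_mul_of_ne_zero m₁ fun hm => ?_).add
    (ContDiffAt.const_mul_of_ne_zero m₂ fun hm => ?_)).add
    (ContDiffAt.const_mul_of_ne_zero f fun hm => ?_)
  · exact ContDiffAt.div (by fun_prop) (contDiffAt_const.mul (contDiffAt_focalSin (h1 hm)))
      (mul_ne_zero two_ne_zero (Real.sqrt_pos.2 (h1 hm)).ne')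
  · exact ContDiffAt.div (by fun_prop) (contDiffAt_const.mul (contDiffAt_focalSin (h2 hm)))
      (mul_ne_zero two_ne_zero (Real.sqrt_pos.2 (h2 hm)).ne')
  · exact contDiffAt_const.mul ((ContDiffAt.div (f := fun q => (1 + focalCos ε Z₁ Z₂) / 2
        * (4 - (focalCos ε Z₁ q - focalCos ε Z₂ q) ^ 2))
      (g := fun q => (focalCos ε Z₁ q + focalCos ε Z₂ q) ^ 2) (by fun_prop) (by fun_prop)
      (pow_ne_zero 2 (h3 hm))).sub contDiffAt_const)

theorem hasDerivAt_inv_sin {x : ℝ} (hx : 0 < ε * (1 - x ^ 2)) :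
    HasDerivAt (fun x => (√(ε * (1 - x ^ 2)))⁻¹) (ε * x / √(ε * (1 - x ^ 2)) ^ 3) x := by
  have h1 : HasDerivAt (fun x : ℝ => ε * (1 - x ^ 2)) (ε * (-(2 * x))) x := by
    simpa using (((hasDerivAt_pow 2 x).const_sub 1).const_mul ε)
  have hr := (Real.sqrt_pos.2 hx).ne'
  refine ((h1.sqrt hx.ne').inv hr).congr_deriv ?_
  field_simp

theorem hasDerivAt_cot {x : ℝ} (hx : 0 < ε * (1 - x ^ 2)) :
    HasDerivAt (fun x => x / √(ε * (1 - x ^ 2))) (ε / √(ε * (1 - x ^ 2)) ^ 3) x := by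
  have h := (hasDerivAt_id x).mul (hasDerivAt_inv_sin hx)
  have hr := (Real.sqrt_pos.2 hx).ne'
  have hs := Real.sq_sqrt hx.le
  refine h.congr_deriv ?_
  set r := √(ε * (1 - x ^ 2))
  simp only [id]
  field_simp
  linear_combination hs

variable {H : Set Space} (hH : IsOpen H) {Z₁ Z₂ : Space}

theorem compatible_kepler_left (hε : ε = 1 ∨ ε = -1) (h₁ : quadricForm ε Z₁ Z₁ = ε)
    (h₂ : quadricForm ε Z₂ Z₂ = ε) {q : Space} (hq1 : 0 < ε * (1 - focalCos ε Z₁ q ^ 2)) :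
    (quadricSurface hε hH h₁ h₂).IsCompatible
      (fun q => focalCos ε Z₁ q / √(ε * (1 - focalCos ε Z₁ q ^ 2)))
      (fun q => (focalCos ε Z₁ q + focalCos ε Z₂ q) / (2 * √(ε * (1 - focalCos ε Z₁ q ^ 2))))
      q := by
  have hU := (hasDerivAt_cot hq1).comp_hasFDerivAt q (focalCos ε Z₁).hasFDerivAt
  have hI := (hasDerivAt_inv_sin hq1).comp_hasFDerivAt q (focalCos ε Z₁).hasFDerivAt
  have hV := ((((focalCos ε Z₁).hasFDerivAt (x := q)).add (focalCos ε Z₂).hasFDerivAt).mul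
    hI).const_mul (2 : ℝ)⁻¹
  refine ⟨_, _, hU, hV.congr_of_eventuallyEq (.of_forall fun x => ?_), fun v hv => ?_⟩
  · simp only [Pi.mul_apply, Pi.add_apply, Function.comp]
    rw [div_eq_mul_inv, mul_inv]
    ring
  have h22 : ε * ε = 1 := by rcases hε with rfl | rfl <;> norm_num
  have hr := (Real.sqrt_pos.2 hq1).ne'
  have hs := Real.sq_sqrt hq1.le
  simp only [quadricSurface]
  rw [quadricForm_focalField hε v hv, quadricForm_focalField hε v hv]
  simp only [add_apply, smul_apply, smul_eq_mul,
    focalCos_focalField, focalCos_self hε h₁, Function.comp, Pi.add_apply]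
  set r := √(ε * (1 - focalCos ε Z₁ q ^ 2))
  field_simp
  rw [sq ε, h22]
  linear_combination (focalCos ε Z₁ v + focalCos ε Z₂ v) * hs

theorem compatible_kepler_right (hε : ε = 1 ∨ ε = -1) (h₁ : quadricForm ε Z₁ Z₁ = ε)
    (h₂ : quadricForm ε Z₂ Z₂ = ε) {q : Space} (hq2 : 0 < ε * (1 - focalCos ε Z₂ q ^ 2)) :
    (quadricSurface hε hH h₁ h₂).IsCompatible
      (fun q => focalCos ε Z₂ q / √(ε * (1 - focalCos ε Z₂ q ^ 2)))
      (fun q => (focalCos ε Z₁ q + focalCos ε Z₂ q) / (2 * √(ε * (1 - focalCos ε Z₂ q ^ 2))))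
      q := by
  obtain ⟨L, L', hL, hL', h⟩ := compatible_kepler_left hH hε h₂ h₁ hq2
  refine ⟨L, L', hL, hL'.congr_of_eventuallyEq (.of_forall fun x => ?_), fun v hv => ?_⟩
  · simp only [add_comm]
  · rw [h v hv]
    simp only [quadricSurface, focalCos_comm (ε := ε) Z₂ Z₁]
    ring

theorem compatible_hooke (hε : ε = 1 ∨ ε = -1) (h₁ : quadricForm ε Z₁ Z₁ = ε)
    (h₂ : quadricForm ε Z₂ Z₂ = ε) {q : Space} (hq : focalCos ε Z₁ q + focalCos ε Z₂ q ≠ 0) :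
    (quadricSurface hε hH h₁ h₂).IsCompatible
      (fun q => ε * (2 * (1 + focalCos ε Z₁ Z₂) / (focalCos ε Z₁ q + focalCos ε Z₂ q) ^ 2 - 1))
      (fun q => ε * ((1 + focalCos ε Z₁ Z₂) / 2 * (4 - (focalCos ε Z₁ q - focalCos ε Z₂ q) ^ 2)
        / (focalCos ε Z₁ q + focalCos ε Z₂ q) ^ 2 - 1)) q := by
  have e1 := (focalCos ε Z₁).hasFDerivAt (x := q)
  have e2 := (focalCos ε Z₂).hasFDerivAt (x := q)
  have hden := ((e1.add e2).pow 2)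
  have hS := (hasDerivAt_inv (pow_ne_zero 2 hq)).comp_hasFDerivAt q hden
  have hU := ((hS.const_mul (2 * (1 + focalCos ε Z₁ Z₂))).sub_const 1).const_mul ε
  have hV := (((((((e1.sub e2).pow 2).const_sub 4).const_mul ((1 + focalCos ε Z₁ Z₂) / 2)).mul
    hS)).sub_const 1).const_mul ε
  refine ⟨_, _, hU, hV, fun v hv => ?_⟩
  have h22 : ε * ε = 1 := by rcases hε with rfl | rfl <;> norm_num
  simp only [quadricSurface]
  rw [quadricForm_focalField hε v hv, quadricForm_focalField hε v hv]
  simp only [add_apply, sub_apply, neg_apply, smul_apply, smul_eq_mul, nsmul_eq_mul,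
    focalCos_focalField, focalCos_self hε h₁, focalCos_self hε h₂, Function.comp, Pi.add_apply,
    Pi.sub_apply, focalCos_comm (ε := ε) Z₂ Z₁]
  field_simp
  rw [sq ε, h22]
  norm_num only [pow_one]
  ring

/-- The force function of the Lagrange problem is compatible with that of the projected problem.
Both are linear in `m₁`, `m₂`, `f`, so this can be checked for each centre alone. -/
theorem quadric_isCompatible (hε : ε = 1 ∨ ε = -1) (h₁ : quadricForm ε Z₁ Z₁ = ε)
    (h₂ : quadricForm ε Z₂ Z₂ = ε) {m₁ m₂ f : ℝ} {q : Space}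
    (hq : q ∈ quadricRegular ε Z₁ Z₂ m₁ m₂ f) :
    (quadricSurface hε hH h₁ h₂).IsCompatible (quadricForce ε Z₁ Z₂ m₁ m₂ f)
      (quadricPotential ε Z₁ Z₂ m₁ m₂ f) q :=
  ((FocalSurface.IsCompatible.const_mul m₁ fun hm =>
      compatible_kepler_left hH hε h₁ h₂ (hq.1 hm)).add
    (FocalSurface.IsCompatible.const_mul m₂ fun hm =>
      compatible_kepler_right hH hε h₁ h₂ (hq.2.1 hm))).add
    (FocalSurface.IsCompatible.const_mul f fun hm => compatible_hooke hH hε h₁ h₂ (hq.2.2 hm))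

/-! ### Confocal conics on the quadrics -/

/-- The length of the focal field is `sin d(q, Z)` or `sinh d(q, Z)`. -/
theorem focalField_norm (hε : ε = 1 ∨ ε = -1) {Z q : Space} (hZ : quadricForm ε Z Z = ε)
    (hq : quadricForm ε q q = ε) :
    quadricForm ε (focalField ε Z q) (focalField ε Z q) = ε * (1 - focalCos ε Z q ^ 2) := by
  rw [quadricForm_focalField hε _ (focalField_mem hε hq), focalCos_focalField, focalCos_self hε hZ]
  ring

theorem focalSin_nonneg (hε : ε = 1 ∨ ε = -1) {Z q : Space} (hZ : quadricForm ε Z Z = ε)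
    (hq : quadricForm ε q q = ε) : 0 ≤ ε * (1 - focalCos ε Z q ^ 2) := by
  rw [← focalField_norm hε hZ hq]
  by_cases h : focalField ε Z q = 0
  · simp [h]
  · exact (quadricForm_pos hε hq (focalField_mem hε hq) h).le

/-- Only multiples of `Z` have vanishing `sin d(q, Z)`. -/
theorem eq_smul_of_focalSin (hε : ε = 1 ∨ ε = -1) {Z q : Space} (hZ : quadricForm ε Z Z = ε)
    (hq : quadricForm ε q q = ε) (h : ¬ 0 < ε * (1 - focalCos ε Z q ^ 2)) :
    Z = focalCos ε Z q • q := by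
  by_contra hne
  apply h
  rw [← focalField_norm hε hZ hq]
  exact quadricForm_pos hε hq (focalField_mem hε hq) (sub_ne_zero.2 hne)

/-- On a level set of `d₁ + σ d₂` with `cos (d₁ + σ d₂)` different from `cos d(Z₁, Z₂)` all
tangent vectors are conic directions. Here `δ` stands for the function `arccos` or `arcosh` that
gives the distance, and `K` for `cos s` or `cosh s`. -/
theorem quadric_isConicDirection (hε : ε = 1 ∨ ε = -1) (h₁ : quadricForm ε Z₁ Z₁ = ε)
    (h₂ : quadricForm ε Z₂ Z₂ = ε) {δ : ℝ → ℝ} {σ s K : ℝ} (hσ : σ ^ 2 = 1)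
    (hδ : ∀ q ∈ quadric ε H, ∀ Z, (Z = Z₁ ∨ Z = Z₂) → 0 < ε * (1 - focalCos ε Z q ^ 2) →
      HasDerivAt δ (-ε / √(ε * (1 - focalCos ε Z q ^ 2))) (focalCos ε Z q))
    {C : Set Space} (hCX : C ⊆ quadric ε H)
    (hC : ∀ q ∈ C, δ (focalCos ε Z₁ q) + σ * δ (focalCos ε Z₂ q) = s)
    (hK : ∀ q ∈ C, focalCos ε Z₁ q * focalCos ε Z₂ q - ε * σ * (√(ε * (1 - focalCos ε Z₁ q ^ 2))
      * √(ε * (1 - focalCos ε Z₂ q ^ 2))) = K) (hKG : K ≠ focalCos ε Z₁ Z₂)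
    {q τ : Space} (hq : q ∈ quadric ε H) (hτ : τ ∈ tangentConeAt ℝ C q) :
    (quadricSurface hε hH h₁ h₂).IsConicDirection q τ := by
  have h22 : ε * ε = 1 := by rcases hε with rfl | rfl <;> norm_num
  have hτT : quadricForm ε q τ = 0 := by
    have := tangentConeAt_mono hCX hτ
    rw [quadric_tangentCone hε hH hq] at this
    exact this
  -- The point `q` of the surface need only be a limit point of the level set `C`.
  have hqK : focalCos ε Z₁ q * focalCos ε Z₂ q - ε * σ * (√(ε * (1 - focalCos ε Z₁ q ^ 2))
      * √(ε * (1 - focalCos ε Z₂ q ^ 2))) = K := by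
    have hcl : IsClosed {q | focalCos ε Z₁ q * focalCos ε Z₂ q
        - ε * σ * (√(ε * (1 - focalCos ε Z₁ q ^ 2)) * √(ε * (1 - focalCos ε Z₂ q ^ 2))) = K} :=
      isClosed_eq (by fun_prop) continuous_const
    exact closure_minimal hK hcl (mem_closure_of_nonempty_tangentConeAt ⟨τ, hτ⟩)
  -- At a focus or its antipode the left side of `hqK` would be `cos d(Z₁, Z₂)`.
  have hp1 : 0 < ε * (1 - focalCos ε Z₁ q ^ 2) := by
    by_contra hcon
    apply hKG
    have h0 : ε * (1 - focalCos ε Z₁ q ^ 2) = 0 :=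
      le_antisymm (not_lt.1 hcon) (focalSin_nonneg hε h₁ hq.1)
    rw [← hqK, h0, focalCos_comm Z₁ Z₂]
    have e := congrArg (focalCos ε Z₂) (eq_smul_of_focalSin hε h₁ hq.1 hcon)
    simpa using e.symm
  have hp2 : 0 < ε * (1 - focalCos ε Z₂ q ^ 2) := by
    by_contra hcon
    apply hKG
    have h0 : ε * (1 - focalCos ε Z₂ q ^ 2) = 0 :=
      le_antisymm (not_lt.1 hcon) (focalSin_nonneg hε h₂ hq.1)
    rw [← hqK, h0]
    have e := congrArg (focalCos ε Z₁) (eq_smul_of_focalSin hε h₂ hq.1 hcon)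
    simpa [mul_comm] using e.symm
  have hd := (((hδ q hq Z₁ (.inl rfl) hp1).comp_hasFDerivAt q (focalCos ε Z₁).hasFDerivAt).add
    (((hδ q hq Z₂ (.inr rfl) hp2).comp_hasFDerivAt q
      (focalCos ε Z₂).hasFDerivAt).const_mul σ)).eq_zero_of_mem_tangentConeAt hC hτ
  simp only [add_apply, smul_apply, smul_eq_mul] at hd
  refine ⟨σ, hσ, ?_, ?_⟩
  · simp only [quadricSurface]
    rw [focalField_norm hε h₁ hq.1, focalField_norm hε h₂ hq.1, quadricForm_focalField hε τ hτT,
      quadricForm_focalField hε τ hτT]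
    have r1 := (Real.sqrt_pos.2 hp1).ne'
    have r2 := (Real.sqrt_pos.2 hp2).ne'
    set s1 := √(ε * (1 - focalCos ε Z₁ q ^ 2))
    set s2 := √(ε * (1 - focalCos ε Z₂ q ^ 2))
    field_simp at hd
    linear_combination (-1) * hd
  · simp only [quadricSurface]
    rw [focalField_norm hε h₁ hq.1, focalField_norm hε h₂ hq.1,
      quadricForm_focalField hε _ (focalField_mem hε hq.1), focalCos_focalField]
    intro h
    apply hKG
    rw [← hqK]
    linear_combination (-ε) * h + (focalCos ε Z₁ Z₂ - focalCos ε Z₁ q * focalCos ε Z₂ q) * h22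

end QuadricForce

/-! ### Central projection of the quadrics -/

section CentralProjection

variable {ε : ℝ} {Z₁ Z₂ : Space}

theorem quadricForm_add_self (hε : ε = 1 ∨ ε = -1) (h₁ : quadricForm ε Z₁ Z₁ = ε)
    (h₂ : quadricForm ε Z₂ Z₂ = ε) :
    ε * quadricForm ε (Z₁ + Z₂) (Z₁ + Z₂) = 2 * (1 + focalCos ε Z₁ Z₂) := by
  have h22 : ε * ε = 1 := by rcases hε with rfl | rfl <;> norm_num
  simp only [map_add, LinearMap.add_apply, h₁, h₂, focalCos_apply, quadricForm_comm ε Z₂ Z₁]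
  linear_combination 2 * h22

theorem quadricMidpoint_self {ε : ℝ} {Z₁ Z₂ : Space} (hε : ε = 1 ∨ ε = -1)
    (h₁ : quadricForm ε Z₁ Z₁ = ε) (h₂ : quadricForm ε Z₂ Z₂ = ε)
    (hG : 0 < 1 + focalCos ε Z₁ Z₂) :
    quadricForm ε (quadricMidpoint ε (quadricForm ε) Z₁ Z₂)
      (quadricMidpoint ε (quadricForm ε) Z₁ Z₂) = ε := by
  have h22 : ε * ε = 1 := by rcases hε with rfl | rfl <;> norm_num
  have hN : √(2 * (1 + focalCos ε Z₁ Z₂)) ≠ 0 := (Real.sqrt_pos.2 (by linarith)).ne'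
  have hs := Real.sq_sqrt (show 0 ≤ 2 * (1 + focalCos ε Z₁ Z₂) by linarith)
  have hadd := quadricForm_add_self hε h₁ h₂
  rw [quadricMidpoint, hadd]
  rw [LinearMap.map_smul₂, map_smul, smul_eq_mul, smul_eq_mul]
  set N := √(2 * (1 + focalCos ε Z₁ Z₂))
  field_simp
  linear_combination (-(quadricForm ε (Z₁ + Z₂) (Z₁ + Z₂))) * h22 + ε * hadd - ε * hs

/-- The linear function whose zero set is the equator with respect to the midpoint. -/
theorem quadricForm_midpoint (hε : ε = 1 ∨ ε = -1) (h₁ : quadricForm ε Z₁ Z₁ = ε)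
    (h₂ : quadricForm ε Z₂ Z₂ = ε) (q : Space) :
    ε * quadricForm ε q (quadricMidpoint ε (quadricForm ε) Z₁ Z₂) =
      (focalCos ε Z₁ q + focalCos ε Z₂ q) / √(2 * (1 + focalCos ε Z₁ Z₂)) := by
  rw [quadricMidpoint, quadricForm_add_self hε h₁ h₂]
  simp only [map_smul, map_add, smul_eq_mul, focalCos_apply, quadricForm_comm ε Z₁ q,
    quadricForm_comm ε Z₂ q]
  ring

theorem halfFocal_eq (hε : ε = 1 ∨ ε = -1) (h₁ : quadricForm ε Z₁ Z₁ = ε)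
    (h₂ : quadricForm ε Z₂ Z₂ = ε) (hG : 0 < 1 + focalCos ε Z₁ Z₂) :
    halfFocal ε (quadricForm ε) Z₁ Z₂ =
      (√(2 * (1 + focalCos ε Z₁ Z₂)))⁻¹ • (Z₁ - Z₂) := by
  have hN : √(2 * (1 + focalCos ε Z₁ Z₂)) ≠ 0 := (Real.sqrt_pos.2 (by linarith)).ne'
  have hs := Real.sq_sqrt (show 0 ≤ 2 * (1 + focalCos ε Z₁ Z₂) by linarith)
  have hz : (1 + focalCos ε Z₁ Z₂) / √(2 * (1 + focalCos ε Z₁ Z₂)) =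
      √(2 * (1 + focalCos ε Z₁ Z₂)) / 2 := by
    rw [div_eq_div_iff hN two_ne_zero]
    linear_combination -hs
  simp only [halfFocal, centralPoint]
  rw [quadricForm_midpoint hε h₁ h₂, focalCos_self hε h₁, focalCos_comm Z₂ Z₁, hz]
  simp only [quadricMidpoint, quadricForm_add_self hε h₁ h₂]
  set N := √(2 * (1 + focalCos ε Z₁ Z₂))
  rw [inv_div, div_eq_mul_inv]
  module

theorem focalFactor_eq (hε : ε = 1 ∨ ε = -1) (h₁ : quadricForm ε Z₁ Z₁ = ε)
    (h₂ : quadricForm ε Z₂ Z₂ = ε) (hG : 0 < 1 + focalCos ε Z₁ Z₂) :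
    focalFactor ε (quadricForm ε) Z₁ Z₂ = 2 / (1 + focalCos ε Z₁ Z₂) := by
  have h22 : ε * ε = 1 := by rcases hε with rfl | rfl <;> norm_num
  have hN : √(2 * (1 + focalCos ε Z₁ Z₂)) ≠ 0 := (Real.sqrt_pos.2 (by linarith)).ne'
  have hs := Real.sq_sqrt (show 0 ≤ 2 * (1 + focalCos ε Z₁ Z₂) by linarith)
  have e : ε * quadricForm ε Z₁ Z₂ = focalCos ε Z₁ Z₂ := rfl
  simp only [focalFactor, halfFocal_eq hε h₁ h₂ hG]
  set N := √(2 * (1 + focalCos ε Z₁ Z₂))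
  simp only [map_sub, map_smul, LinearMap.smul_apply, LinearMap.sub_apply, smul_eq_mul, h₁, h₂,
    quadricForm_comm ε Z₂ Z₁]
  field_simp
  rw [hs]
  linear_combination 2 * (1 + focalCos ε Z₁ Z₂) * h22 - 2 * (1 + focalCos ε Z₁ Z₂) * e

/-- The affinely changed metric in terms of the ambient form, without a choice of coordinates in the
tangent plane. -/
theorem affineForm_self (hε : ε = 1 ∨ ε = -1) (h₁ : quadricForm ε Z₁ Z₁ = ε)
    (h₂ : quadricForm ε Z₂ Z₂ = ε) (hG : 0 < 1 + focalCos ε Z₁ Z₂) (x : Space) :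
    affineForm ε (quadricForm ε) Z₁ Z₂ x x =
      quadricForm ε x x - ε / 4 * (focalCos ε Z₁ x - focalCos ε Z₂ x) ^ 2 := by
  have h22 : ε * ε = 1 := by rcases hε with rfl | rfl <;> norm_num
  have hN : √(2 * (1 + focalCos ε Z₁ Z₂)) ≠ 0 := (Real.sqrt_pos.2 (by linarith)).ne'
  have hs := Real.sq_sqrt (show 0 ≤ 2 * (1 + focalCos ε Z₁ Z₂) by linarith)
  simp only [affineForm, halfFocal_eq hε h₁ h₂ hG, focalFactor_eq hε h₁ h₂ hG]
  set N := √(2 * (1 + focalCos ε Z₁ Z₂))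
  simp only [map_sub, map_smul, LinearMap.smul_apply, LinearMap.sub_apply, smul_eq_mul,
    LinearMap.smulRight_apply]
  rw [focalCos_apply ε Z₁ x, focalCos_apply ε Z₂ x]
  have hd : quadricForm ε Z₁ x - quadricForm ε Z₂ x = ε * (ε * quadricForm ε Z₁ x
    - ε * quadricForm ε Z₂ x) := by
    linear_combination (-(quadricForm ε Z₁ x - quadricForm ε Z₂ x)) * h22
  rw [hd]
  have hi : N⁻¹ * N⁻¹ * (1 + focalCos ε Z₁ Z₂) = 1 / 2 := by
    field_simp
    linarith
  rw [div_div_eq_mul_div]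
  linear_combination (-(ε / 2 * (ε * (ε * quadricForm ε Z₁ x - ε * quadricForm ε Z₂ x)) ^ 2)) * hi
    - ε / 4 * (ε * quadricForm ε Z₁ x - ε * quadricForm ε Z₂ x) ^ 2 * h22

end CentralProjection

section ProjectedEnergy

variable {ε : ℝ} {Z₁ Z₂ : Space}

/-- The vanishing of the Gram determinant of `v` and the two focal fields in the tangent plane. -/
theorem focalSurface_gram {E : Type} [NormedAddCommGroup E] [NormedSpace ℝ E] {X : Set E}
    {g : LinearMap.BilinForm ℝ E} (D : FocalSurface X g) {q v : E} (hq : q ∈ X) (hv : v ∈ D.T q) :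
    g v v * (g (D.c₁ q) (D.c₁ q) * g (D.c₂ q) (D.c₂ q) - g (D.c₁ q) (D.c₂ q) ^ 2) =
      g (D.c₁ q) v ^ 2 * g (D.c₂ q) (D.c₂ q) + g (D.c₂ q) v ^ 2 * g (D.c₁ q) (D.c₁ q)
        - 2 * (g (D.c₁ q) v * g (D.c₂ q) v * g (D.c₁ q) (D.c₂ q)) := by
  by_cases hv0 : v = 0
  · simp [hv0]
  have p11 := D.parseval q hq v hv _ (D.c₁_mem q hq) _ (D.c₁_mem q hq)
  have p12 := D.parseval q hq v hv _ (D.c₁_mem q hq) _ (D.c₂_mem q hq)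
  have p22 := D.parseval q hq v hv _ (D.c₂_mem q hq) _ (D.c₂_mem q hq)
  apply mul_left_cancel₀ (D.pos q hq v hv hv0).ne'
  set t := g v v
  set g11 := g (D.c₁ q) (D.c₁ q)
  set g12 := g (D.c₁ q) (D.c₂ q)
  set g22 := g (D.c₂ q) (D.c₂ q)
  set a1 := g (D.c₁ q) v
  set a2 := g (D.c₂ q) v
  set b1 := g (D.c₁ q) (D.J q v)
  set b2 := g (D.c₂ q) (D.J q v)
  linear_combination (t * g22 - a2 ^ 2) * p11 + (b1 ^ 2 + a1 * a1 - a1 ^ 2) * p22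
    + (2 * a1 * a2 - t * g12 - a1 * a2 - b1 * b2) * p12

/-- The central projection turns the changed metric of the tangent plane into the quadratic part of
the integral of `quadricSurface`. The two sides differ by a multiple of the Gram relation between
`v` and the focal fields. -/
theorem projected_kinetic (hε : ε = 1 ∨ ε = -1) {H : Set Space} (hH : IsOpen H)
    (h₁ : quadricForm ε Z₁ Z₁ = ε) (h₂ : quadricForm ε Z₂ Z₂ = ε)
    (hG : 0 < 1 + focalCos ε Z₁ Z₂) {q v : Space} (hq : q ∈ quadric ε H)
    (hv : quadricForm ε q v = 0) :
    affineForm ε (quadricForm ε) Z₁ Z₂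
      (centralVelocity ε (quadricForm ε) (quadricMidpoint ε (quadricForm ε) Z₁ Z₂) q v)
      (centralVelocity ε (quadricForm ε) (quadricMidpoint ε (quadricForm ε) Z₁ Z₂) q v) =
    ((1 - focalCos ε Z₁ Z₂) / 2 + focalCos ε Z₁ q * focalCos ε Z₂ q) * quadricForm ε v v
      + ε * (quadricForm ε (focalField ε Z₁ q) v * quadricForm ε (focalField ε Z₂ q) v) := by
  have h22 : ε * ε = 1 := by rcases hε with rfl | rfl <;> norm_num
  have hN : √(2 * (1 + focalCos ε Z₁ Z₂)) ≠ 0 := (Real.sqrt_pos.2 (by linarith)).ne'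
  have hs := Real.sq_sqrt (show 0 ≤ 2 * (1 + focalCos ε Z₁ Z₂) by linarith)
  have hgram := focalSurface_gram (quadricSurface hε hH h₁ h₂) hq hv
  simp only [quadricSurface] at hgram
  rw [focalField_norm hε h₁ hq.1, focalField_norm hε h₂ hq.1,
    quadricForm_focalField hε _ (focalField_mem hε hq.1), focalCos_focalField,
    quadricForm_focalField hε v hv, quadricForm_focalField hε v hv] at hgram
  have hcv : centralVelocity ε (quadricForm ε) (quadricMidpoint ε (quadricForm ε) Z₁ Z₂) q v =
      (√(2 * (1 + focalCos ε Z₁ Z₂)))⁻¹ • ((focalCos ε Z₁ q + focalCos ε Z₂ q) • v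
        - (focalCos ε Z₁ v + focalCos ε Z₂ v) • q) := by
    rw [centralVelocity, smul_sub, smul_smul, smul_smul, quadricForm_midpoint hε h₁ h₂,
      quadricForm_midpoint hε h₁ h₂]
    module
  have hqq : quadricForm ε q q = ε := hq.1
  rw [hcv, affineForm_self hε h₁ h₂ hG, quadricForm_focalField hε v hv,
    quadricForm_focalField hε v hv]
  set N := √(2 * (1 + focalCos ε Z₁ Z₂))
  simp only [map_sub, map_smul, LinearMap.smul_apply, LinearMap.sub_apply, smul_eq_mul, hqq, hv,
    quadricForm_comm ε v q]
  have hGN : focalCos ε Z₁ Z₂ = N ^ 2 / 2 - 1 := by linarith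
  rw [hGN] at hgram ⊢
  rcases hε with rfl | rfl
  · field_simp
    linear_combination (-16) * hgram
  · field_simp
    linear_combination (-16) * hgram

theorem centralPoint_left (hε : ε = 1 ∨ ε = -1) (h₁ : quadricForm ε Z₁ Z₁ = ε)
    (h₂ : quadricForm ε Z₂ Z₂ = ε) (hG : 0 < 1 + focalCos ε Z₁ Z₂) :
    centralPoint ε (quadricForm ε) (quadricMidpoint ε (quadricForm ε) Z₁ Z₂) Z₁ =
      (2 / √(2 * (1 + focalCos ε Z₁ Z₂))) • Z₁ := by
  have hN : √(2 * (1 + focalCos ε Z₁ Z₂)) ≠ 0 := (Real.sqrt_pos.2 (by linarith)).ne'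
  have hs := Real.sq_sqrt (show 0 ≤ 2 * (1 + focalCos ε Z₁ Z₂) by linarith)
  rw [centralPoint, quadricForm_midpoint hε h₁ h₂, focalCos_self hε h₁, focalCos_comm Z₂ Z₁,
    inv_div]
  congr 1
  rw [div_eq_div_iff hG.ne' hN]
  linear_combination hs

theorem centralPoint_right (hε : ε = 1 ∨ ε = -1) (h₁ : quadricForm ε Z₁ Z₁ = ε)
    (h₂ : quadricForm ε Z₂ Z₂ = ε) (hG : 0 < 1 + focalCos ε Z₁ Z₂) :
    centralPoint ε (quadricForm ε) (quadricMidpoint ε (quadricForm ε) Z₁ Z₂) Z₂ =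
      (2 / √(2 * (1 + focalCos ε Z₁ Z₂))) • Z₂ := by
  have hM : quadricMidpoint ε (quadricForm ε) Z₁ Z₂ = quadricMidpoint ε (quadricForm ε) Z₂ Z₁ := by
    simp only [quadricMidpoint, add_comm]
  rw [hM, centralPoint_left hε h₂ h₁ (by rwa [focalCos_comm]), focalCos_comm]

theorem affineForm_symm (hε : ε = 1 ∨ ε = -1) (h₁ : quadricForm ε Z₁ Z₁ = ε)
    (h₂ : quadricForm ε Z₂ Z₂ = ε) (hG : 0 < 1 + focalCos ε Z₁ Z₂) (x : Space) :
    affineForm ε (quadricForm ε) Z₁ Z₂ x x = affineForm ε (quadricForm ε) Z₂ Z₁ x x := by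
  rw [affineForm_self hε h₁ h₂ hG, affineForm_self hε h₂ h₁ (by rwa [focalCos_comm])]
  ring

/-- The distance in the tangent plane from the projection of `q` to the projection of a focus. -/
theorem affineForm_center (hε : ε = 1 ∨ ε = -1) (h₁ : quadricForm ε Z₁ Z₁ = ε)
    (h₂ : quadricForm ε Z₂ Z₂ = ε) (hG : 0 < 1 + focalCos ε Z₁ Z₂) {q : Space}
    (hq : quadricForm ε q q = ε) (hS : focalCos ε Z₁ q + focalCos ε Z₂ q ≠ 0) {x : Space}
    (hx : x = (√(2 * (1 + focalCos ε Z₁ Z₂)) / (focalCos ε Z₁ q + focalCos ε Z₂ q)) • q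
      - (2 / √(2 * (1 + focalCos ε Z₁ Z₂))) • Z₁) :
    affineForm ε (quadricForm ε) Z₁ Z₂ x x = ε * (1 - focalCos ε Z₁ q ^ 2)
      * (√(2 * (1 + focalCos ε Z₁ Z₂)) / (focalCos ε Z₁ q + focalCos ε Z₂ q)) ^ 2 := by
  have h22 : ε * ε = 1 := by rcases hε with rfl | rfl <;> norm_num
  have hN : √(2 * (1 + focalCos ε Z₁ Z₂)) ≠ 0 := (Real.sqrt_pos.2 (by linarith)).ne'
  have hs := Real.sq_sqrt (show 0 ≤ 2 * (1 + focalCos ε Z₁ Z₂) by linarith)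
  have hZq : quadricForm ε Z₁ q = ε * focalCos ε Z₁ q := by
    rw [focalCos_apply, ← mul_assoc, h22, one_mul]
  rw [affineForm_self hε h₁ h₂ hG, hx]
  simp only [map_sub, map_smul, LinearMap.smul_apply, LinearMap.sub_apply, smul_eq_mul, hq, h₁,
    quadricForm_comm ε q Z₁, hZq, focalCos_self hε h₁, focalCos_comm Z₂ Z₁]
  set N := √(2 * (1 + focalCos ε Z₁ Z₂))
  have hGN : focalCos ε Z₁ Z₂ = N ^ 2 / 2 - 1 := by linarith
  rw [hGN]
  field_simp
  ring

/-- The distance in the tangent plane from the projection of `q` to the midpoint. -/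
theorem affineForm_midpoint (hε : ε = 1 ∨ ε = -1) (h₁ : quadricForm ε Z₁ Z₁ = ε)
    (h₂ : quadricForm ε Z₂ Z₂ = ε) (hG : 0 < 1 + focalCos ε Z₁ Z₂) {q : Space}
    (hq : quadricForm ε q q = ε) (hS : focalCos ε Z₁ q + focalCos ε Z₂ q ≠ 0) {x : Space}
    (hx : x = (√(2 * (1 + focalCos ε Z₁ Z₂)) / (focalCos ε Z₁ q + focalCos ε Z₂ q)) • q
      - (√(2 * (1 + focalCos ε Z₁ Z₂)))⁻¹ • (Z₁ + Z₂)) :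
    affineForm ε (quadricForm ε) Z₁ Z₂ x x = ε * ((1 + focalCos ε Z₁ Z₂) / 2
      * (4 - (focalCos ε Z₁ q - focalCos ε Z₂ q) ^ 2)
      / (focalCos ε Z₁ q + focalCos ε Z₂ q) ^ 2 - 1) := by
  have h22 : ε * ε = 1 := by rcases hε with rfl | rfl <;> norm_num
  have hN : √(2 * (1 + focalCos ε Z₁ Z₂)) ≠ 0 := (Real.sqrt_pos.2 (by linarith)).ne'
  have hs := Real.sq_sqrt (show 0 ≤ 2 * (1 + focalCos ε Z₁ Z₂) by linarith)
  have hZ : ∀ Z y, quadricForm ε Z y = ε * focalCos ε Z y := fun Z y => by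
    rw [focalCos_apply, ← mul_assoc, h22, one_mul]
  rw [affineForm_self hε h₁ h₂ hG, hx]
  simp only [map_sub, map_add, map_smul, LinearMap.smul_apply, LinearMap.sub_apply,
    LinearMap.add_apply, smul_eq_mul, hq, h₁, h₂, quadricForm_comm ε q Z₁, quadricForm_comm ε q Z₂,
    quadricForm_comm ε Z₂ Z₁, hZ Z₁ q, hZ Z₂ q, hZ Z₁ Z₂, focalCos_self hε h₁,
    focalCos_self hε h₂, focalCos_comm Z₂ Z₁]
  set N := √(2 * (1 + focalCos ε Z₁ Z₂))
  have hGN : focalCos ε Z₁ Z₂ = N ^ 2 / 2 - 1 := by linarith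
  rw [hGN]
  field_simp
  ring

/-- The energy of the centrally projected problem is the additional integral. On the side
`focalCos ε Z₁ q + focalCos ε Z₂ q < 0` of the equator (`s = -1`) the mass factors change sign. -/
theorem projected_energy (hε : ε = 1 ∨ ε = -1) {H : Set Space} (hH : IsOpen H)
    (h₁ : quadricForm ε Z₁ Z₁ = ε) (h₂ : quadricForm ε Z₂ Z₂ = ε)
    (hG : 0 < 1 + focalCos ε Z₁ Z₂) (m₁ m₂ f : ℝ) {s : ℝ} (hs1 : s * s = 1) {q v : Space}
    (hq : q ∈ quadric ε H) (hv : quadricForm ε q v = 0)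
    (hS : 0 < s * (focalCos ε Z₁ q + focalCos ε Z₂ q)) :
    (projectedLagrange ε (quadricForm ε) Z₁ Z₂ (s * m₁) (s * m₂) f).energy
        (projectedPhase ε (quadricForm ε) Z₁ Z₂ (q, v)) =
      (quadricSurface hε hH h₁ h₂).integral (quadricPotential ε Z₁ Z₂ m₁ m₂ f) (q, v) := by
  have hN : 0 < √(2 * (1 + focalCos ε Z₁ Z₂)) := Real.sqrt_pos.2 (by linarith)
  have hs := Real.sq_sqrt (show 0 ≤ 2 * (1 + focalCos ε Z₁ Z₂) by linarith)
  have hS0 : focalCos ε Z₁ q + focalCos ε Z₂ q ≠ 0 := by rintro h; simp [h] at hS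
  have hcp : centralPoint ε (quadricForm ε) (quadricMidpoint ε (quadricForm ε) Z₁ Z₂) q =
      (√(2 * (1 + focalCos ε Z₁ Z₂)) / (focalCos ε Z₁ q + focalCos ε Z₂ q)) • q := by
    rw [centralPoint, quadricForm_midpoint hε h₁ h₂, inv_div]
  have hmid : midpoint ℝ ((2 / √(2 * (1 + focalCos ε Z₁ Z₂))) • Z₁)
      ((2 / √(2 * (1 + focalCos ε Z₁ Z₂))) • Z₂) =
      (√(2 * (1 + focalCos ε Z₁ Z₂)))⁻¹ • (Z₁ + Z₂) := by
    rw [midpoint_eq_smul_add, ← smul_add, smul_smul]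
    congr 1
    simp only [invOf_eq_inv]
    ring
  have hff : √(focalFactor ε (quadricForm ε) Z₁ Z₂) = 2 / √(2 * (1 + focalCos ε Z₁ Z₂)) := by
    rw [focalFactor_eq hε h₁ h₂ hG]
    rw [show 2 / (1 + focalCos ε Z₁ Z₂) = (2 / √(2 * (1 + focalCos ε Z₁ Z₂))) ^ 2 by
      rw [div_pow, hs]; field_simp]
    exact Real.sqrt_sq (by positivity)
  simp only [MechanicalSystem.energy, projectedLagrange, projectedPhase, flatLagrange,
    FocalSurface.integral, focalIntegral]
  rw [projected_kinetic hε hH h₁ h₂ hG hq hv, hcp, centralPoint_left hε h₁ h₂ hG,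
    centralPoint_right hε h₁ h₂ hG, hmid, hff, affineForm_center hε h₁ h₂ hG hq.1 hS0 rfl,
    affineForm_midpoint hε h₁ h₂ hG hq.1 hS0 rfl]
  rw [affineForm_symm hε h₁ h₂ hG, affineForm_center hε h₂ h₁ (by rwa [focalCos_comm]) hq.1
    (by rwa [add_comm]) (by rw [focalCos_comm Z₂ Z₁, add_comm (focalCos ε Z₂ q)]),
    focalCos_comm Z₂ Z₁, add_comm (focalCos ε Z₂ q)]
  -- The root of the square is an absolute value, and `s` is the sign of the denominator.
  have hab : ∀ ρ, √(ρ * (√(2 * (1 + focalCos ε Z₁ Z₂))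
      / (focalCos ε Z₁ q + focalCos ε Z₂ q)) ^ 2) =
      √ρ * (√(2 * (1 + focalCos ε Z₁ Z₂)) * s / (focalCos ε Z₁ q + focalCos ε Z₂ q)) := by
    intro ρ
    rw [Real.sqrt_mul' _ (sq_nonneg _), Real.sqrt_sq_eq_abs]
    congr 1
    rw [← abs_of_pos (show 0 < √(2 * (1 + focalCos ε Z₁ Z₂)) * s
      / (focalCos ε Z₁ q + focalCos ε Z₂ q) from ?_), abs_div, abs_div, abs_mul]
    · have : |s| = 1 := by
        rcases mul_self_eq_one_iff.1 hs1 with rfl | rfl <;> simp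
      rw [this, mul_one]
    · rw [mul_div_assoc]
      refine mul_pos hN ?_
      rcases pos_and_pos_or_neg_and_neg_of_mul_pos hS with h | h
      · exact div_pos h.1 h.2
      · exact div_pos_of_neg_of_neg h.1 h.2
  rw [hab, hab]
  have hsn : s ≠ 0 := by rintro rfl; simp at hs1
  simp only [quadricSurface, quadricPotential]
  set N := √(2 * (1 + focalCos ε Z₁ Z₂))
  have hk : ∀ m ρ : ℝ, s * m / (2 / N) / (ρ * (N * s / (focalCos ε Z₁ q + focalCos ε Z₂ q))) =
      m * ((focalCos ε Z₁ q + focalCos ε Z₂ q) / (2 * ρ)) := by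
    intro m ρ
    by_cases hρ : ρ = 0
    · simp [hρ]
    · field_simp
  rw [hk, hk]

end ProjectedEnergy

/-! ### Walls composed of conics -/

theorem FocalSurface.isConicDirection_of_isCombination {E : Type} [NormedAddCommGroup E]
    [NormedSpace ℝ E] {X : Set E} {g : LinearMap.BilinForm ℝ E} (D : FocalSurface X g)
    {family : Set E → Prop} {B : Set E} (hB : IsCombination family B)
    (h : ∀ C, family C → ∀ q ∈ X, ∀ τ ∈ tangentConeAt ℝ C q, D.IsConicDirection q τ) :
    ∀ q ∈ X, ∀ τ ∈ tangentConeAt ℝ B q, D.IsConicDirection q τ := by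
  intro q hq τ hτ
  obtain ⟨𝒞, hfin, hfam, hsub⟩ := hB
  obtain ⟨C, hC, hτC⟩ := exists_mem_tangentConeAt_of_finite hfin hsub hτ
  exact h C (hfam C hC) q hq τ hτC

/-- A hyperbola is the union of two level sets of the difference of the focal distances. -/
theorem exists_mem_tangentConeAt_focalHyperbola {E : Type} [NormedAddCommGroup E]
    [NormedSpace ℝ E] {M : Set E} {d : E → E → ℝ} {Z₁ Z₂ : E} {s : ℝ} {q τ : E}
    (hτ : τ ∈ tangentConeAt ℝ (focalHyperbola M d Z₁ Z₂ s) q) :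
    ∃ s', |s'| = |s| ∧ τ ∈ tangentConeAt ℝ {x ∈ M | d x Z₁ + -1 * d x Z₂ = s'} q := by
  have hsub : focalHyperbola M d Z₁ Z₂ s ⊆
      ⋃₀ {{x ∈ M | d x Z₁ + -1 * d x Z₂ = s}, {x ∈ M | d x Z₁ + -1 * d x Z₂ = -s}} := by
    rintro x ⟨hxM, hx⟩
    rcases eq_or_eq_neg_of_abs_eq hx with h | h
    · exact ⟨_, .inl rfl, hxM, by linarith⟩
    · exact ⟨_, .inr rfl, hxM, by linarith⟩
  obtain ⟨C, hC, hτC⟩ := exists_mem_tangentConeAt_of_finite (by simp) hsub hτ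
  rcases hC with rfl | rfl
  · exact ⟨s, rfl, hτC⟩
  · exact ⟨-s, abs_neg s, hτC⟩

/-! ### The sphere -/

section Sphere

theorem quadric_one : quadric 1 Set.univ = unitSphere := by
  ext q
  simp only [quadric, unitSphere, quadricForm_one, Set.inter_univ, Set.mem_ofPred_eq,
    innerₗ_apply_apply, real_inner_self_eq_norm_sq, mem_sphere_zero_iff_norm]
  exact pow_eq_one_iff_of_nonneg (norm_nonneg q) two_ne_zero

theorem focalCos_one (Z q : Space) : focalCos 1 Z q = inner ℝ q Z := by
  rw [focalCos_apply, quadricForm_one, one_mul, innerₗ_apply_apply, real_inner_comm]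

theorem sphereDist_eq {q Z : Space} (hq : q ∈ unitSphere) (hZ : Z ∈ unitSphere) :
    sphereDist q Z = Real.arccos (focalCos 1 Z q) := by
  have hq' : ‖q‖ = 1 := by simpa [unitSphere] using hq
  have hZ' : ‖Z‖ = 1 := by simpa [unitSphere] using hZ
  rw [sphereDist, InnerProductGeometry.angle, hq', hZ', focalCos_one]
  simp

theorem quadricForm_one_self {Z : Space} (hZ : Z ∈ unitSphere) : quadricForm 1 Z Z = 1 := by
  rw [← quadric_one] at hZ
  exact hZ.1

theorem abs_focalCos_one_le {q Z : Space} (hq : q ∈ unitSphere) (hZ : Z ∈ unitSphere) :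
    -1 ≤ focalCos 1 Z q ∧ focalCos 1 Z q ≤ 1 := by
  have h := focalSin_nonneg (.inl rfl) (quadricForm_one_self hZ) (quadricForm_one_self hq)
  constructor <;> nlinarith

theorem cot_sphereDist {q Z : Space} (hq : q ∈ unitSphere) (hZ : Z ∈ unitSphere) :
    Real.cot (sphereDist q Z) = focalCos 1 Z q / √(1 * (1 - focalCos 1 Z q ^ 2)) := by
  have h := abs_focalCos_one_le hq hZ
  rw [sphereDist_eq hq hZ, Real.cot_eq_cos_div_sin, Real.cos_arccos h.1 h.2, Real.sin_arccos,
    one_mul]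

theorem focalCos_one_regular {q Z : Space} (hq : q ∈ unitSphere) (hZ : Z ∈ unitSphere) :
    0 < 1 * (1 - focalCos 1 Z q ^ 2) ↔ q ≠ Z ∧ q ≠ -Z := by
  have hZ' := quadricForm_one_self hZ
  constructor
  · refine fun h => ⟨?_, ?_⟩ <;> rintro rfl
    · simp [focalCos_self (.inl rfl) hZ'] at h
    · simp [focalCos_self (.inl rfl) hZ'] at h
  · rintro ⟨h1, h2⟩
    by_contra hcon
    have h := eq_smul_of_focalSin (.inl rfl) hZ' (quadricForm_one_self hq) hcon
    have h0 := focalSin_nonneg (.inl rfl) hZ' (quadricForm_one_self hq)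
    have : focalCos 1 Z q * focalCos 1 Z q = 1 := by linarith
    rcases mul_self_eq_one_iff.1 this with h3 | h3
    · exact h1 (by rw [h, h3, one_smul])
    · exact h2 (by rw [h, h3]; simp)

theorem one_add_focalCos_pos {Z₁ Z₂ : Space} (h₁ : Z₁ ∈ unitSphere) (h₂ : Z₂ ∈ unitSphere)
    (h : Z₂ ≠ -Z₁) : 0 < 1 + focalCos 1 Z₁ Z₂ := by
  have h3 := quadricForm_add_self (.inl rfl) (quadricForm_one_self h₁) (quadricForm_one_self h₂)
  have h4 : 0 < quadricForm 1 (Z₁ + Z₂) (Z₁ + Z₂) := by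
    rw [quadricForm_one]
    have h5 : Z₁ + Z₂ ≠ 0 := fun h0 => h (by rw [eq_neg_iff_add_eq_zero, add_comm, h0])
    exact real_inner_self_pos.2 h5
  linarith

theorem inner_sphereMid {Z₁ Z₂ : Space} (h₁ : Z₁ ∈ unitSphere) (h₂ : Z₂ ∈ unitSphere) (q : Space) :
    inner ℝ q (sphereMid Z₁ Z₂) =
      (focalCos 1 Z₁ q + focalCos 1 Z₂ q) / √(2 * (1 + focalCos 1 Z₁ Z₂)) := by
  have h := quadricForm_midpoint (.inl rfl) (quadricForm_one_self h₁) (quadricForm_one_self h₂) q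
  rw [← h, sphereMid, quadricForm_one, one_mul]
  rfl

theorem sphericalLagrange_carrier {Z₁ Z₂ : Space} (h₁ : Z₁ ∈ unitSphere) (h₂ : Z₂ ∈ unitSphere)
    (h : Z₂ ≠ -Z₁) (m₁ m₂ f : ℝ) :
    (sphericalLagrange Z₁ Z₂ m₁ m₂ f).carrier =
      quadric 1 Set.univ ∩ quadricRegular 1 Z₁ Z₂ m₁ m₂ f := by
  have hN : √(2 * (1 + focalCos 1 Z₁ Z₂)) ≠ 0 :=
    (Real.sqrt_pos.2 (by linarith [one_add_focalCos_pos h₁ h₂ h])).ne'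
  rw [quadric_one]
  ext q
  refine and_congr_right fun hq => ?_
  refine and_congr (imp_congr_right fun _ => (focalCos_one_regular hq h₁).symm)
    (and_congr (imp_congr_right fun _ => (focalCos_one_regular hq h₂).symm)
    (imp_congr_right fun _ => not_congr ?_))
  rw [inner_sphereMid h₁ h₂, div_eq_zero_iff, or_iff_left hN]

theorem sphericalLagrange_force {Z₁ Z₂ : Space} (h₁ : Z₁ ∈ unitSphere) (h₂ : Z₂ ∈ unitSphere)
    (h : Z₂ ≠ -Z₁) {m₁ m₂ f : ℝ} {q : Space} (hq : q ∈ unitSphere)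
    (hf : f ≠ 0 → focalCos 1 Z₁ q + focalCos 1 Z₂ q ≠ 0) :
    (sphericalLagrange Z₁ Z₂ m₁ m₂ f).force q = quadricForce 1 Z₁ Z₂ m₁ m₂ f q := by
  simp only [sphericalLagrange, quadricForce]
  rw [cot_sphereDist hq h₁, cot_sphereDist hq h₂]
  congr 1
  by_cases hf0 : f = 0
  · simp [hf0]
  have hG := one_add_focalCos_pos h₁ h₂ h
  have hS := hf hf0
  have hN : √(2 * (1 + focalCos 1 Z₁ Z₂)) ≠ 0 := (Real.sqrt_pos.2 (by linarith)).ne'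
  have hs := Real.sq_sqrt (show 0 ≤ 2 * (1 + focalCos 1 Z₁ Z₂) by linarith)
  have hM : sphereMid Z₁ Z₂ ∈ unitSphere := by
    have := quadricMidpoint_self (.inl rfl) (quadricForm_one_self h₁) (quadricForm_one_self h₂) hG
    rw [← quadric_one]
    rw [quadricForm_one] at this
    refine ⟨?_, trivial⟩
    change quadricForm 1 _ _ = 1
    rw [quadricForm_one]
    exact this
  have hc := focalSin_nonneg (.inl rfl) (quadricForm_one_self hM) (quadricForm_one_self hq)
  rw [sphereDist_eq hq hM, Real.tan_arccos, div_pow, Real.sq_sqrt (by linarith), focalCos_one,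
    inner_sphereMid h₁ h₂]
  field_simp
  rw [hs]

theorem cos_sphereDist {q Z : Space} (hq : q ∈ unitSphere) (hZ : Z ∈ unitSphere) :
    Real.cos (sphereDist q Z) = focalCos 1 Z q := by
  rw [sphereDist_eq hq hZ]
  exact Real.cos_arccos (abs_focalCos_one_le hq hZ).1 (abs_focalCos_one_le hq hZ).2

theorem sphere_level_isConicDirection {Z₁ Z₂ : Space} (h₁ : quadricForm 1 Z₁ Z₁ = 1)
    (h₂ : quadricForm 1 Z₂ Z₂ = 1) {σ s : ℝ} (hσ : σ = 1 ∨ σ = -1)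
    (hs : Real.cos s ≠ Real.cos (sphereDist Z₁ Z₂)) {q τ : Space} (hq : q ∈ quadric 1 Set.univ)
    (hτ : τ ∈ tangentConeAt ℝ
      {x ∈ unitSphere | sphereDist x Z₁ + σ * sphereDist x Z₂ = s} q) :
    (quadricSurface (.inl rfl) isOpen_univ h₁ h₂).IsConicDirection q τ := by
  have h₁' : Z₁ ∈ unitSphere := by rw [← quadric_one]; exact ⟨h₁, trivial⟩
  have h₂' : Z₂ ∈ unitSphere := by rw [← quadric_one]; exact ⟨h₂, trivial⟩
  refine quadric_isConicDirection (δ := Real.arccos) (σ := σ) (s := s) (K := Real.cos s)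
    isOpen_univ (.inl rfl) h₁ h₂ (by rcases hσ with rfl | rfl <;> norm_num) ?_ ?_ ?_ ?_ ?_ hq hτ
  · intro x hx Z hZ h
    rw [one_mul] at h ⊢
    have := Real.hasDerivAt_arccos (x := focalCos 1 Z x) (by rintro h0; simp [h0] at h)
      (by rintro h0; simp [h0] at h)
    exact this.congr_deriv (by ring)
  · rw [quadric_one]; exact fun x hx => hx.1
  · rintro x ⟨hx, hxs⟩
    rw [← sphereDist_eq hx h₁', ← sphereDist_eq hx h₂', hxs]
  · rintro x ⟨hx, hxs⟩
    rw [← hxs, Real.cos_add, cos_sphereDist hx h₁', sphereDist_eq hx h₁', sphereDist_eq hx h₂']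
    rcases hσ with rfl | rfl
    · simp only [one_mul, Real.sin_arccos, mul_one,
        Real.cos_arccos (abs_focalCos_one_le hx h₂').1 (abs_focalCos_one_le hx h₂').2]
    · simp only [neg_mul, one_mul, Real.cos_neg, Real.sin_neg, Real.sin_arccos, mul_neg, mul_one,
        Real.cos_arccos (abs_focalCos_one_le hx h₂').1 (abs_focalCos_one_le hx h₂').2]
  · rwa [cos_sphereDist h₁' h₂', focalCos_comm] at hs

theorem sphericalConic_isConicDirection {Z₁ Z₂ : Space} (h₁ : quadricForm 1 Z₁ Z₁ = 1)
    (h₂ : quadricForm 1 Z₂ Z₂ = 1) {C : Set Space} (hC : IsSphericalConic Z₁ Z₂ C) :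
    ∀ q ∈ quadric 1 Set.univ, ∀ τ ∈ tangentConeAt ℝ C q,
      (quadricSurface (.inl rfl) isOpen_univ h₁ h₂).IsConicDirection q τ := by
  intro q hq τ hτ
  have hd0 : 0 ≤ sphereDist Z₁ Z₂ := InnerProductGeometry.angle_nonneg _ _
  have hdπ : sphereDist Z₁ Z₂ ≤ Real.pi := InnerProductGeometry.angle_le_pi _ _
  rcases hC with ⟨s, hs1, hs2, rfl⟩ | ⟨s, hs1, hs2, rfl⟩
  · refine sphere_level_isConicDirection h₁ h₂ (σ := 1) (s := s) (.inl rfl) ?_ hq ?_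
    -- The bound `s < 2π - d(Z₁, Z₂)` is needed here: at equality the cosines coincide.
    · rw [← sub_ne_zero, Real.cos_sub_cos]
      have e1 := Real.sin_pos_of_pos_of_lt_pi (x := (s + sphereDist Z₁ Z₂) / 2)
        (by linarith) (by linarith)
      have e2 := Real.sin_pos_of_pos_of_lt_pi (x := (s - sphereDist Z₁ Z₂) / 2)
        (by linarith) (by linarith)
      exact mul_ne_zero (mul_ne_zero (by norm_num) e1.ne') e2.ne'
    · simpa only [one_mul, focalEllipse] using hτ
  · obtain ⟨s', hs', hτ'⟩ := exists_mem_tangentConeAt_focalHyperbola hτ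
    refine sphere_level_isConicDirection h₁ h₂ (σ := -1) (s := s') (.inr rfl) ?_ hq hτ'
    rw [← Real.cos_abs s', hs', abs_of_nonneg hs1]
    exact (Real.cos_lt_cos_of_nonneg_of_le_pi hs1 hdπ hs2).ne'

theorem spherical_billiard_integrable (Z₁ : Space) (h₁ : Z₁ ∈ unitSphere) (Z₂ : Space)
    (h₂ : Z₂ ∈ unitSphere) (h : Z₂ ≠ -Z₁) (m₁ m₂ f : ℝ) :
    ∃ F : Space × Space → ℝ,
      (∀ B : Set Space, IsCombination (IsSphericalConic Z₁ Z₂) B →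
        (sphericalLagrange Z₁ Z₂ m₁ m₂ f).IsAdditionalIntegral B F) ∧
      ∀ p ∈ (sphericalLagrange Z₁ Z₂ m₁ m₂ f).phaseSpace,
        (0 < inner ℝ p.1 (sphereMid Z₁ Z₂) →
          F p = (projectedLagrange 1 (innerₗ Space) Z₁ Z₂ m₁ m₂ f).energy
            (projectedPhase 1 (innerₗ Space) Z₁ Z₂ p)) ∧
        (inner ℝ p.1 (sphereMid Z₁ Z₂) < 0 →
          F p = (projectedLagrange 1 (innerₗ Space) Z₁ Z₂ (-m₁) (-m₂) f).energy
            (projectedPhase 1 (innerₗ Space) Z₁ Z₂ p)) := by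
  have g₁ := quadricForm_one_self h₁
  have g₂ := quadricForm_one_self h₂
  have hG := one_add_focalCos_pos h₁ h₂ h
  have hN : 0 < √(2 * (1 + focalCos 1 Z₁ Z₂)) := Real.sqrt_pos.2 (by linarith)
  have hO := isOpen_quadricRegular (ε := 1) Z₁ Z₂ m₁ m₂ f
  have hS := sphericalLagrange_carrier h₁ h₂ h m₁ m₂ f
  set D := quadricSurface (.inl rfl) isOpen_univ g₁ g₂
  refine ⟨D.integral (quadricPotential 1 Z₁ Z₂ m₁ m₂ f), fun B hB => ?_, ?_⟩
  · refine D.isAdditionalIntegral hO hS quadricForm_one.symm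
      (U := quadricForce 1 Z₁ Z₂ m₁ m₂ f) (fun q hq => ?_) (quadricForce_contDiffOn _ _ _ _ _)
      (quadricPotential_contDiffOn _ _ _ _ _) (fun q hq => ?_)
      (D.isConicDirection_of_isCombination hB fun C hC =>
        sphericalConic_isConicDirection g₁ g₂ hC)
    · rw [hS, quadric_one] at hq
      exact sphericalLagrange_force h₁ h₂ h hq.1 hq.2.2.2
    · rw [hS] at hq
      exact quadric_isCompatible isOpen_univ (.inl rfl) g₁ g₂ hq.2
  · rintro ⟨q, v⟩ hp
    obtain ⟨hq, -, hv⟩ := (D.mem_phaseSpace_iff hO hS).1 hp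
    rw [inner_sphereMid h₁ h₂, ← quadricForm_one]
    refine ⟨fun hpos => ?_, fun hneg => ?_⟩
    · have := projected_energy (.inl rfl) isOpen_univ g₁ g₂ hG m₁ m₂ f (s := 1) (by norm_num) hq hv
        (by rw [one_mul]; exact (div_pos_iff_of_pos_right hN).1 hpos)
      simpa only [one_mul] using this.symm
    · have := projected_energy (.inl rfl) isOpen_univ g₁ g₂ hG m₁ m₂ f (s := -1) (by norm_num) hq hv
        (by rcases div_neg_iff.1 hneg with h0 | h0 <;> linarith)
      simpa only [neg_one_mul] using this.symm

end Sphere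

/-! ### The hyperbolic plane -/

section Hyperbolic

theorem isOpen_lowerHalfSpace : IsOpen {q : Space | q 2 < 0} :=
  isOpen_lt (by fun_prop) continuous_const

theorem quadric_neg_one : quadric (-1) {q | q 2 < 0} = hyperbolicPlane := by
  rw [quadric, quadricForm_neg_one]
  rfl

theorem quadricForm_neg_one_self {Z : Space} (hZ : Z ∈ hyperbolicPlane) :
    quadricForm (-1) Z Z = -1 := by
  rw [← quadric_neg_one] at hZ
  exact hZ.1

theorem one_le_focalCos {q Z : Space} (hq : q ∈ hyperbolicPlane) (hZ : Z ∈ hyperbolicPlane) :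
    1 ≤ focalCos (-1) Z q := by
  have h := focalSin_nonneg (.inr rfl) (quadricForm_neg_one_self hZ) (quadricForm_neg_one_self hq)
  have hq1 := quadricForm_neg_one_self hq
  have hZ1 := quadricForm_neg_one_self hZ
  have hpos : 0 < focalCos (-1) Z q := by
    rw [focalCos_apply]
    rw [quadricForm_apply] at hq1 hZ1 ⊢
    have h0 : 0 < Z 2 * q 2 := mul_pos_of_neg_of_neg hZ.2 hq.2
    have h1 : (Z 0 * q 0 + Z 1 * q 1) ^ 2 < (Z 2 * q 2) ^ 2 := by
      have e1 : Z 2 * Z 2 = 1 + Z 0 * Z 0 + Z 1 * Z 1 := by linarith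
      have e2 : q 2 * q 2 = 1 + q 0 * q 0 + q 1 * q 1 := by linarith
      have e3 : (Z 2 * q 2) ^ 2 = (1 + Z 0 * Z 0 + Z 1 * Z 1) * (1 + q 0 * q 0 + q 1 * q 1) := by
        rw [← e1, ← e2]; ring
      rw [e3]
      nlinarith [sq_nonneg (Z 0 * q 1 - Z 1 * q 0), mul_self_nonneg (Z 0), mul_self_nonneg (Z 1),
        mul_self_nonneg (q 0), mul_self_nonneg (q 1)]
    have h2 := (abs_lt.1 (abs_lt_of_sq_lt_sq h1 h0.le)).2
    linarith
  nlinarith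

theorem hyperbolicDist_eq (q Z : Space) :
    hyperbolicDist q Z = Real.arcosh (focalCos (-1) Z q) := by
  rw [hyperbolicDist, focalCos_apply, quadricForm_comm, quadricForm_neg_one, neg_one_mul]

theorem cosh_hyperbolicDist {q Z : Space} (hq : q ∈ hyperbolicPlane) (hZ : Z ∈ hyperbolicPlane) :
    Real.cosh (hyperbolicDist q Z) = focalCos (-1) Z q := by
  rw [hyperbolicDist_eq, Real.cosh_arcosh (one_le_focalCos hq hZ)]

theorem sinh_hyperbolicDist {q Z : Space} (hq : q ∈ hyperbolicPlane) (hZ : Z ∈ hyperbolicPlane) :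
    Real.sinh (hyperbolicDist q Z) = √(-1 * (1 - focalCos (-1) Z q ^ 2)) := by
  rw [hyperbolicDist_eq, Real.sinh_arcosh (one_le_focalCos hq hZ)]
  congr 1
  ring

theorem focalCos_neg_one_regular {q Z : Space} (hq : q ∈ hyperbolicPlane)
    (hZ : Z ∈ hyperbolicPlane) : 0 < -1 * (1 - focalCos (-1) Z q ^ 2) ↔ q ≠ Z := by
  have hZ' := quadricForm_neg_one_self hZ
  constructor
  · rintro h rfl
    simp [focalCos_self (.inr rfl) hZ'] at h
  · intro h1
    by_contra hcon
    have h := eq_smul_of_focalSin (.inr rfl) hZ' (quadricForm_neg_one_self hq) hcon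
    have h0 := focalSin_nonneg (.inr rfl) hZ' (quadricForm_neg_one_self hq)
    have h2 := one_le_focalCos hq hZ
    have h3 : focalCos (-1) Z q = 1 := by nlinarith
    exact h1 (by rw [h, h3, one_smul])

theorem hyperbolicLagrange_carrier {Z₁ Z₂ : Space} (h₁ : Z₁ ∈ hyperbolicPlane)
    (h₂ : Z₂ ∈ hyperbolicPlane) (m₁ m₂ f : ℝ) :
    (hyperbolicLagrange Z₁ Z₂ m₁ m₂ f).carrier =
      quadric (-1) {q | q 2 < 0} ∩ quadricRegular (-1) Z₁ Z₂ m₁ m₂ f := by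
  rw [quadric_neg_one]
  ext q
  refine and_congr_right fun hq => ?_
  have hS : focalCos (-1) Z₁ q + focalCos (-1) Z₂ q ≠ 0 := by
    linarith [one_le_focalCos hq h₁, one_le_focalCos hq h₂]
  refine and_congr (imp_congr_right fun _ => (focalCos_neg_one_regular hq h₁).symm) ?_
  exact ⟨fun h => ⟨fun hm => (focalCos_neg_one_regular hq h₂).2 (h hm), fun _ => hS⟩,
    fun h hm => (focalCos_neg_one_regular hq h₂).1 (h.1 hm)⟩

theorem hyperbolicMid_mem {Z₁ Z₂ : Space} (h₁ : Z₁ ∈ hyperbolicPlane)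
    (h₂ : Z₂ ∈ hyperbolicPlane) : hyperbolicMid Z₁ Z₂ ∈ hyperbolicPlane := by
  have g₁ := quadricForm_neg_one_self h₁
  have g₂ := quadricForm_neg_one_self h₂
  have hG : 0 < 1 + focalCos (-1) Z₁ Z₂ := by linarith [one_le_focalCos h₂ h₁]
  have hN : 0 < √(2 * (1 + focalCos (-1) Z₁ Z₂)) := Real.sqrt_pos.2 (by linarith)
  have h := quadricMidpoint_self (.inr rfl) g₁ g₂ hG
  have hadd := quadricForm_add_self (.inr rfl) g₁ g₂
  rw [quadricForm_neg_one] at h hadd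
  refine ⟨h, ?_⟩
  rw [hyperbolicMid, quadricMidpoint, hadd]
  have e1 : Z₁ 2 < 0 := h₁.2
  have e2 : Z₂ 2 < 0 := h₂.2
  exact mul_neg_of_pos_of_neg (inv_pos.2 hN) (add_neg e1 e2)

theorem hyperbolicLagrange_force {Z₁ Z₂ : Space} (h₁ : Z₁ ∈ hyperbolicPlane)
    (h₂ : Z₂ ∈ hyperbolicPlane) (m₁ m₂ f : ℝ) {q : Space} (hq : q ∈ hyperbolicPlane) :
    (hyperbolicLagrange Z₁ Z₂ m₁ m₂ f).force q = quadricForce (-1) Z₁ Z₂ m₁ m₂ f q := by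
  have hG : 0 < 1 + focalCos (-1) Z₁ Z₂ := by linarith [one_le_focalCos h₂ h₁]
  have hS : 0 < focalCos (-1) Z₁ q + focalCos (-1) Z₂ q := by
    linarith [one_le_focalCos hq h₁, one_le_focalCos hq h₂]
  have hN : √(2 * (1 + focalCos (-1) Z₁ Z₂)) ≠ 0 := (Real.sqrt_pos.2 (by linarith)).ne'
  have hs := Real.sq_sqrt (show 0 ≤ 2 * (1 + focalCos (-1) Z₁ Z₂) by linarith)
  have hM := hyperbolicMid_mem h₁ h₂
  have hc := focalSin_nonneg (.inr rfl) (quadricForm_neg_one_self hM) (quadricForm_neg_one_self hq)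
  have hx : focalCos (-1) (hyperbolicMid Z₁ Z₂) q =
      (focalCos (-1) Z₁ q + focalCos (-1) Z₂ q) / √(2 * (1 + focalCos (-1) Z₁ Z₂)) := by
    rw [← quadricForm_midpoint (.inr rfl) (quadricForm_neg_one_self h₁)
      (quadricForm_neg_one_self h₂), focalCos_apply, quadricForm_comm, hyperbolicMid,
      quadricForm_neg_one]
  simp only [hyperbolicLagrange, quadricForce, hyperbolicCot]
  rw [cosh_hyperbolicDist hq h₁, cosh_hyperbolicDist hq h₂, sinh_hyperbolicDist hq h₁,
    sinh_hyperbolicDist hq h₂]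
  congr 2
  rw [Real.tanh_eq_sinh_div_cosh, sinh_hyperbolicDist hq hM, cosh_hyperbolicDist hq hM, div_pow,
    Real.sq_sqrt hc, hx]
  field_simp
  rw [hs]

theorem hyperbolic_level_isConicDirection {Z₁ Z₂ : Space} (h₁ : quadricForm (-1) Z₁ Z₁ = -1)
    (h₂ : quadricForm (-1) Z₂ Z₂ = -1) (h₁' : Z₁ ∈ hyperbolicPlane) (h₂' : Z₂ ∈ hyperbolicPlane)
    {σ s : ℝ} (hσ : σ = 1 ∨ σ = -1) (hs : |s| ≠ hyperbolicDist Z₁ Z₂) {q τ : Space}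
    (hq : q ∈ quadric (-1) {q | q 2 < 0})
    (hτ : τ ∈ tangentConeAt ℝ
      {x ∈ hyperbolicPlane | hyperbolicDist x Z₁ + σ * hyperbolicDist x Z₂ = s} q) :
    (quadricSurface (.inr rfl) isOpen_lowerHalfSpace h₁ h₂).IsConicDirection q τ := by
  refine quadric_isConicDirection (δ := Real.arcosh) (σ := σ) (s := s) (K := Real.cosh s)
    isOpen_lowerHalfSpace (.inr rfl) h₁ h₂ (by rcases hσ with rfl | rfl <;> norm_num)
    ?_ ?_ ?_ ?_ ?_ hq hτ
  · intro x hx Z hZ h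
    have hZ' : Z ∈ hyperbolicPlane := by rcases hZ with rfl | rfl <;> assumption
    rw [quadric_neg_one] at hx
    have h1 := one_le_focalCos hx hZ'
    have := Real.hasDerivAt_arcosh (x := focalCos (-1) Z x) (Set.mem_Ioi.2 (by nlinarith))
    refine this.congr_deriv ?_
    rw [neg_neg, one_div]
    congr 2
    ring
  · rw [quadric_neg_one]; exact fun x hx => hx.1
  · rintro x ⟨hx, hxs⟩
    rw [← hyperbolicDist_eq, ← hyperbolicDist_eq, hxs]
  · rintro x ⟨hx, hxs⟩
    rw [← hxs, ← sinh_hyperbolicDist hx h₁', ← sinh_hyperbolicDist hx h₂',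
      ← cosh_hyperbolicDist hx h₁', ← cosh_hyperbolicDist hx h₂', Real.cosh_add]
    rcases hσ with rfl | rfl
    · simp only [one_mul]; ring
    · simp only [neg_mul, one_mul, Real.cosh_neg, Real.sinh_neg]; ring
  · rw [focalCos_comm, ← cosh_hyperbolicDist h₁' h₂']
    have hd0 : 0 ≤ hyperbolicDist Z₁ Z₂ := by
      rw [hyperbolicDist_eq]
      exact Real.arcosh_nonneg (one_le_focalCos h₁' h₂')
    rw [← Real.cosh_abs s]
    exact fun h => hs (Real.cosh_injOn (abs_nonneg s) hd0 h)

theorem hyperbolicConic_isConicDirection {Z₁ Z₂ : Space} (h₁ : quadricForm (-1) Z₁ Z₁ = -1)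
    (h₂ : quadricForm (-1) Z₂ Z₂ = -1) (h₁' : Z₁ ∈ hyperbolicPlane) (h₂' : Z₂ ∈ hyperbolicPlane)
    {C : Set Space} (hC : IsFocalConic hyperbolicPlane hyperbolicDist Z₁ Z₂ C) :
    ∀ q ∈ quadric (-1) {q | q 2 < 0}, ∀ τ ∈ tangentConeAt ℝ C q,
      (quadricSurface (.inr rfl) isOpen_lowerHalfSpace h₁ h₂).IsConicDirection q τ := by
  intro q hq τ hτ
  rcases hC with ⟨s, hs1, rfl⟩ | ⟨s, hs1, hs2, rfl⟩
  · refine hyperbolic_level_isConicDirection h₁ h₂ h₁' h₂' (σ := 1) (s := s) (.inl rfl) ?_ hq ?_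
    · exact (hs1.trans_le (le_abs_self s)).ne'
    · simpa only [one_mul, focalEllipse] using hτ
  · obtain ⟨s', hs', hτ'⟩ := exists_mem_tangentConeAt_focalHyperbola hτ
    refine hyperbolic_level_isConicDirection h₁ h₂ h₁' h₂' (σ := -1) (s := s') (.inr rfl) ?_ hq hτ'
    rw [hs', abs_of_nonneg hs1]
    exact hs2.ne

theorem hyperbolic_billiard_integrable (Z₁ : Space) (h₁ : Z₁ ∈ hyperbolicPlane) (Z₂ : Space)
    (h₂ : Z₂ ∈ hyperbolicPlane) (m₁ m₂ f : ℝ) :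
    ∃ F : Space × Space → ℝ,
      (∀ B : Set Space, IsCombination (IsFocalConic hyperbolicPlane hyperbolicDist Z₁ Z₂) B →
        (hyperbolicLagrange Z₁ Z₂ m₁ m₂ f).IsAdditionalIntegral B F) ∧
      ∀ p ∈ (hyperbolicLagrange Z₁ Z₂ m₁ m₂ f).phaseSpace,
        F p = (projectedLagrange (-1) minkowski Z₁ Z₂ m₁ m₂ f).energy
          (projectedPhase (-1) minkowski Z₁ Z₂ p) := by
  have g₁ := quadricForm_neg_one_self h₁
  have g₂ := quadricForm_neg_one_self h₂
  have hG : 0 < 1 + focalCos (-1) Z₁ Z₂ := by linarith [one_le_focalCos h₂ h₁]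
  have hO := isOpen_quadricRegular (ε := -1) Z₁ Z₂ m₁ m₂ f
  have hS := hyperbolicLagrange_carrier h₁ h₂ m₁ m₂ f
  set D := quadricSurface (.inr rfl) isOpen_lowerHalfSpace g₁ g₂
  refine ⟨D.integral (quadricPotential (-1) Z₁ Z₂ m₁ m₂ f), fun B hB => ?_, ?_⟩
  · refine D.isAdditionalIntegral hO hS quadricForm_neg_one.symm
      (U := quadricForce (-1) Z₁ Z₂ m₁ m₂ f) (fun q hq => ?_) (quadricForce_contDiffOn _ _ _ _ _)
      (quadricPotential_contDiffOn _ _ _ _ _) (fun q hq => ?_)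
      (D.isConicDirection_of_isCombination hB fun C hC =>
        hyperbolicConic_isConicDirection g₁ g₂ h₁ h₂ hC)
    · exact hyperbolicLagrange_force h₁ h₂ m₁ m₂ f hq.1
    · rw [hS] at hq
      exact quadric_isCompatible isOpen_lowerHalfSpace (.inr rfl) g₁ g₂ hq.2
  · rintro ⟨q, v⟩ hp
    obtain ⟨hq, -, hv⟩ := (D.mem_phaseSpace_iff hO hS).1 hp
    have hq' : q ∈ hyperbolicPlane := by rwa [quadric_neg_one] at hq
    rw [← quadricForm_neg_one]
    have := projected_energy (.inr rfl) isOpen_lowerHalfSpace g₁ g₂ hG m₁ m₂ f (s := 1)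
      (by norm_num) hq hv (by linarith [one_le_focalCos hq' h₁, one_le_focalCos hq' h₂])
    simpa only [one_mul] using this.symm

end Hyperbolic

/-! ### The Euclidean plane as a focal surface -/

section PlaneSurface

theorem inner_plane (x y : Plane) : inner ℝ x y = x 0 * y 0 + x 1 * y 1 := by
  simp [PiLp.inner_apply, Fin.sum_univ_two, mul_comm]

theorem hasFDerivAt_inner_sub (Z Z' q : Plane) :
    HasFDerivAt (fun q => inner ℝ (Z - q) (Z' - q))
      (-(innerSL ℝ (Z - q) + innerSL ℝ (Z' - q))) q := by
  refine (((hasFDerivAt_id q).const_sub Z).inner ℝ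
    ((hasFDerivAt_id q).const_sub Z')).congr_fderiv ?_
  ext v
  simp [fderivInnerCLM_apply, real_inner_comm, inner_sub_left, inner_sub_right]
  ring

theorem contDiff_inner_sub (Z Z' : Plane) :
    ContDiff ℝ ∞ (fun q => inner ℝ (Z - q) (Z' - q)) :=
  (contDiff_const.sub contDiff_id).inner ℝ (contDiff_const.sub contDiff_id)

/-- The Euclidean plane with the foci `Z₁`, `Z₂` as a focal surface. The factor `r²` and the
constant in `α` are those of the spherical kinetic energy in a central chart that scales lengths by
`r`. -/
noncomputable def planeSurface (Z₁ Z₂ : Plane) {r : ℝ} (hr : r ≠ 0) :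
    FocalSurface (Set.univ : Set Plane) (innerₗ Plane) where
  T _ := ⊤
  J _ :=
    { toFun := fun v => !₂[-v 1, v 0]
      map_add' := fun v w => by ext i; fin_cases i <;> simp; ring
      map_smul' := fun c v => by ext i; fin_cases i <;> simp }
  c₁ q := Z₁ - q
  c₂ q := Z₂ - q
  lam₁ _ := 1
  lam₂ _ := 1
  α q := r ^ 2 * (1 + inner ℝ (Z₁ - Z₂) (Z₁ - Z₂) / 4 + inner ℝ (Z₁ - q) (Z₂ - q))
  η := -r ^ 2
  η_ne_zero := neg_ne_zero.2 (pow_ne_zero 2 hr)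
  symm x y := real_inner_comm y x
  tangentCone q _ := by simp
  pos q _ v _ hv := real_inner_self_pos.2 hv
  J_mem _ _ _ _ := trivial
  J_orthogonal q _ v _ := by
    rw [innerₗ_apply_apply, inner_plane]; simp; ring
  J_norm q _ v _ := by
    rw [innerₗ_apply_apply, innerₗ_apply_apply, inner_plane, inner_plane]; simp; ring
  parseval q _ v _ a _ b _ := by
    simp only [innerₗ_apply_apply, inner_plane]; simp; ring
  c₁_mem _ _ := trivial
  c₂_mem _ _ := trivial
  α_contDiff := contDiff_const.mul (contDiff_const.add (contDiff_inner_sub Z₁ Z₂))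
  c₁_contDiff := by fun_prop
  c₂_contDiff := by fun_prop
  fderiv_α q _ v _ := by
    have h := ((hasFDerivAt_inner_sub Z₁ Z₂ q).const_add
      (1 + inner ℝ (Z₁ - Z₂) (Z₁ - Z₂) / 4)).const_mul (r ^ 2)
    refine (DFunLike.congr_fun h.fderiv v).trans ?_
    simp only [smul_apply, neg_apply, add_apply, smul_eq_mul, innerSL_apply_apply,
      innerₗ_apply_apply]
    ring
  fderiv_c₁ q _ v _ u _ := by
    have h := (hasFDerivAt_id (𝕜 := ℝ) q).const_sub Z₁
    have h' := DFunLike.congr_fun h.fderiv v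
    simp only [id] at h'
    rw [h']
    simp
  fderiv_c₂ q _ v _ u _ := by
    have h := (hasFDerivAt_id (𝕜 := ℝ) q).const_sub Z₂
    have h' := DFunLike.congr_fun h.fderiv v
    simp only [id] at h'
    rw [h']
    simp
  exists_curve q _ v _ := by
    have hw : (!₂[1, 0] : Plane) ≠ 0 := fun h0 => by
      simpa using congrArg (fun x : Plane => x 0) h0
    have hcont : Continuous (fun t : ℝ => (q + t • (!₂[1, 0] : Plane), v)) := by fun_prop
    have hev : ∀ Z : Plane, ∀ᶠ t in 𝓝[≠] (0 : ℝ), Z - (q + t • (!₂[1, 0] : Plane)) ≠ 0 := by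
      intro Z
      by_cases h : Z = q
      · filter_upwards [self_mem_nhdsWithin] with t ht
        rw [h, sub_add_cancel_left]
        exact neg_ne_zero.2 (smul_ne_zero ht hw)
      · have hc : ContinuousAt (fun t : ℝ => Z - (q + t • (!₂[1, 0] : Plane))) 0 :=
          Continuous.continuousAt (by fun_prop)
        exact (hc.eventually_ne (by simpa [sub_eq_zero] using h)).filter_mono nhdsWithin_le_nhds
    refine ⟨_, hcont.continuousAt, by simp, ?_⟩
    filter_upwards [hev Z₁, hev Z₂] with t h1 h2
    exact ⟨trivial, trivial, h1, h2⟩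

/-- The potential part of the planar integral: the force function of the spherical problem in a
central chart. -/
noncomputable def planePotential (Z₁ Z₂ : Plane) (r m₁ m₂ f : ℝ) (q : Plane) : ℝ :=
  m₁ * (r ^ 2 * ((1 + (inner ℝ (Z₂ - q) (Z₂ - q) - inner ℝ (Z₁ - q) (Z₁ - q)) / 4)
    * (√(inner ℝ (Z₁ - q) (Z₁ - q)))⁻¹))
  + m₂ * (r ^ 2 * ((1 + (inner ℝ (Z₁ - q) (Z₁ - q) - inner ℝ (Z₂ - q) (Z₂ - q)) / 4)
    * (√(inner ℝ (Z₂ - q) (Z₂ - q)))⁻¹))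
  + f * (r ^ 2 * (inner ℝ (Z₁ - q) (Z₂ - q) + inner ℝ (Z₁ - Z₂) (Z₁ - Z₂) / 4
    + ((inner ℝ (Z₂ - q) (Z₂ - q) - inner ℝ (Z₁ - q) (Z₁ - q)) / 4) ^ 2))

/-- The planar force function, with the Hooke term in terms of the focal vectors. -/
noncomputable def planeForce (Z₁ Z₂ : Plane) (m₁ m₂ f : ℝ) (q : Plane) : ℝ :=
  m₁ * (√(inner ℝ (Z₁ - q) (Z₁ - q)))⁻¹ + m₂ * (√(inner ℝ (Z₂ - q) (Z₂ - q)))⁻¹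
  + f * (inner ℝ (Z₁ - q) (Z₂ - q) + inner ℝ (Z₁ - Z₂) (Z₁ - Z₂) / 4)

/-- The plane without the Kepler centres of nonzero mass. -/
def planeRegular (Z₁ Z₂ : Plane) (m₁ m₂ : ℝ) : Set Plane :=
  {q | (m₁ ≠ 0 → q ≠ Z₁) ∧ (m₂ ≠ 0 → q ≠ Z₂)}

theorem isOpen_planeRegular (Z₁ Z₂ : Plane) (m₁ m₂ : ℝ) : IsOpen (planeRegular Z₁ Z₂ m₁ m₂) :=
  (isOpen_setOf_imp _ isOpen_ne).inter (isOpen_setOf_imp _ isOpen_ne)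

theorem planarLagrange_force (Z₁ Z₂ : Plane) (m₁ m₂ f : ℝ) (q : Plane) :
    (planarLagrange Z₁ Z₂ m₁ m₂ f).force q = planeForce Z₁ Z₂ m₁ m₂ f q := by
  have hflip : ∀ Z : Plane, inner ℝ (q - Z) (q - Z) = inner ℝ (Z - q) (Z - q) := fun Z => by
    rw [← neg_sub Z q, inner_neg_neg]
  have hmid : inner ℝ (q - midpoint ℝ Z₁ Z₂) (q - midpoint ℝ Z₁ Z₂) =
      inner ℝ (Z₁ - q) (Z₂ - q) + inner ℝ (Z₁ - Z₂) (Z₁ - Z₂) / 4 := by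
    rw [midpoint_eq_smul_add]
    simp only [inner_plane, PiLp.sub_apply, PiLp.smul_apply, PiLp.add_apply, smul_eq_mul,
      invOf_eq_inv]
    ring
  simp only [planarLagrange, flatLagrange, planeForce, innerₗ_apply_apply]
  rw [hmid, hflip, hflip, div_eq_mul_inv, div_eq_mul_inv]

theorem contDiffAt_inv_dist {Z q : Plane} (h : q ≠ Z) :
    ContDiffAt ℝ ∞ (fun q => (√(inner ℝ (Z - q) (Z - q)))⁻¹) q := by
  have h0 : 0 < inner ℝ (Z - q) (Z - q) := real_inner_self_pos.2 (sub_ne_zero.2 h.symm)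
  exact (ContDiffAt.sqrt (contDiff_inner_sub Z Z).contDiffAt h0.ne').inv (Real.sqrt_pos.2 h0).ne'

theorem planeForce_contDiffOn (Z₁ Z₂ : Plane) (m₁ m₂ f : ℝ) :
    ContDiffOn ℝ ∞ (planeForce Z₁ Z₂ m₁ m₂ f) (planeRegular Z₁ Z₂ m₁ m₂) := by
  rintro q ⟨h1, h2⟩
  refine ContDiffAt.contDiffWithinAt ?_
  exact ((ContDiffAt.const_mul_of_ne_zero m₁ fun hm => contDiffAt_inv_dist (h1 hm)).add
    (ContDiffAt.const_mul_of_ne_zero m₂ fun hm => contDiffAt_inv_dist (h2 hm))).add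
    (contDiff_const.mul ((contDiff_inner_sub Z₁ Z₂).add contDiff_const)).contDiffAt

theorem planePotential_contDiffOn (Z₁ Z₂ : Plane) (r m₁ m₂ f : ℝ) :
    ContDiffOn ℝ ∞ (planePotential Z₁ Z₂ r m₁ m₂ f) (planeRegular Z₁ Z₂ m₁ m₂) := by
  rintro q ⟨h1, h2⟩
  refine ContDiffAt.contDiffWithinAt ?_
  have h11 := (contDiff_inner_sub Z₁ Z₁).contDiffAt (x := q)
  have h22 := (contDiff_inner_sub Z₂ Z₂).contDiffAt (x := q)
  have h12 := (contDiff_inner_sub Z₁ Z₂).contDiffAt (x := q)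
  exact ((ContDiffAt.const_mul_of_ne_zero m₁ fun hm => contDiffAt_const.mul
      (ContDiffAt.mul (contDiffAt_const.add ((h22.sub h11).div_const 4))
        (contDiffAt_inv_dist (h1 hm)))).add
    (ContDiffAt.const_mul_of_ne_zero m₂ fun hm => contDiffAt_const.mul
      (ContDiffAt.mul (contDiffAt_const.add ((h11.sub h22).div_const 4))
        (contDiffAt_inv_dist (h2 hm))))).add
    (contDiffAt_const.mul (contDiffAt_const.mul ((h12.add contDiffAt_const).add
      (((h22.sub h11).div_const 4).pow 2))))

theorem hasFDerivAt_inv_dist {Z q : Plane} (h : q ≠ Z) :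
    HasFDerivAt (fun q => (√(inner ℝ (Z - q) (Z - q)))⁻¹)
      ((√(inner ℝ (Z - q) (Z - q)) ^ 3)⁻¹ • innerSL ℝ (Z - q)) q := by
  have h0 : 0 < inner ℝ (Z - q) (Z - q) := real_inner_self_pos.2 (sub_ne_zero.2 h.symm)
  have hr := (Real.sqrt_pos.2 h0).ne'
  have h1 := (hasDerivAt_inv hr).comp_hasFDerivAt q
    ((hasFDerivAt_inner_sub Z Z q).sqrt h0.ne')
  refine h1.congr_fderiv ?_
  ext v
  simp only [smul_apply, neg_apply, add_apply, smul_eq_mul]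
  field_simp
  ring

theorem plane_compatible_kepler_left {Z₁ Z₂ : Plane} {r : ℝ} (hr : r ≠ 0) {q : Plane}
    (hq : q ≠ Z₁) :
    (planeSurface Z₁ Z₂ hr).IsCompatible (fun q => (√(inner ℝ (Z₁ - q) (Z₁ - q)))⁻¹)
      (fun q => r ^ 2 * ((1 + (inner ℝ (Z₂ - q) (Z₂ - q) - inner ℝ (Z₁ - q) (Z₁ - q)) / 4)
        * (√(inner ℝ (Z₁ - q) (Z₁ - q)))⁻¹)) q := by
  have h0 : 0 < inner ℝ (Z₁ - q) (Z₁ - q) := real_inner_self_pos.2 (sub_ne_zero.2 hq.symm)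
  have hV := (((((hasFDerivAt_inner_sub Z₂ Z₂ q).sub (hasFDerivAt_inner_sub Z₁ Z₁ q)).mul_const
    (4 : ℝ)⁻¹).const_add 1).mul (hasFDerivAt_inv_dist hq)).const_mul (r ^ 2)
  refine ⟨_, _, hasFDerivAt_inv_dist hq, hV, fun v _ => ?_⟩
  have hs := Real.sq_sqrt h0.le
  have hρ := (Real.sqrt_pos.2 h0).ne'
  have hd : inner ℝ (Z₁ - Z₂) (Z₁ - Z₂) = inner ℝ (Z₁ - q) (Z₁ - q) + inner ℝ (Z₂ - q) (Z₂ - q)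
      - 2 * inner ℝ (Z₁ - q) (Z₂ - q) := by
    simp only [inner_plane, PiLp.sub_apply]; ring
  simp only [planeSurface, smul_apply, neg_apply, add_apply, sub_apply, smul_eq_mul,
    innerSL_apply_apply, innerₗ_apply_apply, hd, Pi.sub_apply]
  set ρ := √(inner ℝ (Z₁ - q) (Z₁ - q))
  rw [← hs]
  field_simp
  ring

theorem plane_compatible_kepler_right {Z₁ Z₂ : Plane} {r : ℝ} (hr : r ≠ 0) {q : Plane}
    (hq : q ≠ Z₂) :
    (planeSurface Z₁ Z₂ hr).IsCompatible (fun q => (√(inner ℝ (Z₂ - q) (Z₂ - q)))⁻¹)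
      (fun q => r ^ 2 * ((1 + (inner ℝ (Z₁ - q) (Z₁ - q) - inner ℝ (Z₂ - q) (Z₂ - q)) / 4)
        * (√(inner ℝ (Z₂ - q) (Z₂ - q)))⁻¹)) q := by
  obtain ⟨L, L', hL, hL', h⟩ := plane_compatible_kepler_left (Z₁ := Z₂) (Z₂ := Z₁) hr hq
  refine ⟨L, L', hL, hL', fun v hv => ?_⟩
  rw [h v hv]
  have hd : inner ℝ (Z₂ - Z₁) (Z₂ - Z₁) = inner ℝ (Z₁ - Z₂) (Z₁ - Z₂) := by
    rw [← neg_sub Z₁ Z₂, inner_neg_neg]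
  simp only [planeSurface, hd, real_inner_comm (Z₁ - q) (Z₂ - q)]
  ring

theorem plane_compatible_hooke {Z₁ Z₂ : Plane} {r : ℝ} (hr : r ≠ 0) (q : Plane) :
    (planeSurface Z₁ Z₂ hr).IsCompatible
      (fun q => inner ℝ (Z₁ - q) (Z₂ - q) + inner ℝ (Z₁ - Z₂) (Z₁ - Z₂) / 4)
      (fun q => r ^ 2 * (inner ℝ (Z₁ - q) (Z₂ - q) + inner ℝ (Z₁ - Z₂) (Z₁ - Z₂) / 4
        + ((inner ℝ (Z₂ - q) (Z₂ - q) - inner ℝ (Z₁ - q) (Z₁ - q)) / 4) ^ 2)) q := by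
  have h12 := (hasFDerivAt_inner_sub Z₁ Z₂ q).add_const (inner ℝ (Z₁ - Z₂) (Z₁ - Z₂) / 4)
  have hy := ((hasFDerivAt_inner_sub Z₂ Z₂ q).sub (hasFDerivAt_inner_sub Z₁ Z₁ q)).mul_const
    (4 : ℝ)⁻¹
  refine ⟨_, _, h12, (h12.add (hy.pow 2)).const_mul (r ^ 2), fun v _ => ?_⟩
  have hd : inner ℝ (Z₁ - Z₂) (Z₁ - Z₂) = inner ℝ (Z₁ - q) (Z₁ - q) + inner ℝ (Z₂ - q) (Z₂ - q)
      - 2 * inner ℝ (Z₁ - q) (Z₂ - q) := by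
    simp only [inner_plane, PiLp.sub_apply]; ring
  simp only [planeSurface, smul_apply, neg_apply, add_apply, sub_apply, smul_eq_mul, nsmul_eq_mul,
    innerSL_apply_apply, innerₗ_apply_apply, hd, Pi.sub_apply,
    real_inner_comm (Z₁ - q) (Z₂ - q)]
  norm_num only [pow_one]
  ring

theorem plane_isCompatible {Z₁ Z₂ : Plane} {r m₁ m₂ f : ℝ} (hr : r ≠ 0) {q : Plane}
    (hq : q ∈ planeRegular Z₁ Z₂ m₁ m₂) :
    (planeSurface Z₁ Z₂ hr).IsCompatible (planeForce Z₁ Z₂ m₁ m₂ f)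
      (planePotential Z₁ Z₂ r m₁ m₂ f) q :=
  ((FocalSurface.IsCompatible.const_mul m₁ fun hm => plane_compatible_kepler_left hr (hq.1 hm)).add
    (FocalSurface.IsCompatible.const_mul m₂ fun hm =>
      plane_compatible_kepler_right hr (hq.2 hm))).add
    (FocalSurface.IsCompatible.const_mul f fun _ => plane_compatible_hooke hr q)

theorem plane_level_isConicDirection {Z₁ Z₂ : Plane} {r : ℝ} (hr : r ≠ 0) {σ s : ℝ}
    (hσ : σ ^ 2 = 1) (hs : |s| ≠ dist Z₁ Z₂) {q τ : Plane}
    (hτ : τ ∈ tangentConeAt ℝ {x ∈ Set.univ | dist x Z₁ + σ * dist x Z₂ = s} q) :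
    (planeSurface Z₁ Z₂ hr).IsConicDirection q τ := by
  have hdist : ∀ Z x : Plane, dist x Z = √(inner ℝ (Z - x) (Z - x)) := fun Z x => by
    rw [dist_comm, dist_eq_norm, norm_eq_sqrt_real_inner]
  have hqs : dist q Z₁ + σ * dist q Z₂ = s := by
    have hcl : IsClosed {x : Plane | dist x Z₁ + σ * dist x Z₂ = s} :=
      isClosed_eq (by fun_prop) continuous_const
    exact closure_minimal (fun x hx => hx.2) hcl (mem_closure_of_nonempty_tangentConeAt ⟨τ, hτ⟩)
  have hσ1 : |σ| = 1 := by rw [← Real.sqrt_sq_eq_abs, hσ, Real.sqrt_one]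
  have hq1 : q ≠ Z₁ := by
    rintro rfl
    rw [dist_self, zero_add] at hqs
    exact hs (by rw [← hqs, abs_mul, hσ1, one_mul, abs_of_nonneg dist_nonneg])
  have hq2 : q ≠ Z₂ := by
    rintro rfl
    rw [dist_self, mul_zero, add_zero] at hqs
    exact hs (by rw [← hqs, abs_of_nonneg dist_nonneg, dist_comm])
  have h1 : 0 < inner ℝ (Z₁ - q) (Z₁ - q) := real_inner_self_pos.2 (sub_ne_zero.2 hq1.symm)
  have h2 : 0 < inner ℝ (Z₂ - q) (Z₂ - q) := real_inner_self_pos.2 (sub_ne_zero.2 hq2.symm)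
  have hL := ((hasFDerivAt_inner_sub Z₁ Z₁ q).sqrt h1.ne').add
    (((hasFDerivAt_inner_sub Z₂ Z₂ q).sqrt h2.ne').const_mul σ)
  have hd := hL.eq_zero_of_mem_tangentConeAt (s := s)
    (fun x hx => by simpa only [Pi.add_apply, ← hdist] using hx.2) hτ
  simp only [add_apply, smul_apply, neg_apply, smul_eq_mul, innerSL_apply_apply] at hd
  have r1 := (Real.sqrt_pos.2 h1).ne'
  have r2 := (Real.sqrt_pos.2 h2).ne'
  have s1 := Real.sq_sqrt h1.le
  have s2 := Real.sq_sqrt h2.le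
  rw [hdist, hdist] at hqs
  refine ⟨σ, hσ, ?_, ?_⟩
  · simp only [planeSurface, innerₗ_apply_apply]
    set ρ1 := √(inner ℝ (Z₁ - q) (Z₁ - q))
    set ρ2 := √(inner ℝ (Z₂ - q) (Z₂ - q))
    field_simp at hd
    linear_combination (-1 / 2) * hd
  · simp only [planeSurface, innerₗ_apply_apply]
    intro h12
    apply hs
    have hd : inner ℝ (Z₁ - Z₂) (Z₁ - Z₂) = inner ℝ (Z₁ - q) (Z₁ - q)
        + inner ℝ (Z₂ - q) (Z₂ - q) - 2 * inner ℝ (Z₁ - q) (Z₂ - q) := by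
      simp only [inner_plane, PiLp.sub_apply]; ring
    rw [dist_eq_norm, norm_eq_sqrt_real_inner, ← Real.sqrt_sq_eq_abs, hd, h12, ← hqs]
    congr 1
    linear_combination s1 + s2 * σ ^ 2 + inner ℝ (Z₂ - q) (Z₂ - q) * hσ

theorem planeConic_isConicDirection {Z₁ Z₂ : Plane} {r : ℝ} (hr : r ≠ 0) {C : Set Plane}
    (hC : IsFocalConic Set.univ dist Z₁ Z₂ C) :
    ∀ q ∈ (Set.univ : Set Plane), ∀ τ ∈ tangentConeAt ℝ C q,
      (planeSurface Z₁ Z₂ hr).IsConicDirection q τ := by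
  intro q _ τ hτ
  rcases hC with ⟨s, hs1, rfl⟩ | ⟨s, hs1, hs2, rfl⟩
  · refine plane_level_isConicDirection hr (σ := 1) (s := s) (by norm_num) ?_ ?_
    · exact (hs1.trans_le (le_abs_self s)).ne'
    · simpa only [one_mul, focalEllipse] using hτ
  · obtain ⟨s', hs', hτ'⟩ := exists_mem_tangentConeAt_focalHyperbola hτ
    refine plane_level_isConicDirection hr (σ := -1) (s := s') (by norm_num) ?_ hτ'
    rw [hs', abs_of_nonneg hs1]
    exact hs2.ne

end PlaneSurface

/-! ### The central chart of the sphere -/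

section CentralChart

/-- A vector of the plane is a multiple of a unit vector `(a, b)`. The factor is written as `2 k`
because `k` is the half focal distance of two foci that differ by `x`. -/
theorem exists_unit_smul (x : Plane) :
    ∃ k a b : ℝ, a ^ 2 + b ^ 2 = 1 ∧ x 0 = 2 * k * a ∧ x 1 = 2 * k * b := by
  by_cases hx : x = 0
  · exact ⟨0, 1, 0, by norm_num, by simp [hx], by simp [hx]⟩
  · have hn : ‖x‖ ≠ 0 := norm_ne_zero_iff.2 hx
    have hs : ‖x‖ ^ 2 = x 0 * x 0 + x 1 * x 1 := by
      rw [← real_inner_self_eq_norm_sq, inner_plane]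
    refine ⟨‖x‖ / 2, x 0 / ‖x‖, x 1 / ‖x‖, ?_, by field_simp, by field_simp⟩
    field_simp
    rw [hs]
    ring

/-- The chart with the coordinates `y` along the unit vector `(a, b)` and `w` across it, centred at
the point `o`; the coordinate `w` is scaled by `r`. -/
noncomputable def centralChart (r a b : ℝ) (o : Plane) : Plane →ᵃ[ℝ] Space where
  toFun q := !₂[r * (a * (q 1 - o 1) - b * (q 0 - o 0)), a * (q 0 - o 0) + b * (q 1 - o 1), 1]
  linear :=
    { toFun := fun u => !₂[r * (a * u 1 - b * u 0), a * u 0 + b * u 1, 0]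
      map_add' := fun u v => by ext i; fin_cases i <;> simp <;> ring
      map_smul' := fun c u => by ext i; fin_cases i <;> simp <;> ring }
  map_vadd' q u := by ext i; fin_cases i <;> simp <;> ring

theorem inner_space (x y : Space) : inner ℝ x y = x 0 * y 0 + x 1 * y 1 + x 2 * y 2 := by
  simp [PiLp.inner_apply, Fin.sum_univ_three, mul_comm]

theorem planar_billiard_integrable (Z₁ Z₂ : Plane) (m₁ m₂ f : ℝ) :
    ∃ F : Plane × Plane → ℝ,
      (∀ B : Set Plane, IsCombination (IsFocalConic Set.univ dist Z₁ Z₂) B →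
        (planarLagrange Z₁ Z₂ m₁ m₂ f).IsAdditionalIntegral B F) ∧
      ∃ (W₁ W₂ : Space) (r : ℝ) (ι : Plane →ᵃ[ℝ] Space), IsCentralChart Z₁ Z₂ W₁ W₂ r ι ∧
        ∀ p ∈ (planarLagrange Z₁ Z₂ m₁ m₂ f).phaseSpace,
          F p = (sphericalLagrange W₁ W₂
            (√(focalFactor 1 (innerₗ Space) W₁ W₂) * (r ^ 3 * m₁))
            (√(focalFactor 1 (innerₗ Space) W₁ W₂) * (r ^ 3 * m₂)) f).energy
              (toSpherePhase (ι p.1) (ι.linear p.2)) := by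
  obtain ⟨k, a, b, hab, hk0, hk1⟩ := exists_unit_smul (Z₁ - Z₂)
  rw [PiLp.sub_apply] at hk0 hk1
  -- The angle between `W₁` and the midpoint has the cosine `r` and the sine `r * k`. Then the
  -- projections of `W₁`, `W₂` have distance `k` from the midpoint and `r = 1 / √(1 + k²)`.
  obtain ⟨r, hr, hrk⟩ : ∃ r : ℝ, 0 < r ∧ r ^ 2 * (1 + k ^ 2) = 1 := by
    have h0 : 0 < 1 + k ^ 2 := by positivity
    refine ⟨(√(1 + k ^ 2))⁻¹, by positivity, ?_⟩
    rw [inv_pow, Real.sq_sqrt h0.le, inv_mul_cancel₀ h0.ne']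
  set o : Plane := (2 : ℝ)⁻¹ • (Z₁ + Z₂) with ho
  have ho0 : o 0 = (Z₁ 0 + Z₂ 0) / 2 := by
    simp [ho]; ring
  have ho1 : o 1 = (Z₁ 1 + Z₂ 1) / 2 := by
    simp [ho]; ring
  set W₁ : Space := !₂[0, r * k, r] with hW₁
  set W₂ : Space := !₂[0, -(r * k), r] with hW₂
  have p₁ : ∀ x, focalCos 1 W₁ x = r * k * x 1 + r * x 2 := fun x => by
    simp [focalCos_apply, quadricForm_apply, hW₁]
  have p₂ : ∀ x, focalCos 1 W₂ x = -(r * k) * x 1 + r * x 2 := fun x => by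
    simp [focalCos_apply, quadricForm_apply, hW₂]
  have g₁ : quadricForm 1 W₁ W₁ = 1 := by
    simp [quadricForm_apply, hW₁]; linarith
  have g₂ : quadricForm 1 W₂ W₂ = 1 := by
    simp [quadricForm_apply, hW₂]; linarith
  have s₁ : W₁ ∈ unitSphere := by rw [← quadric_one]; exact ⟨g₁, trivial⟩
  have s₂ : W₂ ∈ unitSphere := by rw [← quadric_one]; exact ⟨g₂, trivial⟩
  have hne : W₂ ≠ -W₁ := fun h => by
    have : r = -r := by simpa [hW₁, hW₂] using congrArg (fun x : Space => x 2) h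
    linarith
  have hG := one_add_focalCos_pos s₁ s₂ hne
  have hG2 : 1 + focalCos 1 W₁ W₂ = 2 * r ^ 2 := by
    rw [p₁]
    simp only [hW₂]
    simp only [Matrix.cons_val_one, Matrix.cons_val, Matrix.cons_val_zero]
    linear_combination -hrk
  have hN : √(2 * (1 + focalCos 1 W₁ W₂)) = 2 * r := by
    rw [hG2, show 2 * (2 * r ^ 2) = (2 * r) ^ 2 by ring, Real.sqrt_sq (by positivity)]
  have hM : sphereMid W₁ W₂ = !₂[0, 0, 1] := by
    have h := quadricForm_add_self (.inl rfl) g₁ g₂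
    rw [quadricForm_one] at h
    rw [sphereMid, quadricMidpoint, h, hN]
    ext i; fin_cases i <;> simp [hW₁, hW₂]
    field_simp
    norm_num
  have hff : √(focalFactor 1 (innerₗ Space) W₁ W₂) = r⁻¹ := by
    rw [← quadricForm_one, focalFactor_eq (.inl rfl) g₁ g₂ hG, hG2,
      show 2 / (2 * r ^ 2) = (r⁻¹) ^ 2 by field_simp, Real.sqrt_sq (by positivity)]
  set ι := centralChart r a b o with hι
  have ι0 : ∀ q, ι q 0 = r * (a * (q 1 - o 1) - b * (q 0 - o 0)) := fun q => rfl
  have ι1 : ∀ q, ι q 1 = a * (q 0 - o 0) + b * (q 1 - o 1) := fun q => rfl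
  have ι2 : ∀ q, ι q 2 = 1 := fun q => rfl
  have l0 : ∀ u, ι.linear u 0 = r * (a * u 1 - b * u 0) := fun q => rfl
  have l1 : ∀ u, ι.linear u 1 = a * u 0 + b * u 1 := fun q => rfl
  have l2 : ∀ u, ι.linear u 2 = 0 := fun q => rfl
  have hcent₁ : centralPoint 1 (innerₗ Space) (sphereMid W₁ W₂) W₁ = r⁻¹ • W₁ := by
    rw [sphereMid, ← quadricForm_one, centralPoint_left (.inl rfl) g₁ g₂ hG, hN]
    congr 1
    field_simp
  have hcent₂ : centralPoint 1 (innerₗ Space) (sphereMid W₁ W₂) W₂ = r⁻¹ • W₂ := by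
    rw [sphereMid, ← quadricForm_one, centralPoint_right (.inl rfl) g₁ g₂ hG, hN]
    congr 1
    field_simp
  set D := planeSurface Z₁ Z₂ hr.ne' with hD
  have hO := isOpen_planeRegular Z₁ Z₂ m₁ m₂
  have hS : (planarLagrange Z₁ Z₂ m₁ m₂ f).carrier = Set.univ ∩ planeRegular Z₁ Z₂ m₁ m₂ := rfl
  refine ⟨D.integral (planePotential Z₁ Z₂ r m₁ m₂ f), fun B hB => ?_, W₁, W₂, r, ι, ?_, ?_⟩
  · exact D.isAdditionalIntegral hO hS rfl (U := planeForce Z₁ Z₂ m₁ m₂ f)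
      (fun q _ => planarLagrange_force _ _ _ _ _ q) (planeForce_contDiffOn _ _ _ _ _)
      (planePotential_contDiffOn _ _ _ _ _ _) (fun q hq => plane_isCompatible hr.ne' hq.2)
      (D.isConicDirection_of_isCombination hB fun C hC => planeConic_isConicDirection hr.ne' hC)
  · refine ⟨s₁, s₂, fun h => hne (by rw [h, neg_neg]), hr, fun q => ?_, ?_, ?_, fun u => ?_⟩
    · change inner ℝ (ι q) (sphereMid W₁ W₂) = 1
      rw [hM, inner_space, ι2]
      simp
    · rw [hcent₁]
      ext i; fin_cases i
      · change ι Z₁ 0 = r⁻¹ * 0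
        rw [ι0, ho0, ho1]
        linear_combination r / 2 * (a * hk1 - b * hk0)
      · change ι Z₁ 1 = r⁻¹ * (r * k)
        rw [ι1, ho0, ho1, inv_mul_cancel_left₀ hr.ne']
        linear_combination (a * hk0 + b * hk1) / 2 + k * hab
      · change (1 : ℝ) = r⁻¹ * r
        rw [inv_mul_cancel₀ hr.ne']
    · rw [hcent₂]
      ext i; fin_cases i
      · change ι Z₂ 0 = r⁻¹ * 0
        rw [ι0, ho0, ho1]
        linear_combination -r / 2 * (a * hk1 - b * hk0)
      · change ι Z₂ 1 = r⁻¹ * (-(r * k))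
        rw [ι1, ho0, ho1, mul_neg, inv_mul_cancel_left₀ hr.ne']
        linear_combination -(a * hk0 + b * hk1) / 2 - k * hab
      · change (1 : ℝ) = r⁻¹ * r
        rw [inv_mul_cancel₀ hr.ne']
    · rw [← quadricForm_one, affineForm_self (.inl rfl) g₁ g₂ hG, quadricForm_apply, p₁, p₂, l0, l1,
        l2, ← real_inner_self_eq_norm_sq, inner_plane]
      linear_combination (r ^ 2 * (u 0 ^ 2 + u 1 ^ 2)) * hab
        - (a * u 0 + b * u 1) ^ 2 * hrk
  -- Both sides become rational functions of the coordinates `y`, `w` along and across the focal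
  -- axis and of the focal distances.
  · rintro ⟨q, v⟩ -
    set y := a * (q 0 - o 0) + b * (q 1 - o 1) with hy
    set w := a * (q 1 - o 1) - b * (q 0 - o 0) with hw
    set x := ι q with hx
    set u := ι.linear v with hu
    have hnx : ‖x‖ ^ 2 = r ^ 2 * w ^ 2 + y ^ 2 + 1 := by
      rw [← real_inner_self_eq_norm_sq, inner_space, ι0, ι1, ι2]
      ring
    have hx0 : 0 < ‖x‖ := by
      have h : 0 < ‖x‖ ^ 2 := by rw [hnx]; positivity
      exact (norm_nonneg x).lt_of_ne' fun h0 => by simp [h0] at h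
    have hxs : ‖x‖⁻¹ • x ∈ unitSphere := by
      rw [unitSphere, mem_sphere_zero_iff_norm, norm_smul, norm_inv, norm_norm,
        inv_mul_cancel₀ hx0.ne']
    have P₁ : focalCos 1 W₁ (‖x‖⁻¹ • x) = r * (1 + k * y) / ‖x‖ := by
      rw [map_smul, p₁, ι1, ι2, smul_eq_mul]
      ring
    have P₂ : focalCos 1 W₂ (‖x‖⁻¹ • x) = r * (1 - k * y) / ‖x‖ := by
      rw [map_smul, p₂, ι1, ι2, smul_eq_mul]
      ring
    have c10 : Z₁ 0 - q 0 = a * (k - y) + b * w := by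
      rw [hy, hw]
      linear_combination hk0 / 2 - ho0 + (q 0 - o 0) * hab
    have c11 : Z₁ 1 - q 1 = b * (k - y) - a * w := by
      rw [hy, hw]
      linear_combination hk1 / 2 - ho1 + (q 1 - o 1) * hab
    have c20 : Z₂ 0 - q 0 = -a * (k + y) + b * w := by
      linear_combination c10 - hk0
    have c21 : Z₂ 1 - q 1 = -b * (k + y) - a * w := by
      linear_combination c11 - hk1
    have A₁ : inner ℝ (Z₁ - q) (Z₁ - q) = w ^ 2 + (y - k) ^ 2 := by
      rw [inner_plane, PiLp.sub_apply, PiLp.sub_apply, c10, c11]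
      linear_combination (w ^ 2 + (y - k) ^ 2) * hab
    have A₂ : inner ℝ (Z₂ - q) (Z₂ - q) = w ^ 2 + (y + k) ^ 2 := by
      rw [inner_plane, PiLp.sub_apply, PiLp.sub_apply, c20, c21]
      linear_combination (w ^ 2 + (y + k) ^ 2) * hab
    have A₁₂ : inner ℝ (Z₁ - q) (Z₂ - q) = w ^ 2 + y ^ 2 - k ^ 2 := by
      rw [inner_plane, PiLp.sub_apply, PiLp.sub_apply, PiLp.sub_apply, PiLp.sub_apply, c10, c11,
        c20, c21]
      linear_combination (w ^ 2 + y ^ 2 - k ^ 2) * hab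
    have A₀ : inner ℝ (Z₁ - Z₂) (Z₁ - Z₂) = 4 * k ^ 2 := by
      rw [inner_plane, PiLp.sub_apply, PiLp.sub_apply, hk0, hk1]
      linear_combination 4 * k ^ 2 * hab
    have hkin : (innerₗ Space) (‖x‖ • u - (inner ℝ x u / ‖x‖) • x)
        (‖x‖ • u - (inner ℝ x u / ‖x‖) • x) =
        r ^ 2 * (1 + k ^ 2 + (w ^ 2 + y ^ 2 - k ^ 2)) * inner ℝ v v
          - r ^ 2 * (inner ℝ (Z₁ - q) v * inner ℝ (Z₂ - q) v) := by
      have e : (innerₗ Space) (‖x‖ • u - (inner ℝ x u / ‖x‖) • x)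
        (‖x‖ • u - (inner ℝ x u / ‖x‖) • x) = ‖x‖ ^ 2 * inner ℝ u u - inner ℝ x u ^ 2 := by
        simp only [innerₗ_apply_apply, inner_sub_left, inner_sub_right, real_inner_smul_left,
          real_inner_smul_right, real_inner_comm x u, real_inner_self_eq_norm_sq x]
        field_simp
        ring
      rw [e, hnx, inner_space, inner_space, l0, l1, l2, ι0, ι1, ← hy, ← hw, inner_plane,
        inner_plane, inner_plane, PiLp.sub_apply, PiLp.sub_apply, PiLp.sub_apply, PiLp.sub_apply, c10,
        c11, c20, c21]
      linear_combination (-(a * v 0 + b * v 1) ^ 2) * hrk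
        + r ^ 2 * (1 + w ^ 2 + y ^ 2) * (v 0 ^ 2 + v 1 ^ 2) * hab
    -- A Kepler term: the cotangent of the spherical distance is `r t / ‖x‖` divided by the
    -- root of `1 - (r t / ‖x‖)²`.
    have hker : ∀ s t A : ℝ, 0 ≤ A → ‖x‖ ^ 2 - (r * t) ^ 2 = r ^ 2 * A →
        r⁻¹ * (r ^ 3 * s) * (r * t / ‖x‖ / √(1 * (1 - (r * t / ‖x‖) ^ 2))) =
          s * (r ^ 2 * (t * (√A)⁻¹)) := by
      intro s t A hA h
      have h1 : 1 * (1 - (r * t / ‖x‖) ^ 2) = (r / ‖x‖) ^ 2 * A := by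
        field_simp
        linarith
      rw [h1, Real.sqrt_mul (sq_nonneg _), Real.sqrt_sq (by positivity)]
      by_cases hA0 : √A = 0
      · simp [hA0]
      · field_simp
    have hSne : focalCos 1 W₁ (‖x‖⁻¹ • x) + focalCos 1 W₂ (‖x‖⁻¹ • x) = 2 * r / ‖x‖ := by
      rw [P₁, P₂]; ring
    simp only [MechanicalSystem.energy, toSpherePhase]
    rw [sphericalLagrange_force s₁ s₂ hne hxs fun _ => by rw [hSne]; positivity, hff]
    simp only [FocalSurface.integral, focalIntegral, quadricForce, planePotential]
    rw [hSne, P₁, P₂, hG2, A₁, A₂, A₁₂, A₀,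
      hker m₁ (1 + k * y) (w ^ 2 + (y - k) ^ 2) (by positivity) (by
        rw [hnx]; linear_combination (-(y ^ 2) - 1) * hrk),
      hker m₂ (1 - k * y) (w ^ 2 + (y + k) ^ 2) (by positivity) (by
        rw [hnx]; linear_combination (-(y ^ 2) - 1) * hrk)]
    have hhooke : 1 * (2 * (2 * r ^ 2) / (2 * r / ‖x‖) ^ 2 - 1) = r ^ 2 * (w ^ 2 + y ^ 2 - k ^ 2
        + 4 * k ^ 2 / 4 + ((w ^ 2 + (y + k) ^ 2 - (w ^ 2 + (y - k) ^ 2)) / 4) ^ 2) := by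
      have h1 : 2 * (2 * r ^ 2) / (2 * r / ‖x‖) ^ 2 = ‖x‖ ^ 2 := by
        field_simp
      rw [h1, hnx]
      linear_combination (-(y ^ 2)) * hrk
    rw [hhooke]
    have hmet : (sphericalLagrange W₁ W₂ (r⁻¹ * (r ^ 3 * m₁)) (r⁻¹ * (r ^ 3 * m₂)) f).metric =
      innerₗ Space := rfl
    rw [hmet, hkin]
    simp only [hD, planeSurface, innerₗ_apply_apply, A₁₂, A₀]
    ring

end CentralChart

theorem theorem1 :
    -- the plane
    (∀ (Z₁ Z₂ : Plane) (m₁ m₂ f : ℝ),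
      ∃ F : Plane × Plane → ℝ,
        (∀ B : Set Plane, IsCombination (IsFocalConic Set.univ dist Z₁ Z₂) B →
          (planarLagrange Z₁ Z₂ m₁ m₂ f).IsAdditionalIntegral B F) ∧
        ∃ (W₁ W₂ : Space) (r : ℝ) (ι : Plane →ᵃ[ℝ] Space), IsCentralChart Z₁ Z₂ W₁ W₂ r ι ∧
          ∀ p ∈ (planarLagrange Z₁ Z₂ m₁ m₂ f).phaseSpace,
            F p = (sphericalLagrange W₁ W₂
              (√(focalFactor 1 (innerₗ Space) W₁ W₂) * (r ^ 3 * m₁))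
              (√(focalFactor 1 (innerₗ Space) W₁ W₂) * (r ^ 3 * m₂)) f).energy
                (toSpherePhase (ι p.1) (ι.linear p.2))) ∧
    -- the sphere
    (∀ Z₁ ∈ unitSphere, ∀ Z₂ ∈ unitSphere, Z₂ ≠ Z₁ → Z₂ ≠ -Z₁ → ∀ m₁ m₂ f : ℝ,
      ∃ F : Space × Space → ℝ,
        (∀ B : Set Space, IsCombination (IsSphericalConic Z₁ Z₂) B →
          (sphericalLagrange Z₁ Z₂ m₁ m₂ f).IsAdditionalIntegral B F) ∧
        ∀ p ∈ (sphericalLagrange Z₁ Z₂ m₁ m₂ f).phaseSpace,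
          (0 < inner ℝ p.1 (sphereMid Z₁ Z₂) →
            F p = (projectedLagrange 1 (innerₗ Space) Z₁ Z₂ m₁ m₂ f).energy
              (projectedPhase 1 (innerₗ Space) Z₁ Z₂ p)) ∧
          (inner ℝ p.1 (sphereMid Z₁ Z₂) < 0 →
            F p = (projectedLagrange 1 (innerₗ Space) Z₁ Z₂ (-m₁) (-m₂) f).energy
              (projectedPhase 1 (innerₗ Space) Z₁ Z₂ p))) ∧
    -- the hyperbolic plane
    (∀ Z₁ ∈ hyperbolicPlane, ∀ Z₂ ∈ hyperbolicPlane, ∀ m₁ m₂ f : ℝ,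
      ∃ F : Space × Space → ℝ,
        (∀ B : Set Space,
          IsCombination (IsFocalConic hyperbolicPlane hyperbolicDist Z₁ Z₂) B →
            (hyperbolicLagrange Z₁ Z₂ m₁ m₂ f).IsAdditionalIntegral B F) ∧
        ∀ p ∈ (hyperbolicLagrange Z₁ Z₂ m₁ m₂ f).phaseSpace,
          F p = (projectedLagrange (-1) minkowski Z₁ Z₂ m₁ m₂ f).energy
            (projectedPhase (-1) minkowski Z₁ Z₂ p)) := by
  exact ⟨planar_billiard_integrable,
    fun Z₁ h₁ Z₂ h₂ _ h m₁ m₂ f => spherical_billiard_integrable Z₁ h₁ Z₂ h₂ h m₁ m₂ f,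
    hyperbolic_billiard_integrable⟩
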